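/- All vector spaces are complete convex bornological vector spaces over $\mathbb{C}$; $\hat\otimes$ is the completed bornological tensor product, $\tau$ the flip of $H\hat\otimes H$, and "isomorphism" means a bounded linear bijection with bounded inverse. A bornological algebra $H$ (not assumed unital, with multiplication $\mu : H\hat\otimes H\to H$) is essential if $H\neq 0$ and $\mu$ induces an isomorphism $H\hat\otimes_H H\cong H$. Its multiplier algebra $M(H)$ consists of the pairs $(L,R)$ of bounded left and right multipliers with $fL(g)=R(f)g$. A bounded homomorphism $f:H\to M(K)$ is essential if $H\hat\otimes_H K\cong K\cong K\hat\otimes_H H$ via the actions given by $f$; it then extends to $M(H)\to M(K)$. A comultiplication is an essential homomorphism $\Delta:H\to M(H\hat\otimes H)$ with $(\Delta\hat\otimes\mathrm{id})\Delta=(\mathrm{id}\hat\otimes\Delta)\Delta$. Its Galois maps $H\hat\otimes H\to M(H\hat\otimes H)$ are $$\gamma_l(f\otimes g)=\Delta(f)(g\otimes 1),\quad \gamma_r(f\otimes g)=\Delta(f)(1\otimes g),\quad \rho_l(f\otimes g)=(f\otimes 1)\Delta(g),\quad \rho_r(f\otimes g)=(1\otimes f)\Delta(g).$$ $H$ has the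 approximation property if for every compact disk $S\subset H$ (a disk which is a compact subset of the Banach space $\langle T\rangle$ spanned by some small completant disk $T$) there is a sequence of finite rank operators $f_n:H\to H$ converging to the identity in $\mathrm{Hom}(\langle S\rangle,H)$. A bounded linear functional $\phi$ on $H$ is faithful if $\phi(fg)=0$ for all $g$ implies $f=0$, and $\phi(fg)=0$ for all $f$ implies $g=0$. If the Galois maps are bounded linear maps of $H\hat\otimes H$ into itself, $\phi$ is left invariant if $(\mathrm{id}\hat\otimes\phi)\Delta(f)=\phi(f)1$ in $M(H)$ for all $f$, that is, $(\mathrm{id}\hat\otimes\phi)\gamma_l(f\otimes g)=\phi(f)g=(\mathrm{id}\hat\otimes\phi)\rho_l(g\otimes f)$ for all $f,g\in H$. A bornological quantum group is an essential bornological algebra $H$ satisfying the approximation property together with a comultiplication $\Delta$ all of whose Galois maps are isomorphisms of $H\hat\otimes H$ onto itself and a faithful left invariant functional $\phi:H\to\mathbb{C}$. **Theorem.** Let $H$ be an essential bornological algebra satisfying the approximation property and let $\Delta:H\to M(H\hat\otimes H)$ be a comultiplication such that all associated Galois maps define bounded linear maps from $H\hat\otimes H$ to itself. Moreover let $\phi:H\to\mathbb{C}$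 be a faithful left invariant functional. Then $(H,\Delta,\phi)$ is a bornological quantum group if and only if there exist an essential algebra homomorphism $\epsilon:H\to\mathbb{C}$ and an isomorphism $S:H\to H$ of bornological vector spaces which is both an algebra antihomomorphism ($S(fg)=S(g)S(f)$) and a coalgebra antihomomorphism ($\Delta S=(S\hat\otimes S)\tau\Delta$, where $(S\hat\otimes S)\tau$ is extended to multipliers as an algebra antiautomorphism) such that $$(\epsilon\hat\otimes\mathrm{id})\Delta=\mathrm{id}=(\mathrm{id}\hat\otimes\epsilon)\Delta$$ and $$\mu(S\hat\otimes\mathrm{id})\gamma_r=\epsilon\hat\otimes\mathrm{id},\qquad \mu(\mathrm{id}\hat\otimes S)\rho_l=\mathrm{id}\hat\otimes\epsilon .$$ In this case the maps $\epsilon$ and $S$ are uniquely determined. -/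

import Mathlib

noncomputable section

open scoped Pointwise
open Bornology


namespace Born

universe u v w

/-! ## Complete bornological vector spaces -/

section Disks

variable {V : Type u} [AddCommGroup V] [Module ℂ V]

/-- A disk is a circled (balanced) and convex subset of a complex vector space. -/
structure IsDisk (D : Set V) : Prop where
  circled : Balanced ℂ D
  convex : Convex ℝ D

theorem IsDisk.comb {D : Set V} (hD : IsDisk D) {x y : V} (hx : x ∈ D) (hy : y ∈ D) {a b : ℂ}
    (h : ‖a‖ + ‖b‖ ≤ 1) : a • x + b • y ∈ D := by
  have key : ∀ (a : ℂ) (x : V), x ∈ D → ∃ x' ∈ D, a • x = ‖a‖ • x' := by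
    intro a x hx
    by_cases ha : a = 0
    · exact ⟨x, hx, by simp [ha]⟩
    · refine ⟨((‖a‖ : ℂ)⁻¹ * a) • x, hD.circled.smul_mem (by simp [ha]) hx, ?_⟩
      rw [← Complex.coe_smul, smul_smul, ← mul_assoc, mul_inv_cancel₀ (by simpa using ha), one_mul]
  obtain ⟨x', hx', ex⟩ := key a x hx
  obtain ⟨y', hy', ey⟩ := key b y hy
  rw [ex, ey]
  have h0 : (0 : V) ∈ D := hD.circled.zero_mem ⟨x, hx⟩
  have := hD.convex.sum_mem (t := Finset.univ) (w := ![‖a‖, ‖b‖, 1 - ‖a‖ - ‖b‖])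
    (z := ![x', y', 0]) (by intro i _; fin_cases i <;> simp <;> linarith)
    (by simp [Fin.sum_univ_three]) (by intro i _; fin_cases i <;> simp [*])
  simpa [Fin.sum_univ_three] using this

theorem IsDisk.of_comb {D : Set V}
    (h : ∀ x ∈ D, ∀ y ∈ D, ∀ a b : ℂ, ‖a‖ + ‖b‖ ≤ 1 → a • x + b • y ∈ D) : IsDisk D := by
  refine ⟨?_, ?_⟩
  · intro a ha
    rintro _ ⟨x, hx, rfl⟩
    simpa using h x hx x hx a 0 (by simpa using ha)
  · intro x hx y hy a b ha hb hab
    have := h x hx y hy a b (by simp [abs_of_nonneg, ha, hb, hab])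
    simpa [Complex.coe_smul] using this

theorem IsDisk.add_mem {D : Set V} (hD : IsDisk D) {r s : ℝ} (hr : 0 ≤ r) (hs : 0 ≤ s) {x y : V}
    (hx : x ∈ (r : ℂ) • D) (hy : y ∈ (s : ℂ) • D) : x + y ∈ ((r + s : ℝ) : ℂ) • D := by
  obtain ⟨x, hx, rfl⟩ := hx
  obtain ⟨y, hy, rfl⟩ := hy
  by_cases h : r + s = 0
  · have h1 : r = 0 := by linarith
    have h2 : s = 0 := by linarith
    subst h1 h2
    exact ⟨x, hx, by simp⟩
  · have h' : ((r : ℂ) + s) ≠ 0 := by exact_mod_cast h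
    have hpos : 0 < r + s := lt_of_le_of_ne (by linarith) (Ne.symm h)
    refine ⟨((r / (r + s) : ℝ) : ℂ) • x + ((s / (r + s) : ℝ) : ℂ) • y, hD.comb hx hy ?_, ?_⟩
    · rw [Complex.norm_real, Complex.norm_real, Real.norm_of_nonneg (by positivity),
        Real.norm_of_nonneg (by positivity), ← add_div, div_self h]
    · simp only [smul_add, smul_smul]
      push_cast
      rw [mul_div_cancel₀ _ h', mul_div_cancel₀ _ h']

theorem IsDisk.mono_mem {D : Set V} (hD : IsDisk D) {r s : ℝ} (hr : 0 ≤ r) (hs : r ≤ s) {x : V}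
    (hx : x ∈ (r : ℂ) • D) : x ∈ (s : ℂ) • D := by
  obtain ⟨y, hy, rfl⟩ := hx
  have := hD.add_mem (y := 0) hr (sub_nonneg.2 hs) ⟨y, hy, rfl⟩
    ⟨0, hD.circled.zero_mem ⟨y, hy⟩, by simp⟩
  simpa using this

theorem IsDisk.smul_mem {D : Set V} (hD : IsDisk D) (c : ℂ) {r : ℝ} {x : V}
    (hx : x ∈ (r : ℂ) • D) : c • x ∈ ((‖c‖ * r : ℝ) : ℂ) • D := by
  obtain ⟨y, hy, rfl⟩ := hx
  by_cases hc : c = 0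
  · subst hc
    exact ⟨y, hy, by simp⟩
  · refine ⟨((‖c‖ : ℂ)⁻¹ * c) • y, hD.circled.smul_mem (by simp [hc]) hy, ?_⟩
    have : (‖c‖ : ℂ) ≠ 0 := by simpa using hc
    simp only [smul_smul]
    congr 1
    push_cast
    field_simp

theorem IsDisk.neg_mem {D : Set V} (hD : IsDisk D) {r : ℝ} {x : V}
    (hx : x ∈ (r : ℂ) • D) : -x ∈ (r : ℂ) • D := by
  simpa using hD.smul_mem (-1) hx

theorem IsDisk.sub_mem {D : Set V} (hD : IsDisk D) {r s : ℝ} (hr : 0 ≤ r) (hs : 0 ≤ s) {x y : V}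
    (hx : x ∈ (r : ℂ) • D) (hy : y ∈ (s : ℂ) • D) : x - y ∈ ((r + s : ℝ) : ℂ) • D := by
  rw [sub_eq_add_neg]
  exact hD.add_mem hr hs hx (hD.neg_mem hy)

theorem IsDisk.sub_comm_mem {D : Set V} (hD : IsDisk D) {r : ℝ} {x y : V}
    (hx : x - y ∈ (r : ℂ) • D) : y - x ∈ (r : ℂ) • D := by
  rw [← neg_sub]
  exact hD.neg_mem hx

theorem mem_smul_of_scaled {D : Set V} {t ε : ℝ} (ht : t ≠ 0) {x : V}
    (hx : (t : ℂ) • x ∈ ((t * ε : ℝ) : ℂ) • D) : x ∈ (ε : ℂ) • D := by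
  obtain ⟨d, hd, e⟩ := hx
  refine ⟨d, hd, ?_⟩
  have ht' : (t : ℂ) ≠ 0 := by exact_mod_cast ht
  have e' : ((t * ε : ℝ) : ℂ) • d = (t : ℂ) • x := e
  rw [Complex.ofReal_mul, mul_smul] at e'
  exact (smul_right_injective V ht') e'

/-- A disk `D` is completant if its linear span, equipped with the Minkowski functional
`‖x‖_D = inf {ε > 0 | x ∈ ε D}`, is a Banach space: the functional is definite and every sequence
which is Cauchy for `‖·‖_D` converges for `‖·‖_D`.
For a disk one has `‖x‖_D < ε → x ∈ ε D → ‖x‖_D ≤ ε`, so that `‖·‖_D` may be expressed through the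
sets `ε D`. (The limit of a sequence in the span lies in the span automatically, and a Cauchy
sequence in the whole space is a sequence in the span up to translation.) -/
structure IsCompletant (D : Set V) : Prop extends IsDisk D where
  definite : ∀ x : V, (∀ ε : ℝ, 0 < ε → x ∈ (ε : ℂ) • D) → x = 0
  complete : ∀ x : ℕ → V,
    (∀ ε : ℝ, 0 < ε → ∃ N, ∀ m ≥ N, ∀ n ≥ N, x m - x n ∈ (ε : ℂ) • D) →
    ∃ y : V, ∀ ε : ℝ, 0 < ε → ∃ N, ∀ n ≥ N, x n - y ∈ (ε : ℂ) • D

end Disks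

/-- A complete (convex) bornological vector space over `ℂ`. The small sets are the bounded sets of
the underlying bornology. Convexity of the bornology is contained in the second condition. -/
class BornSpace (V : Type u) [AddCommGroup V] [Module ℂ V] extends Bornology V where
  isBounded_smul : ∀ (c : ℂ) (S : Set V), IsBounded S → IsBounded (c • S)
  exists_completant : ∀ S : Set V, IsBounded S → ∃ D, S ⊆ D ∧ IsBounded D ∧ IsCompletant D

section Conv

variable {V : Type u} [AddCommGroup V] [Module ℂ V] [BornSpace V]

theorem exists_disk {S : Set V} (hS : IsBounded S) :
    ∃ D, S ⊆ D ∧ IsBounded D ∧ IsCompletant D ∧ (0 : V) ∈ D := by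
  obtain ⟨D, h1, h2, h3⟩ := BornSpace.exists_completant (S ∪ {0}) (hS.union isBounded_singleton)
  exact ⟨D, fun x hx => h1 (Or.inl hx), h2, h3, h1 (Or.inr rfl)⟩

theorem isBounded_smul {S : Set V} (c : ℂ) (hS : IsBounded S) : IsBounded (c • S) :=
  BornSpace.isBounded_smul c S hS

theorem isBounded_add {S T : Set V} (hS : IsBounded S) (hT : IsBounded T) : IsBounded (S + T) := by
  obtain ⟨D, h1, h2, h3, -⟩ := exists_disk (hS.union hT)
  refine (isBounded_smul ((2 : ℝ) : ℂ) h2).subset ?_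
  rintro _ ⟨x, hx, y, hy, rfl⟩
  have := h3.toIsDisk.add_mem (r := 1) (s := 1) (by norm_num) (by norm_num) (x := x) (y := y)
    (by simpa using h1 (Or.inl hx)) (by simpa using h1 (Or.inr hy))
  norm_num at this ⊢
  exact this

/-- Convergence of a sequence: it converges in `⟨D⟩` for some small set `D`. -/
def Converges (x : ℕ → V) (y : V) : Prop :=
  ∃ D : Set V, IsBounded D ∧ ∀ ε : ℝ, 0 < ε → ∃ N, ∀ n ≥ N, x n - y ∈ (ε : ℂ) • D

theorem smul_subset_smul {D E : Set V} (h : D ⊆ E) (c : ℂ) : c • D ⊆ c • E :=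
  Set.smul_set_mono h

theorem eq_of_forall_mem {D : Set V} (hD : IsBounded D) {x : V}
    (h : ∀ ε : ℝ, 0 < ε → x ∈ (ε : ℂ) • D) : x = 0 := by
  obtain ⟨E, h1, h2, h3⟩ := BornSpace.exists_completant D hD
  exact h3.definite x fun ε hε => smul_subset_smul h1 _ (h ε hε)

theorem Converges.unique {x : ℕ → V} {y z : V} (hy : Converges x y) (hz : Converges x z) :
    y = z := by
  obtain ⟨D, hD, h⟩ := hy
  obtain ⟨E, hE, h'⟩ := hz
  obtain ⟨B, h1, h2, h3, -⟩ := exists_disk (hD.union hE)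
  rw [← sub_eq_zero]
  refine h3.definite _ fun ε hε => ?_
  obtain ⟨N, hN⟩ := h (ε / 2) (by linarith)
  obtain ⟨N', hN'⟩ := h' (ε / 2) (by linarith)
  have a := smul_subset_smul (fun x hx => h1 (Or.inl hx)) _ (hN (max N N') (le_max_left _ _))
  have b := smul_subset_smul (fun x hx => h1 (Or.inr hx)) _ (hN' (max N N') (le_max_right _ _))
  have := h3.toIsDisk.sub_mem (by linarith) (by linarith) b a
  simpa using this

theorem Converges.const (y : V) : Converges (fun _ => y) y :=
  ⟨{0}, isBounded_singleton, fun ε _ => ⟨0, fun n _ => by simp⟩⟩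

theorem Converges.add {x x' : ℕ → V} {y y' : V} (h : Converges x y) (h' : Converges x' y') :
    Converges (fun n => x n + x' n) (y + y') := by
  obtain ⟨D, hD, h⟩ := h
  obtain ⟨E, hE, h'⟩ := h'
  refine ⟨D + E, isBounded_add hD hE, fun ε hε => ?_⟩
  obtain ⟨N, hN⟩ := h ε hε
  obtain ⟨N', hN'⟩ := h' ε hε
  refine ⟨max N N', fun n hn => ?_⟩
  rw [smul_add, add_sub_add_comm]
  exact Set.add_mem_add (hN n (le_trans (le_max_left _ _) hn))
    (hN' n (le_trans (le_max_right _ _) hn))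

theorem Converges.smul (c : ℂ) {x : ℕ → V} {y : V} (h : Converges x y) :
    Converges (fun n => c • x n) (c • y) := by
  obtain ⟨D, hD, h⟩ := h
  refine ⟨c • D, isBounded_smul c hD, fun ε hε => ?_⟩
  obtain ⟨N, hN⟩ := h ε hε
  refine ⟨N, fun n hn => ?_⟩
  rw [← smul_sub, smul_comm]
  exact Set.smul_mem_smul_set (hN n hn)

theorem Converges.map {W : Type v} [AddCommGroup W] [Module ℂ W] [BornSpace W] (f : V →ₗ[ℂ] W)
    (hf : ∀ S, IsBounded S → IsBounded (f '' S)) {x : ℕ → V} {y : V} (h : Converges x y) :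
    Converges (fun n => f (x n)) (f y) := by
  obtain ⟨D, hD, h⟩ := h
  refine ⟨f '' D, hf D hD, fun ε hε => ?_⟩
  obtain ⟨N, hN⟩ := h ε hε
  refine ⟨N, fun n hn => ?_⟩
  obtain ⟨d, hd, e⟩ := hN n hn
  exact ⟨f d, ⟨d, hd, rfl⟩, by simp only at e ⊢; rw [← map_smul, e, map_sub]⟩

/-- A subspace is closed if it contains the limits of its convergent sequences. -/
def IsClosedSubspace (P : Submodule ℂ V) : Prop :=
  ∀ (x : ℕ → V) (y : V), (∀ n, x n ∈ P) → Converges x y → y ∈ P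

/-- The closure of the linear span of a set: the smallest closed subspace containing it. -/
def closedSpan (S : Set V) : Submodule ℂ V :=
  sInf {P | S ⊆ P ∧ IsClosedSubspace P}

theorem subset_closedSpan (S : Set V) : S ⊆ closedSpan S := by
  intro x hx
  exact (Submodule.mem_sInf).2 fun P hP => hP.1 hx

theorem closedSpan_le {S : Set V} {P : Submodule ℂ V} (h : S ⊆ P) (hP : IsClosedSubspace P) :
    closedSpan S ≤ P := sInf_le ⟨h, hP⟩

theorem isClosed_closedSpan (S : Set V) : IsClosedSubspace (closedSpan S) := by
  intro x y hx h
  exact (Submodule.mem_sInf).2 fun P hP =>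
    hP.2 x y (fun n => (Submodule.mem_sInf).1 (hx n) P hP) h

end Conv

/-! ## Bounded linear maps -/

section BHom

variable {V : Type u} [AddCommGroup V] [Module ℂ V] [BornSpace V]
variable {W : Type v} [AddCommGroup W] [Module ℂ W] [BornSpace W]
variable {X : Type w} [AddCommGroup X] [Module ℂ X] [BornSpace X]

/-- The linear maps which map small sets to small sets, as a subspace of all linear maps. -/
def boundedMaps (V : Type u) [AddCommGroup V] [Module ℂ V] [BornSpace V]
    (W : Type v) [AddCommGroup W] [Module ℂ W] [BornSpace W] : Submodule ℂ (V →ₗ[ℂ] W) where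
  carrier := {f | ∀ S, IsBounded S → IsBounded (f '' S)}
  add_mem' := by
    intro f g hf hg S hS
    refine (isBounded_add (hf S hS) (hg S hS)).subset ?_
    rintro _ ⟨x, hx, rfl⟩
    exact Set.add_mem_add ⟨x, hx, rfl⟩ ⟨x, hx, rfl⟩
  zero_mem' := by
    intro S _
    refine (isBounded_singleton (x := (0 : W))).subset ?_
    rintro _ ⟨x, _, rfl⟩
    simp
  smul_mem' := by
    intro c f hf S hS
    refine (isBounded_smul c (hf S hS)).subset ?_
    rintro _ ⟨x, hx, rfl⟩
    exact Set.smul_mem_smul_set ⟨x, hx, rfl⟩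

/-- The space `Hom(V, W)` of bounded linear maps. -/
def BHom (V : Type u) [AddCommGroup V] [Module ℂ V] [BornSpace V]
    (W : Type v) [AddCommGroup W] [Module ℂ W] [BornSpace W] : Type (max u v) :=
  ↥(boundedMaps V W)

namespace BHom

instance : AddCommGroup (BHom V W) := inferInstanceAs (AddCommGroup ↥(boundedMaps V W))
instance : Module ℂ (BHom V W) := inferInstanceAs (Module ℂ ↥(boundedMaps V W))

instance : FunLike (BHom V W) V W where
  coe f := f.1
  coe_injective _ _ h := Subtype.ext (DFunLike.coe_injective h)

instance : LinearMapClass (BHom V W) ℂ V W where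
  map_add f := f.1.map_add
  map_smulₛₗ f := f.1.map_smul

@[ext] theorem ext {f g : BHom V W} (h : ∀ x, f x = g x) : f = g := DFunLike.ext f g h

@[simp] theorem add_apply (f g : BHom V W) (x : V) : (f + g) x = f x + g x := rfl
@[simp] theorem zero_apply (x : V) : (0 : BHom V W) x = 0 := rfl
@[simp] theorem smul_apply (c : ℂ) (f : BHom V W) (x : V) : (c • f) x = c • f x := rfl
@[simp] theorem neg_apply (f : BHom V W) (x : V) : (-f) x = - f x := rfl
@[simp] theorem sub_apply (f g : BHom V W) (x : V) : (f - g) x = f x - g x := rfl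

theorem bounded (f : BHom V W) {S : Set V} (hS : IsBounded S) : IsBounded (f '' S) := f.2 S hS

theorem map_converges (f : BHom V W) {x : ℕ → V} {y : V} (h : Converges x y) :
    Converges (fun n => f (x n)) (f y) := h.map f.1 f.2

/-- A linear map together with its boundedness. -/
def mk (f : V →ₗ[ℂ] W) (hf : ∀ S, IsBounded S → IsBounded (f '' S)) : BHom V W := ⟨f, hf⟩

@[simp] theorem mk_apply (f : V →ₗ[ℂ] W) (hf) (x : V) : mk f hf x = f x := rfl

/-- Two bounded linear maps agree on a closed subspace. -/
theorem isClosed_eqLocus (f g : BHom V W) :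
    IsClosedSubspace (LinearMap.eqLocus f.1 g.1) := by
  intro x y hx h
  have h1 := f.map_converges h
  have h2 := g.map_converges h
  have : (fun n => f (x n)) = fun n => g (x n) := funext fun n => hx n
  rw [this] at h1
  exact h1.unique h2

/-- The natural bornology on `Hom(V, W)`: a set `L` of maps is small if `L(S)` is small for all
small sets `S`. -/
instance instBornology : Bornology (BHom V W) :=
  Bornology.ofBounded
    {L | ∀ S : Set V, IsBounded S → IsBounded (Set.image2 (fun (f : BHom V W) x => f x) L S)}
    (by intro S _; simp)
    (by intro L hL M hM S hS; exact (hL S hS).subset (Set.image2_subset_right hM))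
    (by
      intro L hL M hM S hS
      rw [Set.image2_union_left]
      exact (hL S hS).union (hM S hS))
    (by
      intro f S hS
      rw [Set.image2_singleton_left]
      exact f.bounded hS)

theorem isBounded_iff {L : Set (BHom V W)} : IsBounded L ↔
    ∀ S : Set V, IsBounded S → IsBounded (Set.image2 (fun (f : BHom V W) x => f x) L S) := by
  exact Bornology.isBounded_ofBounded_iff _

instance instBornSpace : BornSpace (BHom V W) where
  isBounded_smul := by
    intro c L hL
    rw [isBounded_iff] at hL ⊢
    intro S hS
    refine (isBounded_smul c (hL S hS)).subset ?_
    rintro _ ⟨_, ⟨f, hf, rfl⟩, x, hx, rfl⟩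
    exact ⟨f x, ⟨f, hf, x, hx, rfl⟩, rfl⟩
  exists_completant := by
    intro L hL
    rw [isBounded_iff] at hL
    have H : ∀ S : Set V, ∃ D : Set W, IsBounded S →
        (∀ f ∈ L, ∀ x ∈ S, f x ∈ D) ∧ IsBounded D ∧ IsCompletant D ∧ (0 : W) ∈ D := by
      intro S
      by_cases hS : IsBounded S
      · obtain ⟨D, h1, h2, h3, h4⟩ := exists_disk (hL S hS)
        exact ⟨D, fun _ => ⟨fun f hf x hx => h1 ⟨f, hf, x, hx, rfl⟩, h2, h3, h4⟩⟩
      · exact ⟨∅, fun h => absurd h hS⟩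
    choose D hD using H
    -- the closed unit balls
    have key : ∀ (S : Set V) (hS : IsBounded S) (ε : ℝ) (hε : 0 < ε) (f : BHom V W),
        f ∈ (ε : ℂ) • {f : BHom V W | ∀ S, IsBounded S → ∀ x ∈ S, ∀ δ : ℝ, 1 < δ →
          f x ∈ (δ : ℂ) • D S} ↔ ∀ S, IsBounded S → ∀ x ∈ S, ∀ δ : ℝ, ε < δ →
          f x ∈ (δ : ℂ) • D S := by
      intro S hS ε hε f
      have hε' : (ε : ℂ) ≠ 0 := by exact_mod_cast hε.ne'
      constructor
      · rintro ⟨g, hg, rfl⟩ S hS x hx δ hδ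
        have := hg S hS x hx (δ / ε) (by rwa [lt_div_iff₀ hε, one_mul])
        obtain ⟨d, hd, e⟩ := this
        refine ⟨d, hd, ?_⟩
        change (δ : ℂ) • d = (ε : ℂ) • g x
        rw [← e]
        simp only [smul_smul]
        congr 1
        push_cast
        field_simp
      · intro h
        refine ⟨(ε : ℂ)⁻¹ • f, ?_, by simp [smul_smul, hε']⟩
        intro S hS x hx δ hδ
        obtain ⟨d, hd, e⟩ := h S hS x hx (ε * δ) (by nlinarith)
        refine ⟨d, hd, ?_⟩
        change (δ : ℂ) • d = (ε : ℂ)⁻¹ • f x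
        rw [← e]
        simp only [smul_smul]
        congr 1
        push_cast
        field_simp
    refine ⟨{f | ∀ S, IsBounded S → ∀ x ∈ S, ∀ δ : ℝ, 1 < δ → f x ∈ (δ : ℂ) • D S}, ?_, ?_, ?_, ?_,
      ?_⟩
    · intro f hf S hS x hx δ hδ
      refine (hD S hS).2.2.1.toIsDisk.mono_mem (r := 1) (by norm_num) hδ.le ?_
      simpa using (hD S hS).1 f hf x hx
    · rw [isBounded_iff]
      intro S hS
      refine (isBounded_smul ((2 : ℝ) : ℂ) (hD S hS).2.1).subset ?_
      rintro _ ⟨f, hf, x, hx, rfl⟩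
      exact hf S hS x hx 2 (by norm_num)
    · refine IsDisk.of_comb ?_
      intro f hf g hg a b hab S hS x hx δ hδ
      have hdisk := (hD S hS).2.2.1.toIsDisk
      have h1 := hdisk.smul_mem a (hf S hS x hx δ hδ)
      have h2 := hdisk.smul_mem b (hg S hS x hx δ hδ)
      have h3 := hdisk.add_mem (by positivity) (by positivity) h1 h2
      refine hdisk.mono_mem (by positivity) ?_ h3
      nlinarith [norm_nonneg a, norm_nonneg b]
    · intro f hf
      ext x
      refine (hD {x} isBounded_singleton).2.2.1.definite _ fun ε hε => ?_
      have := (key {x} isBounded_singleton (ε / 2) (by linarith) f).1 (hf (ε / 2) (by linarith))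
      exact this {x} isBounded_singleton x rfl ε (by linarith)
    · intro f hf
      have hf' : ∀ ε : ℝ, 0 < ε → ∃ N, ∀ m ≥ N, ∀ n ≥ N, ∀ S, IsBounded S → ∀ x ∈ S,
          f m x - f n x ∈ (ε : ℂ) • D S := by
        intro ε hε
        obtain ⟨N, hN⟩ := hf (ε / 2) (by linarith)
        refine ⟨N, fun m hm n hn S hS x hx => ?_⟩
        exact (key S hS _ (by linarith) _).1 (hN m hm n hn) S hS x hx ε (by linarith)
      have lim : ∀ x : V, ∃ y : W, Converges (fun n => f n x) y := by
        intro x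
        obtain ⟨y, hy⟩ := (hD {x} isBounded_singleton).2.2.1.complete (fun n => f n x) (by
          intro ε hε
          obtain ⟨N, hN⟩ := hf' ε hε
          exact ⟨N, fun m hm n hn => hN m hm n hn {x} isBounded_singleton x rfl⟩)
        exact ⟨y, D {x}, (hD {x} isBounded_singleton).2.1, hy⟩
      choose g hg using lim
      have unif : ∀ ε : ℝ, 0 < ε → ∃ N, ∀ n ≥ N, ∀ S, IsBounded S → ∀ x ∈ S,
          f n x - g x ∈ (ε : ℂ) • D S := by
        intro ε hε
        obtain ⟨N, hN⟩ := hf' (ε / 2) (by linarith)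
        refine ⟨N, fun n hn S hS x hx => ?_⟩
        obtain ⟨y, hy⟩ := (hD S hS).2.2.1.complete (fun n => f n x) (by
          intro ε hε
          obtain ⟨N, hN⟩ := hf' ε hε
          exact ⟨N, fun m hm n hn => hN m hm n hn S hS x hx⟩)
        have : y = g x := Converges.unique ⟨D S, (hD S hS).2.1, hy⟩ (hg x)
        subst this
        obtain ⟨M, hM⟩ := hy (ε / 2) (by linarith)
        have h1 := hN n hn (max M N) (le_max_right _ _) S hS x hx
        have h2 := hM (max M N) (le_max_left _ _)
        have := (hD S hS).2.2.1.toIsDisk.add_mem (by linarith) (by linarith) h1 h2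
        simpa using this
      let G : V →ₗ[ℂ] W :=
        { toFun := g
          map_add' := by
            intro x y
            refine Converges.unique (hg (x + y)) ?_
            simpa using (hg x).add (hg y)
          map_smul' := by
            intro c x
            refine Converges.unique (hg (c • x)) ?_
            simpa using (hg x).smul c }
      have hG : ∀ S, IsBounded S → IsBounded (G '' S) := by
        intro S hS
        obtain ⟨N, hN⟩ := unif 1 (by norm_num)
        refine (isBounded_add ((f N).bounded hS) (isBounded_smul (-1) (hD S hS).2.1)).subset ?_
        rintro _ ⟨x, hx, rfl⟩
        obtain ⟨d, hd, e⟩ := hN N le_rfl S hS x hx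
        refine ⟨f N x, ⟨x, hx, rfl⟩, _, ⟨d, hd, rfl⟩, ?_⟩
        have e' : d = f N x - g x := by simpa using e
        change f N x + (-1 : ℂ) • d = g x
        rw [e']
        simp
      refine ⟨⟨G, hG⟩, fun ε hε => ?_⟩
      obtain ⟨N, hN⟩ := unif ε hε
      refine ⟨N, fun n hn => ?_⟩
      rw [key ∅ isBounded_empty ε hε]
      intro S hS x hx δ hδ
      exact (hD S hS).2.2.1.toIsDisk.mono_mem hε.le hδ.le (hN n hn S hS x hx)

/-- A bounded bilinear map `V × W → X`, as a bounded linear map `V → Hom(W, X)`. -/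
def mk₂ (b : V →ₗ[ℂ] W →ₗ[ℂ] X)
    (hb : ∀ S T, IsBounded S → IsBounded T → IsBounded (Set.image2 (fun x y => b x y) S T)) :
    BHom V (BHom W X) :=
  ⟨{ toFun := fun x => ⟨b x, fun T hT => by
        simpa [Set.image2_singleton_left] using hb {x} T isBounded_singleton hT⟩
     map_add' := fun x y => by ext z; exact LinearMap.congr_fun (b.map_add x y) z
     map_smul' := fun c x => by ext z; exact LinearMap.congr_fun (b.map_smul c x) z }, by
    intro S hS
    rw [isBounded_iff]
    intro T hT
    refine (hb S T hS hT).subset ?_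
    rintro _ ⟨_, ⟨x, hx, rfl⟩, y, hy, rfl⟩
    exact ⟨x, hx, y, hy, rfl⟩⟩

@[simp] theorem mk₂_apply (b : V →ₗ[ℂ] W →ₗ[ℂ] X) (hb) (x : V) (y : W) :
    mk₂ b hb x y = b x y := rfl

theorem bounded₂ (b : BHom V (BHom W X)) {S : Set V} {T : Set W} (hS : IsBounded S)
    (hT : IsBounded T) : IsBounded (Set.image2 (fun x y => b x y) S T) := by
  have := isBounded_iff.1 (b.bounded hS) T hT
  rwa [Set.image2_image_left] at this

/-- The identity map. -/
def id (V : Type u) [AddCommGroup V] [Module ℂ V] [BornSpace V] : BHom V V :=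
  ⟨LinearMap.id, fun S hS => by simpa using hS⟩

@[simp] theorem id_apply (x : V) : id V x = x := rfl

/-- Composition of bounded linear maps. -/
def comp (g : BHom W X) (f : BHom V W) : BHom V X :=
  ⟨g.1.comp f.1, fun S hS => by
    have := g.bounded (f.bounded hS)
    rw [Set.image_image] at this
    exact this⟩

@[simp] theorem comp_apply (g : BHom W X) (f : BHom V W) (x : V) : comp g f x = g (f x) := rfl

/-- Composition of bounded linear maps, as a bounded bilinear map. -/
def compL (V : Type u) [AddCommGroup V] [Module ℂ V] [BornSpace V]
    (W : Type v) [AddCommGroup W] [Module ℂ W] [BornSpace W]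
    (X : Type w) [AddCommGroup X] [Module ℂ X] [BornSpace X] :
    BHom (BHom W X) (BHom (BHom V W) (BHom V X)) :=
  mk₂ (LinearMap.mk₂ ℂ comp (fun _ _ _ => rfl) (fun _ _ _ => rfl)
    (fun g f f' => by ext x; simp) (fun c g f => by ext x; simp)) (by
    intro G F hG hF
    rw [isBounded_iff] at *
    intro S hS
    refine (hG _ (hF S hS)).subset ?_
    rintro _ ⟨_, ⟨g, hg, f, hf, rfl⟩, x, hx, rfl⟩
    exact ⟨g, hg, f x, ⟨f, hf, x, hx, rfl⟩, rfl⟩)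

@[simp] theorem compL_apply (g : BHom W X) (f : BHom V W) : compL V W X g f = comp g f := rfl

/-- Exchanging the arguments of a bounded bilinear map. -/
def flip (b : BHom V (BHom W X)) : BHom W (BHom V X) :=
  mk₂ (LinearMap.mk₂ ℂ (fun y x => b x y) (by simp) (by simp) (by simp) (by simp)) (by
    intro T S hT hS
    refine (b.bounded₂ hS hT).subset ?_
    rintro _ ⟨y, hy, x, hx, rfl⟩
    exact ⟨x, hx, y, hy, rfl⟩)

@[simp] theorem flip_apply (b : BHom V (BHom W X)) (x : V) (y : W) : flip b y x = b x y := rfl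

end BHom

/-- Isomorphisms of bornological vector spaces: linear bijections which are bounded in both
directions. -/
structure BIso (V : Type u) [AddCommGroup V] [Module ℂ V] [BornSpace V]
    (W : Type v) [AddCommGroup W] [Module ℂ W] [BornSpace W] where
  toHom : BHom V W
  inv : BHom W V
  inv_toHom : ∀ x, inv (toHom x) = x
  toHom_inv : ∀ y, toHom (inv y) = y

end BHom

/-! ## Quotients -/

section Quot

variable {V : Type u} [AddCommGroup V] [Module ℂ V] [BornSpace V]
variable {X : Type w} [AddCommGroup X] [Module ℂ X] [BornSpace X]

/-- The quotient of `V` by the smallest closed subspace containing a set `R` of relations. -/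
def QuotBy (R : Set V) : Type u := V ⧸ closedSpan R

namespace QuotBy

variable (R : Set V)

instance : AddCommGroup (QuotBy R) := inferInstanceAs (AddCommGroup (V ⧸ closedSpan R))
instance : Module ℂ (QuotBy R) := inferInstanceAs (Module ℂ (V ⧸ closedSpan R))

/-- The quotient map as a linear map. -/
def proj : V →ₗ[ℂ] QuotBy R := (closedSpan R).mkQ

theorem proj_surjective : Function.Surjective (proj R) := (closedSpan R).mkQ_surjective

theorem proj_eq_zero_iff {x : V} : proj R x = 0 ↔ x ∈ closedSpan R :=
  Submodule.Quotient.mk_eq_zero _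

/-- The quotient bornology: the small sets are the subsets of images of small sets. -/
instance instBornology : Bornology (QuotBy R) :=
  Bornology.ofBounded {B | ∃ S : Set V, IsBounded S ∧ B ⊆ proj R '' S}
    ⟨∅, isBounded_empty, by simp⟩
    (by rintro B ⟨S, hS, h⟩ B' hB'; exact ⟨S, hS, hB'.trans h⟩)
    (by
      rintro B ⟨S, hS, h⟩ B' ⟨S', hS', h'⟩
      refine ⟨S ∪ S', hS.union hS', ?_⟩
      rw [Set.image_union]
      exact Set.union_subset_union h h')
    (by
      intro x
      obtain ⟨y, rfl⟩ := proj_surjective R x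
      exact ⟨{y}, isBounded_singleton, by simp⟩)

theorem isBounded_iff {B : Set (QuotBy R)} :
    IsBounded B ↔ ∃ S : Set V, IsBounded S ∧ B ⊆ proj R '' S :=
  Bornology.isBounded_ofBounded_iff _

theorem mem_smul_image_iff {D : Set V} {ε : ℂ} {z : QuotBy R} :
    z ∈ ε • (proj R '' D) ↔ ∃ d ∈ D, proj R (ε • d) = z := by
  constructor
  · rintro ⟨_, ⟨d, hd, rfl⟩, rfl⟩
    exact ⟨d, hd, by simp⟩
  · rintro ⟨d, hd, rfl⟩
    exact ⟨_, ⟨d, hd, rfl⟩, by simp⟩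

theorem isCompletant_image {D : Set V} (hb : IsBounded D) (hD : IsCompletant D) :
    IsCompletant (proj R '' D) := by
  have hdisk : IsDisk (proj R '' D) := by
    refine IsDisk.of_comb ?_
    rintro _ ⟨x, hx, rfl⟩ _ ⟨y, hy, rfl⟩ a b hab
    exact ⟨a • x + b • y, hD.toIsDisk.comb hx hy hab, by simp⟩
  refine ⟨hdisk, ?_, ?_⟩
  · intro z hz
    obtain ⟨x, rfl⟩ := proj_surjective R z
    rw [proj_eq_zero_iff]
    have h1 : ∀ n : ℕ, ∃ d ∈ D, proj R (((1 / ((n : ℝ) + 1) : ℝ) : ℂ) • d) = proj R x := by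
      intro n
      exact (mem_smul_image_iff R).1 (hz _ (by positivity))
    choose d hd e using h1
    refine isClosed_closedSpan R (fun n => x - ((1 / ((n : ℝ) + 1) : ℝ) : ℂ) • d n) x ?_ ?_
    · intro n
      rw [← proj_eq_zero_iff, map_sub, e, sub_self]
    · refine ⟨D, hb, fun ε hε => ?_⟩
      obtain ⟨N, hN⟩ := exists_nat_one_div_lt hε
      refine ⟨N, fun n hn => ?_⟩
      rw [sub_sub_cancel_left]
      refine hD.toIsDisk.neg_mem (hD.toIsDisk.mono_mem (by positivity) ?_ ⟨d n, hd n, rfl⟩)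
      exact (Nat.one_div_le_one_div hn).trans hN.le
  · intro z hz
    have h1 : ∀ k : ℕ, ∃ N, ∀ m ≥ N, ∀ n ≥ N, z m - z n ∈ (((1 / 2) ^ k : ℝ) : ℂ) • (proj R '' D) :=
      fun k => hz _ (by positivity)
    choose N hN using h1
    let φ : ℕ → ℕ := fun k => (Finset.range (k + 1)).sup N
    have hφ : ∀ k l, k ≤ l → N k ≤ φ l := fun k l h =>
      Finset.le_sup (f := N) (Finset.mem_range.2 (by omega))
    have h2 : ∀ k : ℕ, ∃ d ∈ D, proj R ((((1 / 2) ^ k : ℝ) : ℂ) • d) = z (φ (k + 1)) - z (φ k) :=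
      fun k => (mem_smul_image_iff R).1
        (hN k _ (hφ k _ (by omega)) _ (hφ k _ le_rfl))
    choose d hd e using h2
    obtain ⟨x0, hx0⟩ := proj_surjective R (z (φ 0))
    let x : ℕ → V := fun k => x0 + ∑ j ∈ Finset.range k, (((1 / 2) ^ j : ℝ) : ℂ) • d j
    have hx : ∀ k, proj R (x k) = z (φ k) := by
      intro k
      induction k with
      | zero => simp [x, hx0]
      | succ k ih =>
        have : x (k + 1) = x k + (((1 / 2) ^ k : ℝ) : ℂ) • d k := by
          simp only [x, Finset.sum_range_succ, add_assoc]
        rw [this, map_add, ih, e]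
        abel
    have hdiff : ∀ n i, x (n + i) - x n ∈
        ((2 * (1 / 2) ^ n - 2 * (1 / 2) ^ (n + i) : ℝ) : ℂ) • D := by
      intro n i
      induction i with
      | zero => exact ⟨d 0, hd 0, by simp⟩
      | succ i ih =>
        have : x (n + (i + 1)) - x n =
            (x (n + i) - x n) + (((1 / 2) ^ (n + i) : ℝ) : ℂ) • d (n + i) := by
          simp only [x, ← add_assoc, Finset.sum_range_succ]
          abel
        rw [this]
        have hle : (1 / 2 : ℝ) ^ (n + i) ≤ (1 / 2) ^ n :=
          pow_le_pow_of_le_one (by norm_num) (by norm_num) (by omega)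
        have := hD.toIsDisk.add_mem (s := (1 / 2) ^ (n + i)) (by linarith) (by positivity) ih
          ⟨d (n + i), hd _, rfl⟩
        convert this using 3
        rw [← add_assoc, pow_succ]
        ring
    have hdiff' : ∀ n m, n ≤ m → x m - x n ∈ ((2 * (1 / 2) ^ n : ℝ) : ℂ) • D := by
      intro n m h
      obtain ⟨i, rfl⟩ := Nat.exists_eq_add_of_le h
      refine hD.toIsDisk.mono_mem ?_ ?_ (hdiff n i)
      · have hle : (1 / 2 : ℝ) ^ (n + i) ≤ (1 / 2) ^ n :=
          pow_le_pow_of_le_one (by norm_num) (by norm_num) (by omega)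
        linarith
      · have : (0 : ℝ) ≤ (1 / 2) ^ (n + i) := by positivity
        linarith
    obtain ⟨y, hy⟩ := hD.complete x (by
      intro ε hε
      obtain ⟨k, hk⟩ := exists_pow_lt_of_lt_one (show (0 : ℝ) < ε / 4 by linarith)
        (show (1 / 2 : ℝ) < 1 by norm_num)
      refine ⟨k, fun m hm n hn => ?_⟩
      have a := hdiff' k m hm
      have b := hdiff' k n hn
      have c := hD.toIsDisk.sub_mem (by positivity) (by positivity) a b
      rw [sub_sub_sub_cancel_right] at c
      exact hD.toIsDisk.mono_mem (by positivity) (by linarith) c)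
    refine ⟨proj R y, fun ε hε => ?_⟩
    obtain ⟨k, hk⟩ := exists_pow_lt_of_lt_one (show (0 : ℝ) < ε / 2 by linarith)
      (show (1 / 2 : ℝ) < 1 by norm_num)
    obtain ⟨M, hM⟩ := hy (ε / 2) (by linarith)
    refine ⟨N k, fun n hn => ?_⟩
    have a := hN k n hn (φ (max k M)) (hφ k _ (le_max_left _ _))
    obtain ⟨c, hc, e'⟩ := hM (max k M) (le_max_right _ _)
    have b : z (φ (max k M)) - proj R y ∈ ((ε / 2 : ℝ) : ℂ) • (proj R '' D) := by
      rw [mem_smul_image_iff]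
      refine ⟨c, hc, ?_⟩
      rw [← hx, ← map_sub]
      exact congrArg _ e'
    have := hdisk.add_mem (by positivity) (by positivity) a b
    rw [sub_add_sub_cancel] at this
    exact hdisk.mono_mem (by positivity) (by linarith) this

instance instBornSpace : BornSpace (QuotBy R) where
  isBounded_smul := by
    intro c B hB
    rw [isBounded_iff] at *
    obtain ⟨S, hS, h⟩ := hB
    refine ⟨c • S, isBounded_smul c hS, ?_⟩
    rintro _ ⟨b, hb, rfl⟩
    obtain ⟨s, hs, rfl⟩ := h hb
    exact ⟨c • s, ⟨s, hs, rfl⟩, by simp⟩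
  exists_completant := by
    intro B hB
    obtain ⟨S, hS, h⟩ := (isBounded_iff R).1 hB
    obtain ⟨D, h1, h2, h3⟩ := BornSpace.exists_completant S hS
    exact ⟨proj R '' D, h.trans (Set.image_mono h1), (isBounded_iff R).2 ⟨D, h2, subset_rfl⟩,
      isCompletant_image R h2 h3⟩

/-- The quotient map. -/
def mk : BHom V (QuotBy R) :=
  BHom.mk (proj R) fun S hS => (isBounded_iff R).2 ⟨S, hS, subset_rfl⟩

theorem mk_surjective : Function.Surjective (mk R) := proj_surjective R

theorem mk_eq_zero {x : V} (hx : x ∈ R) : mk R x = 0 :=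
  (proj_eq_zero_iff R).2 (subset_closedSpan R hx)

variable {R}

/-- The universal property of the quotient. -/
def lift (f : BHom V X) (hf : ∀ x ∈ R, f x = 0) : BHom (QuotBy R) X :=
  BHom.mk ((closedSpan R).liftQ f.1 (by
    refine (closedSpan_le (P := LinearMap.eqLocus f.1 (0 : BHom V X).1) ?_
      (BHom.isClosed_eqLocus f 0)).trans ?_
    · intro x hx
      exact hf x hx
    · intro x hx
      exact hx)) (by
    intro B hB
    obtain ⟨S, hS, h⟩ := (isBounded_iff R).1 hB
    refine (f.bounded hS).subset ?_
    rintro _ ⟨b, hb, rfl⟩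
    obtain ⟨s, hs, rfl⟩ := h hb
    exact ⟨s, hs, rfl⟩)

@[simp] theorem lift_mk (f : BHom V X) (hf : ∀ x ∈ R, f x = 0) (x : V) :
    lift f hf (mk R x) = f x := rfl

theorem hom_ext {f g : BHom (QuotBy R) X} (h : ∀ x, f (mk R x) = g (mk R x)) : f = g := by
  ext z
  obtain ⟨x, rfl⟩ := mk_surjective R z
  exact h x

end QuotBy

end Quot

/-! ## The completed bornological tensor product -/

section Sums

theorem IsCompletant.dilate {V : Type u} [AddCommGroup V] [Module ℂ V] {D : Set V}
    (hD : IsCompletant D) {t : ℝ} (ht : 0 < t) : IsCompletant ((t : ℂ) • D) := by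
  have e : ∀ ε : ℝ, (ε : ℂ) • ((t : ℂ) • D) = ((ε * t : ℝ) : ℂ) • D := by
    intro ε
    rw [smul_smul, Complex.ofReal_mul]
  have e' : ∀ ε : ℝ, (((ε / t : ℝ) : ℂ)) • ((t : ℂ) • D) = (ε : ℂ) • D := by
    intro ε
    rw [e, div_mul_cancel₀ _ ht.ne']
  refine ⟨IsDisk.of_comb ?_, ?_, ?_⟩
  · rintro _ ⟨x, hx, rfl⟩ _ ⟨y, hy, rfl⟩ a b hab
    exact ⟨a • x + b • y, hD.toIsDisk.comb hx hy hab, by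
      simp only [smul_add]
      rw [smul_comm a, smul_comm b]⟩
  · intro x hx
    exact hD.definite x fun ε hε => by
      rw [← e']
      exact hx _ (by positivity)
  · intro x hx
    obtain ⟨y, hy⟩ := hD.complete x (by
      intro ε hε
      obtain ⟨N, hN⟩ := hx (ε / t) (by positivity)
      rw [e'] at hN
      exact ⟨N, hN⟩)
    refine ⟨y, fun ε hε => ?_⟩
    rw [e]
    exact hy _ (by positivity)

variable {X : Type w} [AddCommGroup X] [Module ℂ X] [BornSpace X] {ι : Type u}

/-- Convergence of a possibly infinite sum in `⟨D⟩` for some small set `D`. -/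
def HasBSum (x : ι → X) (y : X) : Prop :=
  ∃ D : Set X, IsBounded D ∧ ∀ ε : ℝ, 0 < ε → ∃ s₀ : Finset ι, ∀ s : Finset ι, s₀ ⊆ s →
    y - ∑ i ∈ s, x i ∈ (ε : ℂ) • D

theorem HasBSum.unique {x : ι → X} {y z : X} (hy : HasBSum x y) (hz : HasBSum x z) : y = z := by
  classical
  obtain ⟨D, hD, h⟩ := hy
  obtain ⟨E, hE, h'⟩ := hz
  obtain ⟨B, h1, h2, h3, -⟩ := exists_disk (hD.union hE)
  rw [← sub_eq_zero]
  refine h3.definite _ fun ε hε => ?_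
  obtain ⟨N, hN⟩ := h (ε / 2) (by linarith)
  obtain ⟨N', hN'⟩ := h' (ε / 2) (by linarith)
  have a := smul_subset_smul (fun x hx => h1 (Or.inl hx)) _ (hN (N ∪ N') Finset.subset_union_left)
  have b := smul_subset_smul (fun x hx => h1 (Or.inr hx)) _ (hN' (N ∪ N') Finset.subset_union_right)
  have := h3.toIsDisk.sub_mem (by linarith) (by linarith) a b
  simpa using this

theorem HasBSum.add {x x' : ι → X} {y y' : X} (h : HasBSum x y) (h' : HasBSum x' y') :
    HasBSum (fun i => x i + x' i) (y + y') := by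
  classical
  obtain ⟨D, hD, h⟩ := h
  obtain ⟨E, hE, h'⟩ := h'
  refine ⟨D + E, isBounded_add hD hE, fun ε hε => ?_⟩
  obtain ⟨N, hN⟩ := h ε hε
  obtain ⟨N', hN'⟩ := h' ε hε
  refine ⟨N ∪ N', fun n hn => ?_⟩
  rw [smul_add, Finset.sum_add_distrib, add_sub_add_comm]
  exact Set.add_mem_add (hN n (Finset.union_subset_left hn))
    (hN' n (Finset.union_subset_right hn))

theorem HasBSum.smul (c : ℂ) {x : ι → X} {y : X} (h : HasBSum x y) :
    HasBSum (fun i => c • x i) (c • y) := by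
  obtain ⟨D, hD, h⟩ := h
  refine ⟨c • D, isBounded_smul c hD, fun ε hε => ?_⟩
  obtain ⟨N, hN⟩ := h ε hε
  refine ⟨N, fun n hn => ?_⟩
  rw [← Finset.smul_sum, ← smul_sub, smul_comm]
  exact Set.smul_mem_smul_set (hN n hn)

theorem sum_mem_disk {D : Set X} (hD : IsDisk D) (h0 : (0 : X) ∈ D) {c : ι → ℂ} {x : ι → X}
    (hx : ∀ i, c i ≠ 0 → x i ∈ D) (s : Finset ι) :
    ∑ i ∈ s, c i • x i ∈ ((∑ i ∈ s, ‖c i‖ : ℝ) : ℂ) • D := by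
  classical
  induction s using Finset.induction_on with
  | empty => exact ⟨0, h0, by simp⟩
  | insert i s hi ih =>
    rw [Finset.sum_insert hi, Finset.sum_insert hi]
    refine hD.add_mem (norm_nonneg _) (by positivity) ?_ ih
    by_cases hc : c i = 0
    · exact ⟨0, h0, by simp [hc]⟩
    · have := hD.smul_mem (c i) (r := 1) (x := x i) (by simpa using hx i hc)
      simpa using this

theorem exists_hasBSum {D : Set X} (hb : IsBounded D) (hD : IsCompletant D) (h0 : (0 : X) ∈ D)
    {c : ι → ℂ} {x : ι → X} (hx : ∀ i, c i ≠ 0 → x i ∈ D) (hc : Summable fun i => ‖c i‖) {C : ℝ}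
    (hC : ∑' i, ‖c i‖ ≤ C) :
    ∃ y ∈ ((C + 1 : ℝ) : ℂ) • D, HasBSum (fun i => c i • x i) y := by
  classical
  have tail : ∀ ε : ℝ, 0 < ε → ∃ s₀ : Finset ι, ∀ s t : Finset ι, s₀ ⊆ s → s₀ ⊆ t →
      ∑ i ∈ t, c i • x i - ∑ i ∈ s, c i • x i ∈ (ε : ℂ) • D := by
    intro ε hε
    obtain ⟨s₀, hs₀⟩ := summable_iff_vanishing_norm.1 hc (ε / 2) (by linarith)
    refine ⟨s₀, fun s t hs ht => ?_⟩
    have aux : ∀ s, s₀ ⊆ s →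
        ∑ i ∈ s, c i • x i - ∑ i ∈ s₀, c i • x i ∈ ((ε / 2 : ℝ) : ℂ) • D := by
      intro s hs
      rw [← Finset.sum_sdiff hs, add_sub_cancel_right]
      refine hD.toIsDisk.mono_mem (by positivity) ?_ (sum_mem_disk hD.toIsDisk h0 hx _)
      have := hs₀ (s \ s₀) Finset.sdiff_disjoint
      exact (le_abs_self _).trans this.le
    have := hD.toIsDisk.sub_mem (by positivity) (by positivity) (aux t ht) (aux s hs)
    simpa using this
  have h1 : ∀ n : ℕ, ∃ s₀ : Finset ι, ∀ s t : Finset ι, s₀ ⊆ s → s₀ ⊆ t →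
      ∑ i ∈ t, c i • x i - ∑ i ∈ s, c i • x i ∈ ((1 / ((n : ℝ) + 1) : ℝ) : ℂ) • D :=
    fun n => tail _ (by positivity)
  choose s hs using h1
  let t : ℕ → Finset ι := fun n => (Finset.range (n + 1)).biUnion s
  have ht : ∀ m n, m ≤ n → s m ⊆ t n := fun m n h =>
    Finset.subset_biUnion_of_mem s (Finset.mem_range.2 (by omega))
  obtain ⟨y, hy⟩ := hD.complete (fun n => ∑ i ∈ t n, c i • x i) (by
    intro ε hε
    obtain ⟨N, hN⟩ := exists_nat_one_div_lt hε
    exact ⟨N, fun m hm n hn => hD.toIsDisk.mono_mem (by positivity) hN.le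
      (hs N _ _ (ht N n hn) (ht N m hm))⟩)
  have hsum : ∀ ε : ℝ, 0 < ε → ∃ s₀ : Finset ι, ∀ s : Finset ι, s₀ ⊆ s →
      y - ∑ i ∈ s, c i • x i ∈ (ε : ℂ) • D := by
    intro ε hε
    obtain ⟨s₀, hs₀⟩ := tail (ε / 2) (by linarith)
    obtain ⟨N, hN⟩ := hy (ε / 4) (by linarith)
    obtain ⟨M, hM⟩ := exists_nat_one_div_lt (show 0 < ε / 4 by linarith)
    refine ⟨s M, fun r hr => ?_⟩
    have a := hD.toIsDisk.sub_comm_mem (hN (max N M) (le_max_left _ _))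
    have b := hs M r (t (max N M)) hr (ht _ _ (le_max_right _ _))
    have := hD.toIsDisk.add_mem (by positivity) (by positivity) a b
    rw [sub_add_sub_cancel] at this
    exact hD.toIsDisk.mono_mem (by positivity) (by linarith) this
  refine ⟨y, ?_, D, hb, hsum⟩
  obtain ⟨s₀, hs₀⟩ := hsum 1 one_pos
  have a := sum_mem_disk hD.toIsDisk h0 hx s₀
  have hle : ∑ i ∈ s₀, ‖c i‖ ≤ C := (hc.sum_le_tsum s₀ (fun i _ => norm_nonneg _)).trans hC
  have := hD.toIsDisk.add_mem (by positivity) (by positivity) a (hs₀ s₀ subset_rfl)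
  rw [add_sub_cancel] at this
  exact hD.toIsDisk.mono_mem (by positivity) (by linarith) this

end Sums

section Tensor

variable {V : Type u} [AddCommGroup V] [Module ℂ V] [BornSpace V]
variable {W : Type v} [AddCommGroup W] [Module ℂ W] [BornSpace W]
variable {X : Type w} [AddCommGroup X] [Module ℂ X] [BornSpace X]

/-- The absolutely summable families `(c (v, w))` of complex numbers indexed by `V × W` whose
support is contained in `S × T` for some small sets `S ⊆ V`, `T ⊆ W`. -/
def formalSums (V : Type u) [AddCommGroup V] [Module ℂ V] [BornSpace V]
    (W : Type v) [AddCommGroup W] [Module ℂ W] [BornSpace W] :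
    Submodule ℂ (lp (fun _ : V × W => ℂ) 1) where
  carrier := {c | ∃ (S : Set V) (T : Set W), IsBounded S ∧ IsBounded T ∧
    ∀ i, c i ≠ 0 → i.1 ∈ S ∧ i.2 ∈ T}
  add_mem' := by
    rintro c c' ⟨S, T, hS, hT, h⟩ ⟨S', T', hS', hT', h'⟩
    refine ⟨S ∪ S', T ∪ T', hS.union hS', hT.union hT', fun i hi => ?_⟩
    by_cases hc : c i = 0
    · have hc' : c' i ≠ 0 := by
        intro hc'
        exact hi (by simp [hc, hc'])
      exact ⟨Or.inr (h' i hc').1, Or.inr (h' i hc').2⟩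
    · exact ⟨Or.inl (h i hc).1, Or.inl (h i hc).2⟩
  zero_mem' := ⟨∅, ∅, isBounded_empty, isBounded_empty, by simp⟩
  smul_mem' := by
    rintro a c ⟨S, T, hS, hT, h⟩
    refine ⟨S, T, hS, hT, fun i hi => h i ?_⟩
    intro hc
    exact hi (by simp [hc])

/-- The space of formal sums `∑ c (v, w) [v, w]`. -/
def FormalSum (V : Type u) [AddCommGroup V] [Module ℂ V] [BornSpace V]
    (W : Type v) [AddCommGroup W] [Module ℂ W] [BornSpace W] : Type (max u v) :=
  ↥(formalSums V W)

namespace FormalSum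

instance : AddCommGroup (FormalSum V W) := inferInstanceAs (AddCommGroup ↥(formalSums V W))
instance : Module ℂ (FormalSum V W) := inferInstanceAs (Module ℂ ↥(formalSums V W))

/-- The formal sums supported in `S × T` with `ℓ¹`-norm at most `r`. -/
def box (S : Set V) (T : Set W) (r : ℝ) : Set (FormalSum V W) :=
  {c | ‖c.1‖ ≤ r ∧ ∀ i, c.1 i ≠ 0 → i.1 ∈ S ∧ i.2 ∈ T}

theorem box_mono {S S' : Set V} {T T' : Set W} {r r' : ℝ} (hS : S ⊆ S') (hT : T ⊆ T')
    (hr : r ≤ r') : box S T r ⊆ box S' T' r' :=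
  fun _ hc => ⟨hc.1.trans hr, fun i hi => ⟨hS (hc.2 i hi).1, hT (hc.2 i hi).2⟩⟩

/-- A set of formal sums is small if all of them are supported in `S × T` for some small sets
`S`, `T`, and if their `ℓ¹`-norms are bounded. -/
instance instBornology : Bornology (FormalSum V W) :=
  Bornology.ofBounded
    {B | ∃ (S : Set V) (T : Set W) (r : ℝ), IsBounded S ∧ IsBounded T ∧ B ⊆ box S T r}
    ⟨∅, ∅, 0, isBounded_empty, isBounded_empty, by simp⟩
    (by
      rintro B ⟨S, T, r, hS, hT, h⟩ B' hB'
      exact ⟨S, T, r, hS, hT, hB'.trans h⟩)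
    (by
      rintro B ⟨S, T, r, hS, hT, h⟩ B' ⟨S', T', r', hS', hT', h'⟩
      refine ⟨S ∪ S', T ∪ T', max r r', hS.union hS', hT.union hT', Set.union_subset ?_ ?_⟩
      · exact h.trans (box_mono Set.subset_union_left Set.subset_union_left (le_max_left _ _))
      · exact h'.trans (box_mono Set.subset_union_right Set.subset_union_right (le_max_right _ _)))
    (by
      rintro ⟨c, S, T, hS, hT, h⟩
      refine ⟨S, T, ‖c‖, hS, hT, ?_⟩
      rintro _ rfl
      exact ⟨le_rfl, h⟩)

theorem isBounded_iff {B : Set (FormalSum V W)} : IsBounded B ↔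
    ∃ (S : Set V) (T : Set W) (r : ℝ), IsBounded S ∧ IsBounded T ∧ B ⊆ box S T r :=
  Bornology.isBounded_ofBounded_iff _

theorem mem_smul_box {S : Set V} {T : Set W} {r ε : ℝ} (hε : 0 < ε) {c : FormalSum V W} :
    c ∈ (ε : ℂ) • box S T r ↔ c ∈ box S T (ε * r) := by
  have hε' : (ε : ℂ) ≠ 0 := by exact_mod_cast hε.ne'
  constructor
  · rintro ⟨d, hd, rfl⟩
    refine ⟨?_, fun i hi => hd.2 i ?_⟩
    · change ‖(ε : ℂ) • d.1‖ ≤ _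
      rw [norm_smul, Complex.norm_real, Real.norm_of_nonneg hε.le]
      exact mul_le_mul_of_nonneg_left hd.1 hε.le
    · intro h
      apply hi
      change (ε : ℂ) • d.1 i = 0
      rw [h, smul_zero]
  · intro hc
    refine ⟨(ε : ℂ)⁻¹ • c, ⟨?_, fun i hi => hc.2 i ?_⟩, by simp [smul_smul, hε']⟩
    · change ‖(ε : ℂ)⁻¹ • c.1‖ ≤ _
      rw [norm_smul, norm_inv, Complex.norm_real, Real.norm_of_nonneg hε.le,
        inv_mul_le_iff₀ hε]
      exact hc.1
    · intro h
      apply hi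
      change (ε : ℂ)⁻¹ • c.1 i = 0
      rw [h, smul_zero]

theorem isCompletant_box {S : Set V} {T : Set W} (hS : IsBounded S) (hT : IsBounded T) :
    IsCompletant (box S T 1) := by
  have hdisk : IsDisk (box S T 1) := by
    refine IsDisk.of_comb ?_
    intro c hc d hd a b hab
    refine ⟨?_, fun i hi => ?_⟩
    · change ‖a • c.1 + b • d.1‖ ≤ 1
      refine (norm_add_le _ _).trans ?_
      rw [norm_smul, norm_smul]
      nlinarith [norm_nonneg a, norm_nonneg b, hc.1, hd.1]
    · by_cases h : c.1 i = 0
      · refine hd.2 i fun h' => hi ?_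
        change a • c.1 i + b • d.1 i = 0
        simp [h, h']
      · exact hc.2 i h
  refine ⟨hdisk, ?_, ?_⟩
  · intro c hc
    have : ‖c.1‖ ≤ 0 := by
      refine le_of_forall_pos_le_add fun ε hε => ?_
      have := ((mem_smul_box hε).1 (hc ε hε)).1
      linarith
    exact Subtype.ext (norm_le_zero_iff.1 this)
  · intro c hc
    have hcau : CauchySeq fun n => (c n).1 := by
      rw [Metric.cauchySeq_iff]
      intro ε hε
      obtain ⟨N, hN⟩ := hc (ε / 2) (by linarith)
      refine ⟨N, fun m hm n hn => ?_⟩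
      rw [dist_eq_norm]
      have := ((mem_smul_box (by linarith)).1 (hN m hm n hn)).1
      have h2 : ‖(c m).1 - (c n).1‖ ≤ ε / 2 * 1 := this
      linarith
    obtain ⟨y, hy⟩ := cauchySeq_tendsto_of_complete hcau
    have happ : ∀ i, Filter.Tendsto (fun n => (c n).1 i) Filter.atTop (nhds (y i)) := by
      intro i
      have := ((lp.evalCLM ℂ (fun _ : V × W => ℂ) 1 i).continuous.tendsto y).comp hy
      exact this
    have hsupp : ∀ N, (∀ n ≥ N, ∀ i, (c n).1 i - (c N).1 i ≠ 0 → i.1 ∈ S ∧ i.2 ∈ T) →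
        ∀ i, (c N).1 i - y i ≠ 0 → i.1 ∈ S ∧ i.2 ∈ T := by
      intro N hN i hi
      by_contra hcon
      apply hi
      rw [sub_eq_zero]
      refine tendsto_nhds_unique ?_ (happ i)
      refine Filter.Tendsto.congr' ?_ tendsto_const_nhds
      filter_upwards [Filter.eventually_ge_atTop N] with n hn
      by_contra h
      exact hcon (hN n hn i (sub_ne_zero.2 (Ne.symm h)))
    obtain ⟨N, hN⟩ := hc 1 one_pos
    have hsuppN := hsupp N fun n hn i hi =>
      ((mem_smul_box one_pos).1 (hN n hn N le_rfl)).2 i hi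
    have hymem : y ∈ formalSums V W := by
      obtain ⟨S', T', hS', hT', h'⟩ := (c N).2
      refine ⟨S ∪ S', T ∪ T', hS.union hS', hT.union hT', fun i hi => ?_⟩
      by_cases h0 : (c N).1 i = 0
      · have := hsuppN i (by rw [h0, zero_sub]; exact neg_ne_zero.2 hi)
        exact ⟨Or.inl this.1, Or.inl this.2⟩
      · exact ⟨Or.inr (h' i h0).1, Or.inr (h' i h0).2⟩
    refine ⟨⟨y, hymem⟩, fun ε hε => ?_⟩
    obtain ⟨M, hM⟩ := Metric.tendsto_atTop.1 hy ε hε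
    refine ⟨max N M, fun n hn => ?_⟩
    rw [mem_smul_box hε]
    refine ⟨?_, ?_⟩
    · have := hM n ((le_max_right _ _).trans hn)
      rw [dist_eq_norm] at this
      change ‖(c n).1 - y‖ ≤ ε * 1
      linarith
    · intro i hi
      refine hsupp n (fun m hm i hi => ?_) i hi
      exact ((mem_smul_box one_pos).1
        (hN m (((le_max_left _ _).trans hn).trans hm) n ((le_max_left _ _).trans hn))).2 i hi

instance instBornSpace : BornSpace (FormalSum V W) where
  isBounded_smul := by
    intro a B hB
    obtain ⟨S, T, r, hS, hT, h⟩ := isBounded_iff.1 hB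
    refine isBounded_iff.2 ⟨S, T, ‖a‖ * r, hS, hT, ?_⟩
    rintro _ ⟨c, hc, rfl⟩
    refine ⟨?_, fun i hi => (h hc).2 i ?_⟩
    · change ‖a • c.1‖ ≤ _
      rw [norm_smul]
      exact mul_le_mul_of_nonneg_left (h hc).1 (norm_nonneg _)
    · intro h0
      apply hi
      change a • c.1 i = 0
      rw [h0, smul_zero]
  exists_completant := by
    intro B hB
    obtain ⟨S, T, r, hS, hT, h⟩ := isBounded_iff.1 hB
    have hpos : 0 < max r 1 := lt_max_of_lt_right one_pos
    have hc : IsCompletant (((max r 1 : ℝ) : ℂ) • (box S T 1 : Set (FormalSum V W))) :=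
      (isCompletant_box hS hT).dilate hpos
    refine ⟨((max r 1 : ℝ) : ℂ) • box S T 1, ?_, ?_, hc⟩
    · intro c hc
      rw [mem_smul_box hpos, mul_one]
      exact box_mono subset_rfl subset_rfl (le_max_left _ _) (h hc)
    · refine isBounded_iff.2 ⟨S, T, max r 1, hS, hT, ?_⟩
      intro c hc
      rwa [mem_smul_box hpos, mul_one] at hc

open Classical in
/-- The formal sum `[v, w]`. -/
def single (v : V) (w : W) : FormalSum V W :=
  ⟨lp.single 1 (v, w) 1, {v}, {w}, isBounded_singleton, isBounded_singleton, by
    intro i hi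
    by_cases h : i = (v, w)
    · subst h
      exact ⟨rfl, rfl⟩
    · exact absurd (lp.single_apply_ne (E := fun _ : V × W => ℂ) 1 (v, w) (1 : ℂ) h) hi⟩

theorem single_mem_box {S : Set V} {T : Set W} {v : V} {w : W} (hv : v ∈ S) (hw : w ∈ T) :
    single v w ∈ box S T 1 := by
  classical
  refine ⟨?_, fun i hi => ?_⟩
  · change ‖(lp.single 1 (v, w) (1 : ℂ) : lp (fun _ : V × W => ℂ) 1)‖ ≤ 1
    rw [lp.norm_single (by norm_num)]
    simp
  · by_cases h : i = (v, w)
    · subst h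
      exact ⟨hv, hw⟩
    · exact absurd (lp.single_apply_ne (E := fun _ : V × W => ℂ) 1 (v, w) (1 : ℂ) h) hi

theorem summable (c : FormalSum V W) : Summable fun i => ‖c.1 i‖ := by
  have := (lp.memℓp c.1).summable (by norm_num)
  simpa using this

theorem tsum_le (c : FormalSum V W) : ∑' i, ‖c.1 i‖ ≤ ‖c.1‖ := by
  rw [lp.norm_eq_tsum_rpow (by norm_num)]
  simp

/-- A closed subspace containing all `[v, w]` is everything. -/
theorem closed_eq_top {P : Submodule ℂ (FormalSum V W)} (hP : IsClosedSubspace P)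
    (h : ∀ v w, single v w ∈ P) : P = ⊤ := by
  classical
  rw [eq_top_iff]
  intro c _
  obtain ⟨S, T, hS, hT, hc⟩ := c.2
  have hsum : HasSum (fun i => (lp.single 1 i (c.1 i) : lp (fun _ : V × W => ℂ) 1)) c.1 :=
    lp.hasSum_single (by norm_num) c.1
  have h1 : ∀ n : ℕ, ∃ s : Finset (V × W),
      ‖∑ i ∈ s, (lp.single 1 i (c.1 i) : lp (fun _ : V × W => ℂ) 1) - c.1‖ < 1 / ((n : ℝ) + 1) := by
    intro n
    have := (Metric.tendsto_nhds.1 hsum (1 / ((n : ℝ) + 1)) (by positivity)).exists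
    obtain ⟨s, hs⟩ := this
    exact ⟨s, by rwa [dist_eq_norm] at hs⟩
  choose s hs using h1
  have hval : ∀ s : Finset (V × W), (∑ i ∈ s, c.1 i • single i.1 i.2 : FormalSum V W).1 =
      ∑ i ∈ s, (lp.single 1 i (c.1 i) : lp (fun _ : V × W => ℂ) 1) := by
    intro s
    have e : ∀ i : V × W, (c.1 i • single i.1 i.2 : FormalSum V W).1 =
        (lp.single 1 i (c.1 i) : lp (fun _ : V × W => ℂ) 1) := by
      intro i
      change c.1 i • (lp.single 1 i (1 : ℂ) : lp (fun _ : V × W => ℂ) 1) = _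
      rw [← lp.single_smul]
      simp
    rw [← Finset.sum_congr rfl fun i _ => e i]
    exact map_sum (formalSums V W).subtype _ s
  refine hP (fun n => ∑ i ∈ s n, c.1 i • single i.1 i.2) c ?_ ?_
  · intro n
    exact P.sum_mem fun i _ => P.smul_mem _ (h i.1 i.2)
  · refine ⟨box S T 1, isBounded_iff.2 ⟨S, T, 1, hS, hT, subset_rfl⟩, fun ε hε => ?_⟩
    obtain ⟨N, hN⟩ := exists_nat_one_div_lt hε
    refine ⟨N, fun n hn => ?_⟩
    rw [mem_smul_box hε]
    have e : (∑ i ∈ s n, c.1 i • single i.1 i.2 - c : FormalSum V W).1 =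
        ∑ i ∈ s n, (lp.single 1 i (c.1 i) : lp (fun _ : V × W => ℂ) 1) - c.1 := by
      rw [← hval]
      rfl
    refine ⟨?_, fun i hi => hc i fun h0 => hi ?_⟩
    · rw [e, mul_one]
      exact ((hs n).le.trans (Nat.one_div_le_one_div hn)).trans hN.le
    · rw [e]
      have e2 : (∑ j ∈ s n, (lp.single 1 j (c.1 j) : lp (fun _ : V × W => ℂ) 1)) i = 0 := by
        rw [lp.coeFn_sum, Finset.sum_apply]
        refine Finset.sum_eq_zero fun j _ => ?_
        by_cases hij : i = j
        · subst hij
          rw [lp.single_apply_self, h0]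
        · exact lp.single_apply_ne 1 j _ hij
      change (∑ j ∈ s n, (lp.single 1 j (c.1 j) : lp (fun _ : V × W => ℂ) 1)) i - c.1 i = 0
      rw [e2, h0, sub_zero]

theorem exists_sum (b : BHom V (BHom W X)) (c : FormalSum V W) :
    ∃ y, HasBSum (fun i => c.1 i • b i.1 i.2) y := by
  obtain ⟨S, T, hS, hT, hc⟩ := c.2
  obtain ⟨D, h1, h2, h3, h4⟩ := exists_disk (b.bounded₂ hS hT)
  obtain ⟨y, -, hy⟩ := exists_hasBSum h2 h3 h4 (c := c.1) (x := fun i : V × W => b i.1 i.2)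
    (fun i hi => h1 ⟨i.1, (hc i hi).1, i.2, (hc i hi).2, rfl⟩) c.summable le_rfl
  exact ⟨y, hy⟩

/-- The value `∑ c (v, w) b (v, w)` of a bounded bilinear map `b` on a formal sum. -/
def eval (b : BHom V (BHom W X)) (c : FormalSum V W) : X := (exists_sum b c).choose

theorem hasBSum_eval (b : BHom V (BHom W X)) (c : FormalSum V W) :
    HasBSum (fun i => c.1 i • b i.1 i.2) (eval b c) := (exists_sum b c).choose_spec

theorem eval_mem {B : Set (BHom V (BHom W X))} (hB : IsBounded B) {C : Set (FormalSum V W)}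
    (hC : IsBounded C) : IsBounded (Set.image2 (fun b c => eval b c) B C) := by
  obtain ⟨S, T, r, hS, hT, h⟩ := isBounded_iff.1 hC
  have hb : IsBounded (Set.image2 (fun (f : BHom W X) y => f y)
      (Set.image2 (fun (b : BHom V (BHom W X)) x => b x) B S) T) :=
    BHom.isBounded_iff.1 (BHom.isBounded_iff.1 hB S hS) T hT
  obtain ⟨D, h1, h2, h3, h4⟩ := exists_disk hb
  refine (isBounded_smul ((r + 1 : ℝ) : ℂ) h2).subset ?_
  rintro _ ⟨b, hb, c, hc, rfl⟩
  obtain ⟨y, hy, hy'⟩ := exists_hasBSum h2 h3 h4 (c := c.1) (x := fun i : V × W => b i.1 i.2)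
    (fun i hi => h1 ⟨_, ⟨b, hb, i.1, ((h hc).2 i hi).1, rfl⟩, i.2, ((h hc).2 i hi).2, rfl⟩)
    c.summable ((tsum_le c).trans (h hc).1)
  have e := (hasBSum_eval b c).unique hy'
  change eval b c ∈ _
  rw [e]
  exact hy

theorem eval_single (b : BHom V (BHom W X)) (v : V) (w : W) : eval b (single v w) = b v w := by
  classical
  refine (hasBSum_eval b _).unique ⟨{0}, isBounded_singleton, fun ε _ => ⟨{(v, w)}, ?_⟩⟩
  intro s hs
  refine ⟨0, rfl, ?_⟩
  have : ∑ i ∈ s, (single v w).1 i • b i.1 i.2 = b v w := by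
    rw [Finset.sum_eq_single (v, w)]
    · change (lp.single 1 (v, w) (1 : ℂ) : lp (fun _ : V × W => ℂ) 1) (v, w) • _ = _
      rw [lp.single_apply_self, one_smul]
    · intro i _ hi
      change (lp.single 1 (v, w) (1 : ℂ) : lp (fun _ : V × W => ℂ) 1) i • _ = _
      rw [lp.single_apply_ne 1 _ _ hi, zero_smul]
    · intro h
      exact absurd (hs (Finset.mem_singleton_self _)) h
  simp [this]

/-- Evaluation of bounded bilinear maps on formal sums. -/
def evalHom (V : Type u) [AddCommGroup V] [Module ℂ V] [BornSpace V]
    (W : Type v) [AddCommGroup W] [Module ℂ W] [BornSpace W]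
    (X : Type w) [AddCommGroup X] [Module ℂ X] [BornSpace X] :
    BHom (BHom V (BHom W X)) (BHom (FormalSum V W) X) :=
  BHom.mk₂ (LinearMap.mk₂ ℂ eval
    (fun b b' c => by
      refine (hasBSum_eval _ c).unique ?_
      simpa using (hasBSum_eval b c).add (hasBSum_eval b' c))
    (fun a b c => by
      refine (hasBSum_eval _ c).unique ?_
      have := (hasBSum_eval b c).smul a
      simpa [smul_comm a] using this)
    (fun b c c' => by
      refine (hasBSum_eval b _).unique ?_
      have := (hasBSum_eval b c).add (hasBSum_eval b c')
      convert this using 2 with i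
      exact add_smul _ _ _)
    (fun a b c => by
      refine (hasBSum_eval b _).unique ?_
      have := (hasBSum_eval b c).smul a
      convert this using 2 with i
      exact mul_smul _ _ _))
    (fun _ _ hS hT => eval_mem hS hT)

end FormalSum

/-- The relations which make `(v, w) ↦ [v, w]` bilinear. -/
inductive TensorRel (V : Type u) [AddCommGroup V] [Module ℂ V] [BornSpace V]
    (W : Type v) [AddCommGroup W] [Module ℂ W] [BornSpace W] : FormalSum V W → Prop
  | add_left (v v' : V) (w : W) : TensorRel V W
      (FormalSum.single (v + v') w - FormalSum.single v w - FormalSum.single v' w)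
  | smul_left (a : ℂ) (v : V) (w : W) : TensorRel V W
      (FormalSum.single (a • v) w - a • FormalSum.single v w)
  | add_right (v : V) (w w' : W) : TensorRel V W
      (FormalSum.single v (w + w') - FormalSum.single v w - FormalSum.single v w')
  | smul_right (a : ℂ) (v : V) (w : W) : TensorRel V W
      (FormalSum.single v (a • w) - a • FormalSum.single v w)

/-- The completed bornological tensor product: the quotient of the space of formal sums by the
closed subspace generated by the bilinearity relations. It carries the universal bounded bilinear
map from `V × W` into a complete bornological vector space, see `BTensor.lift`, `BTensor.lift_tmul`
and `BTensor.hom_ext`. -/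
def BTensor (V : Type u) [AddCommGroup V] [Module ℂ V] [BornSpace V]
    (W : Type v) [AddCommGroup W] [Module ℂ W] [BornSpace W] : Type (max u v) :=
  QuotBy {c : FormalSum V W | TensorRel V W c}

namespace BTensor

instance : AddCommGroup (BTensor V W) :=
  inferInstanceAs (AddCommGroup (QuotBy {c : FormalSum V W | TensorRel V W c}))
instance : Module ℂ (BTensor V W) :=
  inferInstanceAs (Module ℂ (QuotBy {c : FormalSum V W | TensorRel V W c}))
instance : BornSpace (BTensor V W) :=
  inferInstanceAs (BornSpace (QuotBy {c : FormalSum V W | TensorRel V W c}))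

/-- The quotient map from formal sums to the tensor product. -/
def proj (V : Type u) [AddCommGroup V] [Module ℂ V] [BornSpace V]
    (W : Type v) [AddCommGroup W] [Module ℂ W] [BornSpace W] : BHom (FormalSum V W) (BTensor V W) :=
  QuotBy.mk {c : FormalSum V W | TensorRel V W c}

theorem proj_surjective : Function.Surjective (proj V W) := QuotBy.mk_surjective _

theorem proj_rel {c : FormalSum V W} (h : TensorRel V W c) : proj V W c = 0 :=
  QuotBy.mk_eq_zero _ h

/-- The canonical bounded bilinear map `V × W → V ⊗ W`. -/
def tmulHom (V : Type u) [AddCommGroup V] [Module ℂ V] [BornSpace V]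
    (W : Type v) [AddCommGroup W] [Module ℂ W] [BornSpace W] : BHom V (BHom W (BTensor V W)) :=
  BHom.mk₂ (LinearMap.mk₂ ℂ (fun v w => proj V W (FormalSum.single v w))
    (fun v v' w => by
      have := proj_rel (TensorRel.add_left v v' w)
      rwa [map_sub, map_sub, sub_sub, sub_eq_zero] at this)
    (fun a v w => by
      have := proj_rel (TensorRel.smul_left a v w)
      rwa [map_sub, map_smul, sub_eq_zero] at this)
    (fun v w w' => by
      have := proj_rel (TensorRel.add_right v w w')
      rwa [map_sub, map_sub, sub_sub, sub_eq_zero] at this)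
    (fun a v w => by
      have := proj_rel (TensorRel.smul_right a v w)
      rwa [map_sub, map_smul, sub_eq_zero] at this)) (by
    intro S T hS hT
    refine ((proj V W).bounded
      (FormalSum.isBounded_iff.2 ⟨S, T, 1, hS, hT, subset_rfl⟩)).subset ?_
    rintro _ ⟨v, hv, w, hw, rfl⟩
    exact ⟨FormalSum.single v w, FormalSum.single_mem_box hv hw, rfl⟩)

/-- The elementary tensor `v ⊗ w`. -/
def tmul (v : V) (w : W) : BTensor V W := tmulHom V W v w

@[simp] theorem tmulHom_apply (v : V) (w : W) : tmulHom V W v w = tmul v w := rfl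

@[simp] theorem add_tmul (v v' : V) (w : W) : tmul (v + v') w = tmul v w + tmul v' w := by
  simp [← tmulHom_apply]
@[simp] theorem tmul_add (v : V) (w w' : W) : tmul v (w + w') = tmul v w + tmul v w' := by
  simp [← tmulHom_apply]
@[simp] theorem smul_tmul (a : ℂ) (v : V) (w : W) : tmul (a • v) w = a • tmul v w := by
  simp [← tmulHom_apply]
@[simp] theorem tmul_smul (a : ℂ) (v : V) (w : W) : tmul v (a • w) = a • tmul v w := by
  simp [← tmulHom_apply]

/-- Bounded linear maps on the tensor product are determined by elementary tensors. -/
theorem hom_ext {f g : BHom (BTensor V W) X} (h : ∀ v w, f (tmul v w) = g (tmul v w)) : f = g := by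
  refine QuotBy.hom_ext fun c => ?_
  have := FormalSum.closed_eq_top (BHom.isClosed_eqLocus (f.comp (proj V W)) (g.comp (proj V W)))
    (fun v w => h v w)
  have hc : c ∈ LinearMap.eqLocus (f.comp (proj V W)).1 (g.comp (proj V W)).1 := by
    rw [this]
    trivial
  exact hc

/-- The universal property: a bounded bilinear map on `V × W` induces a bounded linear map on the
tensor product. -/
def lift (b : BHom V (BHom W X)) : BHom (BTensor V W) X :=
  QuotBy.lift (FormalSum.evalHom V W X b) (by
    intro c hc
    have e : ∀ v w, FormalSum.evalHom V W X b (FormalSum.single v w) = b v w :=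
      FormalSum.eval_single b
    cases hc <;> simp [e])

@[simp] theorem lift_tmul (b : BHom V (BHom W X)) (v : V) (w : W) : lift b (tmul v w) = b v w :=
  FormalSum.eval_single b v w

/-- The universal property, with bounded dependence on the bilinear map. -/
def liftHom (V : Type u) [AddCommGroup V] [Module ℂ V] [BornSpace V]
    (W : Type v) [AddCommGroup W] [Module ℂ W] [BornSpace W]
    (X : Type w) [AddCommGroup X] [Module ℂ X] [BornSpace X] :
    BHom (BHom V (BHom W X)) (BHom (BTensor V W) X) :=
  BHom.mk
    { toFun := lift
      map_add' := fun b b' => hom_ext (by simp)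
      map_smul' := fun a b => hom_ext (by simp) } (by
    intro B hB
    rw [BHom.isBounded_iff]
    intro S hS
    obtain ⟨C, hC, h⟩ := (QuotBy.isBounded_iff _).1 hS
    refine (FormalSum.eval_mem hB hC).subset ?_
    rintro _ ⟨_, ⟨b, hb, rfl⟩, s, hs, rfl⟩
    obtain ⟨c, hc, rfl⟩ := h hs
    exact ⟨b, hb, c, hc, rfl⟩)

@[simp] theorem liftHom_apply (b : BHom V (BHom W X)) : liftHom V W X b = lift b := rfl

end BTensor

end Tensor

section Maps

namespace BHom

variable {V : Type*} [AddCommGroup V] [Module ℂ V] [BornSpace V]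
variable {V' : Type*} [AddCommGroup V'] [Module ℂ V'] [BornSpace V']
variable {W : Type*} [AddCommGroup W] [Module ℂ W] [BornSpace W]
variable {W' : Type*} [AddCommGroup W'] [Module ℂ W'] [BornSpace W']
variable {X : Type*} [AddCommGroup X] [Module ℂ X] [BornSpace X]
variable {X' : Type*} [AddCommGroup X'] [Module ℂ X'] [BornSpace X']

/-- The bounded bilinear map `(v, w) ↦ b (f v) (g w)`. -/
def comp₂ (b : BHom V' (BHom W' X)) (f : BHom V V') (g : BHom W W') : BHom V (BHom W X) :=
  (flip (compL W W' X) g).comp (b.comp f)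

@[simp] theorem comp₂_apply (b : BHom V' (BHom W' X)) (f : BHom V V') (g : BHom W W') (v : V)
    (w : W) : comp₂ b f g v w = b (f v) (g w) := rfl

/-- The bounded bilinear map `(v, w) ↦ g (b v w)`. -/
def post (g : BHom X X') (b : BHom V (BHom W X)) : BHom V (BHom W X') :=
  (compL W X X' g).comp b

@[simp] theorem post_apply (g : BHom X X') (b : BHom V (BHom W X)) (v : V) (w : W) :
    post g b v w = g (b v w) := rfl

end BHom

namespace BTensor

variable {V : Type*} [AddCommGroup V] [Module ℂ V] [BornSpace V]
variable {V' : Type*} [AddCommGroup V'] [Module ℂ V'] [BornSpace V']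
variable {W : Type*} [AddCommGroup W] [Module ℂ W] [BornSpace W]
variable {W' : Type*} [AddCommGroup W'] [Module ℂ W'] [BornSpace W']
variable {X : Type*} [AddCommGroup X] [Module ℂ X] [BornSpace X]

theorem hom_ext₂ {f g : BHom (BTensor V W) (BHom (BTensor V' W') X)}
    (h : ∀ v w v' w', f (tmul v w) (tmul v' w') = g (tmul v w) (tmul v' w')) : f = g :=
  hom_ext fun v w => hom_ext fun v' w' => h v w v' w'

/-- The tensor product of bounded linear maps. -/
def map (f : BHom V V') (g : BHom W W') : BHom (BTensor V W) (BTensor V' W') :=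
  lift (BHom.comp₂ (tmulHom V' W') f g)

@[simp] theorem map_tmul (f : BHom V V') (g : BHom W W') (v : V) (w : W) :
    map f g (tmul v w) = tmul (f v) (g w) := by
  simp [map]

/-- The tensor product of bounded linear maps, as a bounded bilinear map. -/
def mapHom (V V' W W' : Type*) [AddCommGroup V] [Module ℂ V] [BornSpace V]
    [AddCommGroup V'] [Module ℂ V'] [BornSpace V'] [AddCommGroup W] [Module ℂ W] [BornSpace W]
    [AddCommGroup W'] [Module ℂ W'] [BornSpace W'] :
    BHom (BHom V V') (BHom (BHom W W') (BHom (BTensor V W) (BTensor V' W'))) :=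
  BHom.mk₂ (LinearMap.mk₂ ℂ map
    (fun f f' g => hom_ext (by simp)) (fun a f g => hom_ext (by simp))
    (fun f g g' => hom_ext (by simp)) (fun a f g => hom_ext (by simp))) (by
    intro F G hF hG
    have h : IsBounded (Set.image2 (fun f g => BHom.comp₂ (tmulHom V' W') f g) F G) := by
      rw [BHom.isBounded_iff] at *
      intro S hS
      rw [BHom.isBounded_iff]
      intro T hT
      refine ((tmulHom V' W').bounded₂ (hF S hS) (hG T hT)).subset ?_
      rintro _ ⟨_, ⟨_, ⟨f, hf, g, hg, rfl⟩, v, hv, rfl⟩, w, hw, rfl⟩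
      exact ⟨f v, ⟨f, hf, v, hv, rfl⟩, g w, ⟨g, hg, w, hw, rfl⟩, rfl⟩
    refine ((liftHom V W (BTensor V' W')).bounded h).subset ?_
    rintro _ ⟨f, hf, g, hg, rfl⟩
    exact ⟨_, ⟨f, hf, g, hg, rfl⟩, rfl⟩)

@[simp] theorem mapHom_apply (f : BHom V V') (g : BHom W W') :
    mapHom V V' W W' f g = map f g := rfl

/-- The flip map. -/
def swap (V W : Type*) [AddCommGroup V] [Module ℂ V] [BornSpace V]
    [AddCommGroup W] [Module ℂ W] [BornSpace W] : BHom (BTensor V W) (BTensor W V) :=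
  lift (BHom.flip (tmulHom W V))

@[simp] theorem swap_tmul (v : V) (w : W) : swap V W (tmul v w) = tmul w v := by
  simp [swap]

@[simp] theorem swap_swap (x : BTensor V W) : swap W V (swap V W x) = x :=
  DFunLike.congr_fun (hom_ext (f := (swap W V).comp (swap V W)) (g := BHom.id _) (by simp)) x

theorem hom_ext_left {Y : Type*} [AddCommGroup Y] [Module ℂ Y] [BornSpace Y]
    {f g : BHom (BTensor (BTensor V W) X) Y}
    (h : ∀ v w x, f (tmul (tmul v w) x) = g (tmul (tmul v w) x)) : f = g :=
  hom_ext fun z x => DFunLike.congr_fun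
    (hom_ext (f := f.comp (BHom.flip (tmulHom _ _) x)) (g := g.comp (BHom.flip (tmulHom _ _) x))
      fun v w => h v w x) z

theorem hom_ext_right {Y : Type*} [AddCommGroup Y] [Module ℂ Y] [BornSpace Y]
    {f g : BHom (BTensor V (BTensor W X)) Y}
    (h : ∀ v w x, f (tmul v (tmul w x)) = g (tmul v (tmul w x))) : f = g :=
  hom_ext fun v z => DFunLike.congr_fun
    (hom_ext (f := f.comp (tmulHom _ _ v)) (g := g.comp (tmulHom _ _ v)) fun w x => h v w x) z

/-- The associativity isomorphism `(v ⊗ w) ⊗ x ↦ v ⊗ (w ⊗ x)`. -/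
def assoc (V W X : Type*) [AddCommGroup V] [Module ℂ V] [BornSpace V]
    [AddCommGroup W] [Module ℂ W] [BornSpace W] [AddCommGroup X] [Module ℂ X] [BornSpace X] :
    BIso (BTensor (BTensor V W) X) (BTensor V (BTensor W X)) where
  toHom := lift (lift (BHom.comp₂ (BHom.compL X (BTensor W X) (BTensor V (BTensor W X)))
    (tmulHom V (BTensor W X)) (tmulHom W X)))
  inv := lift ((liftHom W X (BTensor (BTensor V W) X)).comp
    (BHom.post (tmulHom (BTensor V W) X) (tmulHom V W)))
  inv_toHom x := DFunLike.congr_fun (hom_ext_left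
    (f := BHom.comp (lift _) (lift _)) (g := BHom.id _) (by simp)) x
  toHom_inv x := DFunLike.congr_fun (hom_ext_right
    (f := BHom.comp (lift _) (lift _)) (g := BHom.id _) (by simp)) x

@[simp] theorem assoc_tmul (v : V) (w : W) (x : X) :
    (assoc V W X).toHom (tmul (tmul v w) x) = tmul v (tmul w x) := by
  simp [assoc]

end BTensor

end Maps

/-! ## The complex numbers -/

section Complex

theorem mem_smul_closedBall {ε : ℝ} (hε : 0 < ε) {z : ℂ} :
    z ∈ (ε : ℂ) • Metric.closedBall (0 : ℂ) 1 ↔ ‖z‖ ≤ ε := by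
  rw [smul_unitClosedBall]
  simp [abs_of_pos hε]

/-- The complex numbers with the bornology of bounded sets. -/
instance instBornSpaceComplex : BornSpace ℂ where
  isBounded_smul := fun c S hS => hS.smul₀ c
  exists_completant := by
    intro S hS
    obtain ⟨r, hr⟩ := hS.subset_closedBall (0 : ℂ)
    have hpos : 0 < max r 1 := lt_max_of_lt_right one_pos
    have hc : IsCompletant (Metric.closedBall (0 : ℂ) 1) := by
      refine ⟨⟨?_, convex_closedBall _ _⟩, ?_, ?_⟩
      · exact balanced_closedBall_zero
      · intro z hz
        have : ‖z‖ ≤ 0 := le_of_forall_pos_le_add fun ε hε => by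
          simpa using (mem_smul_closedBall hε).1 (hz ε hε)
        exact norm_le_zero_iff.1 this
      · intro z hz
        have : CauchySeq z := by
          rw [Metric.cauchySeq_iff]
          intro ε hε
          obtain ⟨N, hN⟩ := hz (ε / 2) (by linarith)
          refine ⟨N, fun m hm n hn => ?_⟩
          rw [dist_eq_norm]
          have := (mem_smul_closedBall (by linarith)).1 (hN m hm n hn)
          linarith
        obtain ⟨y, hy⟩ := cauchySeq_tendsto_of_complete this
        refine ⟨y, fun ε hε => ?_⟩
        obtain ⟨N, hN⟩ := Metric.tendsto_atTop.1 hy ε hε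
        refine ⟨N, fun n hn => (mem_smul_closedBall hε).2 ?_⟩
        rw [← dist_eq_norm]
        exact (hN n hn).le
    refine ⟨((max r 1 : ℝ) : ℂ) • Metric.closedBall (0 : ℂ) 1, ?_, ?_, hc.dilate hpos⟩
    · intro z hz
      rw [mem_smul_closedBall hpos]
      have := hr hz
      rw [mem_closedBall_zero_iff] at this
      exact this.trans (le_max_left _ _)
    · exact Metric.isBounded_closedBall.smul₀ _

end Complex

/-! ## Bornological algebras -/

/-- A bornological algebra: a complete bornological vector space with an associative multiplication
given by a bounded bilinear map. It need not have a unit. -/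
class BornAlgebra (A : Type u) [NonUnitalRing A] [Module ℂ A] extends
    BornSpace A, IsScalarTower ℂ A A, SMulCommClass ℂ A A where
  isBounded_mul : ∀ S T : Set A, IsBounded S → IsBounded T → IsBounded (S * T)

instance instBornAlgebraComplex : BornAlgebra ℂ where
  isBounded_mul := by
    intro S T hS hT
    obtain ⟨r, hr⟩ := isBounded_iff_forall_norm_le.1 hS
    obtain ⟨t, ht⟩ := isBounded_iff_forall_norm_le.1 hT
    refine isBounded_iff_forall_norm_le.2 ⟨r * t, ?_⟩
    rintro _ ⟨x, hx, y, hy, rfl⟩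
    rw [norm_mul]
    exact mul_le_mul (hr x hx) (ht y hy) (norm_nonneg _) ((norm_nonneg x).trans (hr x hx))

section Algebra

variable {A : Type*} [NonUnitalRing A] [Module ℂ A] [BornAlgebra A]
variable {B : Type*} [NonUnitalRing B] [Module ℂ B] [BornAlgebra B]

/-- The multiplication `(a, b) ↦ a * b` as a bounded bilinear map. -/
def mulHom (A : Type*) [NonUnitalRing A] [Module ℂ A] [BornAlgebra A] : BHom A (BHom A A) :=
  BHom.mk₂ (LinearMap.mul ℂ A) (fun S T hS hT => BornAlgebra.isBounded_mul S T hS hT)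

@[simp] theorem mulHom_apply (a b : A) : mulHom A a b = a * b := rfl

/-- The multiplication `μ : A ⊗ A → A` as a bounded linear map. -/
def mulMap (A : Type*) [NonUnitalRing A] [Module ℂ A] [BornAlgebra A] : BHom (BTensor A A) A :=
  BTensor.lift (mulHom A)

namespace BTensor

/-- The multiplication of the tensor product of two bornological algebras. -/
def tensorMul (A B : Type*) [NonUnitalRing A] [Module ℂ A] [BornAlgebra A]
    [NonUnitalRing B] [Module ℂ B] [BornAlgebra B] :
    BHom (BTensor A B) (BHom (BTensor A B) (BTensor A B)) :=
  lift (BHom.comp₂ (mapHom A A B B) (mulHom A) (mulHom B))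

theorem tensorMul_tmul (a a' : A) (b b' : B) :
    tensorMul A B (tmul a b) (tmul a' b') = tmul (a * a') (b * b') := by
  simp [tensorMul]

theorem tensorMul_assoc (x y z : BTensor A B) :
    tensorMul A B (tensorMul A B x y) z = tensorMul A B x (tensorMul A B y z) := by
  have h1 : ∀ a b a' b' (z : BTensor A B),
      tensorMul A B (tensorMul A B (tmul a b) (tmul a' b')) z =
        tensorMul A B (tmul a b) (tensorMul A B (tmul a' b') z) := by
    intro a b a' b' z
    refine DFunLike.congr_fun (hom_ext
      (f := tensorMul A B (tensorMul A B (tmul a b) (tmul a' b')))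
      (g := (tensorMul A B (tmul a b)).comp (tensorMul A B (tmul a' b'))) ?_) z
    intro a'' b''
    simp [tensorMul_tmul, mul_assoc]
  have h2 : BHom.post (BHom.flip (tensorMul A B) z) (tensorMul A B) =
      BHom.comp₂ (tensorMul A B) (BHom.id _) (BHom.flip (tensorMul A B) z) :=
    hom_ext₂ fun a b a' b' => h1 a b a' b' z
  exact DFunLike.congr_fun (DFunLike.congr_fun h2 x) y

instance instNonUnitalRing : NonUnitalRing (BTensor A B) :=
  { (inferInstance : AddCommGroup (BTensor A B)) with
    mul := fun x y => tensorMul A B x y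
    left_distrib := fun x y z => map_add (tensorMul A B x) y z
    right_distrib := fun x y z => by
      change tensorMul A B (x + y) z = tensorMul A B x z + tensorMul A B y z
      simp
    zero_mul := fun x => by
      change tensorMul A B 0 x = 0
      simp
    mul_zero := fun x => map_zero (tensorMul A B x)
    mul_assoc := tensorMul_assoc }

theorem mul_def (x y : BTensor A B) : x * y = tensorMul A B x y := rfl

@[simp] theorem tmul_mul_tmul (a a' : A) (b b' : B) :
    (tmul a b : BTensor A B) * tmul a' b' = tmul (a * a') (b * b') := tensorMul_tmul a a' b b'

/-- The tensor product of two bornological algebras is a bornological algebra. -/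
instance instBornAlgebra : BornAlgebra (BTensor A B) where
  smul_assoc a x y := by
    change tensorMul A B (a • x) y = a • tensorMul A B x y
    simp
  smul_comm a x y := (map_smul (tensorMul A B x) a y).symm
  isBounded_mul := fun S T hS hT => (tensorMul A B).bounded₂ hS hT

end BTensor

end Algebra

/-! ## Multipliers -/

section Multipliers

variable {A : Type*} [NonUnitalRing A] [Module ℂ A] [BornAlgebra A]
variable {B : Type*} [NonUnitalRing B] [Module ℂ B] [BornAlgebra B]

/-- The pairs `(L, R)` consisting of a left multiplier `L` and a right multiplier `R` of `A` which
are compatible in the sense that `x * L y = R x * y`. -/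
def multipliers (A : Type u) [NonUnitalRing A] [Module ℂ A] [BornAlgebra A] :
    Submodule ℂ (BHom A A × BHom A A) where
  carrier := {m | (∀ x y, m.1 (x * y) = m.1 x * y) ∧ (∀ x y, m.2 (x * y) = x * m.2 y) ∧
    ∀ x y, x * m.1 y = m.2 x * y}
  add_mem' := by
    rintro m n ⟨h1, h2, h3⟩ ⟨h1', h2', h3'⟩
    refine ⟨fun x y => ?_, fun x y => ?_, fun x y => ?_⟩
    · simp [h1, h1', add_mul]
    · simp [h2, h2', mul_add]
    · simp [h3, h3', mul_add, add_mul]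
  zero_mem' := by simp
  smul_mem' := by
    rintro c m ⟨h1, h2, h3⟩
    refine ⟨fun x y => ?_, fun x y => ?_, fun x y => ?_⟩
    · simp [h1, smul_mul_assoc]
    · simp [h2, mul_smul_comm]
    · simp [h3, smul_mul_assoc, mul_smul_comm]

/-- The multiplier algebra `M(A)`. -/
def Multiplier (A : Type u) [NonUnitalRing A] [Module ℂ A] [BornAlgebra A] : Type u :=
  ↥(multipliers A)

namespace Multiplier

instance : AddCommGroup (Multiplier A) := inferInstanceAs (AddCommGroup ↥(multipliers A))
instance : Module ℂ (Multiplier A) := inferInstanceAs (Module ℂ ↥(multipliers A))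

/-- The left multiplier `x ↦ m * x`. -/
def L (m : Multiplier A) : BHom A A := m.1.1
/-- The right multiplier `x ↦ x * m`. -/
def R (m : Multiplier A) : BHom A A := m.1.2

theorem L_mul (m : Multiplier A) (x y : A) : m.L (x * y) = m.L x * y := m.2.1 x y
theorem R_mul (m : Multiplier A) (x y : A) : m.R (x * y) = x * m.R y := m.2.2.1 x y
theorem mul_L (m : Multiplier A) (x y : A) : x * m.L y = m.R x * y := m.2.2.2 x y

@[ext] theorem ext {m n : Multiplier A} (hL : ∀ x, m.L x = n.L x) (hR : ∀ x, m.R x = n.R x) :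
    m = n :=
  Subtype.ext (Prod.ext (BHom.ext hL) (BHom.ext hR))

/-- A multiplier from its two components. -/
def mk (L R : BHom A A) (h1 : ∀ x y, L (x * y) = L x * y) (h2 : ∀ x y, R (x * y) = x * R y)
    (h3 : ∀ x y, x * L y = R x * y) : Multiplier A := ⟨(L, R), h1, h2, h3⟩

@[simp] theorem mk_L (L R : BHom A A) (h1 h2 h3) : (mk L R h1 h2 h3).L = L := rfl
@[simp] theorem mk_R (L R : BHom A A) (h1 h2 h3) : (mk L R h1 h2 h3).R = R := rfl

@[simp] theorem add_L (m n : Multiplier A) : (m + n).L = m.L + n.L := rfl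
@[simp] theorem add_R (m n : Multiplier A) : (m + n).R = m.R + n.R := rfl
@[simp] theorem sub_L (m n : Multiplier A) : (m - n).L = m.L - n.L := rfl
@[simp] theorem sub_R (m n : Multiplier A) : (m - n).R = m.R - n.R := rfl
@[simp] theorem smul_L (c : ℂ) (m : Multiplier A) : (c • m).L = c • m.L := rfl
@[simp] theorem smul_R (c : ℂ) (m : Multiplier A) : (c • m).R = c • m.R := rfl

/-- The product of multipliers, so that `(m * n) * x = m * (n * x)` and `x * (m * n) = (x * m) * n`
for all `x`. -/
instance : Mul (Multiplier A) where
  mul m n := mk (m.L.comp n.L) (n.R.comp m.R) (by simp [L_mul]) (by simp [R_mul])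
    (by simp [mul_L])

/-- The unit of the multiplier algebra. -/
instance : One (Multiplier A) where
  one := mk (BHom.id A) (BHom.id A) (by simp) (by simp) (by simp)

@[simp] theorem mul_L_apply (m n : Multiplier A) (x : A) : (m * n).L x = m.L (n.L x) := rfl
@[simp] theorem mul_R_apply (m n : Multiplier A) (x : A) : (m * n).R x = n.R (m.R x) := rfl
@[simp] theorem one_L (x : A) : (1 : Multiplier A).L x = x := rfl
@[simp] theorem one_R (x : A) : (1 : Multiplier A).R x = x := rfl

/-- The bornology of `M(A)`: the bornology induced from `Hom(A, A) ⊕ Hom(A, A)`. -/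
instance instBornology : Bornology (Multiplier A) :=
  Bornology.ofBounded {B | IsBounded (L '' B) ∧ IsBounded (R '' B)}
    (by simp)
    (fun B hB B' h => ⟨hB.1.subset (Set.image_mono h), hB.2.subset (Set.image_mono h)⟩)
    (fun B hB B' hB' => by
      simp only [Set.image_union, Set.mem_ofPred_eq]
      exact ⟨hB.1.union hB'.1, hB.2.union hB'.2⟩)
    (fun m => by simp [isBounded_singleton])

theorem isBounded_iff {B : Set (Multiplier A)} :
    IsBounded B ↔ IsBounded (L '' B) ∧ IsBounded (R '' B) :=
  Bornology.isBounded_ofBounded_iff _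

theorem _root_.Born.BHom.converges_apply {V W : Type*} [AddCommGroup V] [Module ℂ V] [BornSpace V]
    [AddCommGroup W] [Module ℂ W] [BornSpace W] {f : ℕ → BHom V W} {g : BHom V W}
    (h : Converges f g) (x : V) : Converges (fun n => f n x) (g x) := by
  have := (BHom.flip (BHom.id (BHom V W)) x).map_converges h
  exact this

instance instBornSpace : BornSpace (Multiplier A) where
  isBounded_smul := by
    intro c B hB
    rw [isBounded_iff] at *
    constructor
    · refine (isBounded_smul c hB.1).subset ?_
      rintro _ ⟨_, ⟨m, hm, rfl⟩, rfl⟩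
      exact ⟨m.L, ⟨m, hm, rfl⟩, rfl⟩
    · refine (isBounded_smul c hB.2).subset ?_
      rintro _ ⟨_, ⟨m, hm, rfl⟩, rfl⟩
      exact ⟨m.R, ⟨m, hm, rfl⟩, rfl⟩
  exists_completant := by
    intro B hB
    obtain ⟨hBL, hBR⟩ := isBounded_iff.1 hB
    obtain ⟨D, h1, h2, h3⟩ := BornSpace.exists_completant _ hBL
    obtain ⟨E, h1', h2', h3'⟩ := BornSpace.exists_completant _ hBR
    have key : ∀ (ε : ℝ), 0 < ε → ∀ m : Multiplier A,
        m ∈ (ε : ℂ) • {m : Multiplier A | m.L ∈ D ∧ m.R ∈ E} ↔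
          m.L ∈ (ε : ℂ) • D ∧ m.R ∈ (ε : ℂ) • E := by
      intro ε hε m
      have hε' : (ε : ℂ) ≠ 0 := by exact_mod_cast hε.ne'
      simp only [Set.mem_smul_set_iff_inv_smul_mem₀ hε', Set.mem_ofPred_eq, smul_L, smul_R]
    refine ⟨{m | m.L ∈ D ∧ m.R ∈ E}, fun m hm => ⟨h1 ⟨m, hm, rfl⟩, h1' ⟨m, hm, rfl⟩⟩, ?_, ?_, ?_,
      ?_⟩
    · rw [isBounded_iff]
      constructor
      · refine h2.subset ?_
        rintro _ ⟨m, hm, rfl⟩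
        exact hm.1
      · refine h2'.subset ?_
        rintro _ ⟨m, hm, rfl⟩
        exact hm.2
    · refine IsDisk.of_comb ?_
      intro m hm n hn a b hab
      exact ⟨h3.toIsDisk.comb hm.1 hn.1 hab, h3'.toIsDisk.comb hm.2 hn.2 hab⟩
    · intro m hm
      have hL : m.L = 0 := h3.definite _ fun ε hε => ((key ε hε m).1 (hm ε hε)).1
      have hR : m.R = 0 := h3'.definite _ fun ε hε => ((key ε hε m).1 (hm ε hε)).2
      exact Subtype.ext (Prod.ext hL hR)
    · intro m hm
      obtain ⟨l, hl⟩ := h3.complete (fun n => (m n).L) fun ε hε => by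
        obtain ⟨N, hN⟩ := hm ε hε
        exact ⟨N, fun i hi j hj => ((key ε hε _).1 (hN i hi j hj)).1⟩
      obtain ⟨r, hr⟩ := h3'.complete (fun n => (m n).R) fun ε hε => by
        obtain ⟨N, hN⟩ := hm ε hε
        exact ⟨N, fun i hi j hj => ((key ε hε _).1 (hN i hi j hj)).2⟩
      have cl : ∀ x, Converges (fun n => (m n).L x) (l x) :=
        BHom.converges_apply (f := fun n => (m n).L) ⟨D, h2, hl⟩
      have cr : ∀ x, Converges (fun n => (m n).R x) (r x) :=
        BHom.converges_apply (f := fun n => (m n).R) ⟨E, h2', hr⟩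
      refine ⟨mk l r ?_ ?_ ?_, ?_⟩
      · intro x y
        refine (cl (x * y)).unique ?_
        have := (BHom.flip (mulHom A) y).map_converges (cl x)
        simpa [L_mul] using this
      · intro x y
        refine (cr (x * y)).unique ?_
        have := (mulHom A x).map_converges (cr y)
        simpa [R_mul] using this
      · intro x y
        have a := (mulHom A x).map_converges (cl y)
        have b := (BHom.flip (mulHom A) y).map_converges (cr x)
        refine a.unique ?_
        simpa [mul_L] using b
      · intro ε hε
        obtain ⟨N, hN⟩ := hl ε hε
        obtain ⟨M, hM⟩ := hr ε hε
        refine ⟨max N M, fun n hn => (key ε hε _).2 ⟨?_, ?_⟩⟩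
        · exact hN n ((le_max_left _ _).trans hn)
        · exact hM n ((le_max_right _ _).trans hn)

/-- `m ↦ m.L` as a bounded linear map. -/
def LHom (A : Type*) [NonUnitalRing A] [Module ℂ A] [BornAlgebra A] :
    BHom (Multiplier A) (BHom A A) :=
  BHom.mk { toFun := L, map_add' := fun _ _ => rfl, map_smul' := fun _ _ => rfl }
    fun _ hS => (isBounded_iff.1 hS).1

/-- `m ↦ m.R` as a bounded linear map. -/
def RHom (A : Type*) [NonUnitalRing A] [Module ℂ A] [BornAlgebra A] :
    BHom (Multiplier A) (BHom A A) :=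
  BHom.mk { toFun := R, map_add' := fun _ _ => rfl, map_smul' := fun _ _ => rfl }
    fun _ hS => (isBounded_iff.1 hS).2

@[simp] theorem LHom_apply (m : Multiplier A) : LHom A m = m.L := rfl
@[simp] theorem RHom_apply (m : Multiplier A) : RHom A m = m.R := rfl

/-- A bounded bilinear map into the multiplier algebra from its two components. -/
def mk₂ {V W : Type*} [AddCommGroup V] [Module ℂ V] [BornSpace V]
    [AddCommGroup W] [Module ℂ W] [BornSpace W] (b : V → W → Multiplier A)
    (l r : BHom V (BHom W (BHom A A))) (hl : ∀ v w, (b v w).L = l v w)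
    (hr : ∀ v w, (b v w).R = r v w) : BHom V (BHom W (Multiplier A)) :=
  BHom.mk₂ (LinearMap.mk₂ ℂ b
    (fun v v' w => by ext x <;> simp [hl, hr]) (fun c v w => by ext x <;> simp [hl, hr])
    (fun v w w' => by ext x <;> simp [hl, hr]) (fun c v w => by ext x <;> simp [hl, hr])) (by
    intro S T hS hT
    rw [isBounded_iff]
    constructor
    · refine (l.bounded₂ hS hT).subset ?_
      rintro _ ⟨_, ⟨v, hv, w, hw, rfl⟩, rfl⟩
      exact ⟨v, hv, w, hw, (hl v w).symm⟩
    · refine (r.bounded₂ hS hT).subset ?_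
      rintro _ ⟨_, ⟨v, hv, w, hw, rfl⟩, rfl⟩
      exact ⟨v, hv, w, hw, (hr v w).symm⟩)

@[simp] theorem mk₂_apply {V W : Type*} [AddCommGroup V] [Module ℂ V] [BornSpace V]
    [AddCommGroup W] [Module ℂ W] [BornSpace W] (b : V → W → Multiplier A)
    (l r : BHom V (BHom W (BHom A A))) (hl hr) (v : V) (w : W) : mk₂ b l r hl hr v w = b v w := rfl

/-- The multiplication of multipliers as a bounded bilinear map. -/
def mulHom (A : Type*) [NonUnitalRing A] [Module ℂ A] [BornAlgebra A] :
    BHom (Multiplier A) (BHom (Multiplier A) (Multiplier A)) :=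
  mk₂ (fun m n => m * n) (BHom.comp₂ (BHom.compL A A A) (LHom A) (LHom A))
    (BHom.flip (BHom.comp₂ (BHom.compL A A A) (RHom A) (RHom A))) (fun _ _ => rfl)
    (fun _ _ => rfl)

@[simp] theorem mulHom_apply (m n : Multiplier A) : mulHom A m n = m * n := rfl

/-- The canonical homomorphism `A → M(A)`. -/
def ι (A : Type*) [NonUnitalRing A] [Module ℂ A] [BornAlgebra A] : BHom A (Multiplier A) :=
  BHom.mk
    { toFun := fun a => mk (Born.mulHom A a) (BHom.flip (Born.mulHom A) a)
        (by simp [mul_assoc]) (by simp [mul_assoc]) (by simp [mul_assoc])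
      map_add' := fun a b => ext (fun x => add_mul a b x) (fun x => mul_add x a b)
      map_smul' := fun c a => ext (fun x => smul_mul_assoc c a x) (fun x => mul_smul_comm c x a) } (by
    intro S hS
    rw [isBounded_iff, Set.image_image, Set.image_image]
    exact ⟨(Born.mulHom A).bounded hS, (BHom.flip (Born.mulHom A)).bounded hS⟩)

@[simp] theorem ι_L (a x : A) : (ι A a).L x = a * x := rfl
@[simp] theorem ι_R (a x : A) : (ι A a).R x = x * a := rfl

/-- The multiplier `m ⊗ n` of `A ⊗ B`. -/
def tmul (m : Multiplier A) (n : Multiplier B) : Multiplier (BTensor A B) :=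
  mk (BTensor.map m.L n.L) (BTensor.map m.R n.R)
    (fun x y => DFunLike.congr_fun (DFunLike.congr_fun (BTensor.hom_ext₂
      (f := BHom.post (BTensor.map m.L n.L) (Born.mulHom (BTensor A B)))
      (g := BHom.comp₂ (Born.mulHom (BTensor A B)) (BTensor.map m.L n.L) (BHom.id _))
      (by simp [L_mul])) x) y)
    (fun x y => DFunLike.congr_fun (DFunLike.congr_fun (BTensor.hom_ext₂
      (f := BHom.post (BTensor.map m.R n.R) (Born.mulHom (BTensor A B)))
      (g := BHom.comp₂ (Born.mulHom (BTensor A B)) (BHom.id _) (BTensor.map m.R n.R))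
      (by simp [R_mul])) x) y)
    (fun x y => DFunLike.congr_fun (DFunLike.congr_fun (BTensor.hom_ext₂
      (f := BHom.comp₂ (Born.mulHom (BTensor A B)) (BHom.id _) (BTensor.map m.L n.L))
      (g := BHom.comp₂ (Born.mulHom (BTensor A B)) (BTensor.map m.R n.R) (BHom.id _))
      (by simp [mul_L])) x) y)

@[simp] theorem tmul_L (m : Multiplier A) (n : Multiplier B) :
    (tmul m n).L = BTensor.map m.L n.L := rfl
@[simp] theorem tmul_R (m : Multiplier A) (n : Multiplier B) :
    (tmul m n).R = BTensor.map m.R n.R := rfl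

/-- `(m, n) ↦ m ⊗ n` as a bounded bilinear map. -/
def tmulHom (A B : Type*) [NonUnitalRing A] [Module ℂ A] [BornAlgebra A] [NonUnitalRing B]
    [Module ℂ B] [BornAlgebra B] :
    BHom (Multiplier A) (BHom (Multiplier B) (Multiplier (BTensor A B))) :=
  mk₂ tmul (BHom.comp₂ (BTensor.mapHom A A B B) (LHom A) (LHom B))
    (BHom.comp₂ (BTensor.mapHom A A B B) (RHom A) (RHom B)) (fun _ _ => rfl) (fun _ _ => rfl)

@[simp] theorem tmulHom_apply (m : Multiplier A) (n : Multiplier B) :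
    tmulHom A B m n = tmul m n := rfl

end Multiplier

end Multipliers

/-! ## Essential modules, algebras and homomorphisms -/

section Essential

section Balanced

variable {A : Type*} [AddCommGroup A] [Module ℂ A] [BornSpace A]
variable {B : Type*} [AddCommGroup B] [Module ℂ B] [BornSpace B]
variable {X : Type*} [AddCommGroup X] [Module ℂ X] [BornSpace X]

/-- The relations `(a x) ⊗ b - a ⊗ (x b)` for a multiplication `m : (a, x) ↦ a x` on `A` and an
action `l : (x, b) ↦ x b` of `A` on `B`. -/
def balancedRel (m : BHom A (BHom A A)) (l : BHom A (BHom B B)) : Set (BTensor A B) :=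
  {z | ∃ a x b, z = BTensor.tmul (m a x) b - BTensor.tmul a (l x b)}

/-- The balanced tensor product `A ⊗_A B`, the quotient of `A ⊗ B` by the closed subspace generated
by the elements `(a x) ⊗ b - a ⊗ (x b)`. -/
abbrev Balanced (m : BHom A (BHom A A)) (l : BHom A (BHom B B)) : Type _ :=
  QuotBy (balancedRel m l)

/-- The class of `a ⊗ b` in `A ⊗_A B`. -/
def Balanced.tmul (m : BHom A (BHom A A)) (l : BHom A (BHom B B)) (a : A) (b : B) :
    Balanced m l := QuotBy.mk (balancedRel m l) (BTensor.tmul a b)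

/-- The canonical map `A ⊗_A B → B`, `a ⊗ b ↦ a b`, is an isomorphism of bornological vector
spaces. -/
def IsEssentialAction (m : BHom A (BHom A A)) (l : BHom A (BHom B B)) : Prop :=
  ∃ e : BIso (Balanced m l) B, ∀ a b, e.toHom (Balanced.tmul m l a b) = l a b

theorem Balanced.hom_ext {m : BHom A (BHom A A)} {l : BHom A (BHom B B)}
    {f g : BHom (Balanced m l) X}
    (h : ∀ a b, f (Balanced.tmul m l a b) = g (Balanced.tmul m l a b)) : f = g :=
  QuotBy.hom_ext fun x => DFunLike.congr_fun (BTensor.hom_ext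
    (f := f.comp (QuotBy.mk _)) (g := g.comp (QuotBy.mk _)) h) x

theorem Balanced.tmul_rel (m : BHom A (BHom A A)) (l : BHom A (BHom B B)) (a x : A) (b : B) :
    Balanced.tmul m l (m a x) b = Balanced.tmul m l a (l x b) := by
  have := QuotBy.mk_eq_zero (balancedRel m l) (x := BTensor.tmul (m a x) b - BTensor.tmul a (l x b))
    ⟨a, x, b, rfl⟩
  rwa [map_sub, sub_eq_zero] at this

theorem IsEssentialAction.hom_ext {m : BHom A (BHom A A)} {l : BHom A (BHom B B)}
    (h : IsEssentialAction m l) {f g : BHom B X} (hfg : ∀ a b, f (l a b) = g (l a b)) : f = g := by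
  obtain ⟨e, he⟩ := h
  have : f.comp e.toHom = g.comp e.toHom := Balanced.hom_ext fun a b => by simp [he, hfg]
  ext b
  have h1 := DFunLike.congr_fun this (e.inv b)
  simpa [e.toHom_inv] using h1

/-- A map `T` of `A` with `T (a x) = (T a) x` acts on essential modules by
`T (a b) = (T a) b`. -/
def IsEssentialAction.extend {m : BHom A (BHom A A)} {l : BHom A (BHom B B)}
    (h : IsEssentialAction m l) (T : BHom A A) (hT : ∀ a x, T (m a x) = m (T a) x) : BHom B B :=
  (h.choose.toHom.comp (QuotBy.lift
    ((QuotBy.mk (balancedRel m l)).comp (BTensor.map T (BHom.id B))) (by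
      rintro _ ⟨a, x, b, rfl⟩
      have := Balanced.tmul_rel m l (T a) x b
      simp only [BHom.comp_apply, map_sub, BTensor.map_tmul, hT, BHom.id_apply, sub_eq_zero]
      exact this))).comp h.choose.inv

theorem IsEssentialAction.extend_apply {m : BHom A (BHom A A)} {l : BHom A (BHom B B)}
    (h : IsEssentialAction m l) (T : BHom A A) (hT : ∀ a x, T (m a x) = m (T a) x) (a : A) (b : B) :
    h.extend T hT (l a b) = l (T a) b := by
  have e : h.choose.inv (l a b) = Balanced.tmul m l a b := by
    rw [← h.choose_spec a b, h.choose.inv_toHom]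
  rw [← h.choose_spec (T a) b]
  simp only [IsEssentialAction.extend, BHom.comp_apply, e]
  simp [Balanced.tmul]

end Balanced

variable {A : Type*} [NonUnitalRing A] [Module ℂ A] [BornAlgebra A]
variable {B : Type*} [NonUnitalRing B] [Module ℂ B] [BornAlgebra B]

/-- The opposite multiplication `(a, x) ↦ x * a`. -/
def mulOpHom (A : Type*) [NonUnitalRing A] [Module ℂ A] [BornAlgebra A] : BHom A (BHom A A) :=
  BHom.flip (mulHom A)

@[simp] theorem mulOpHom_apply (a x : A) : mulOpHom A a x = x * a := rfl

/-- A bornological algebra is essential if it is nonzero and the multiplication induces an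
isomorphism `A ⊗_A A ≅ A`. -/
class EssentialAlgebra (A : Type*) [NonUnitalRing A] [Module ℂ A] [BornAlgebra A] : Prop where
  nontrivial : Nontrivial A
  essential : IsEssentialAction (mulHom A) (mulHom A)

/-- The left action `(a, b) ↦ f(a) b` of `A` on `B` given by `f : A → M(B)`. -/
def leftAction (f : BHom A (Multiplier B)) : BHom A (BHom B B) := (Multiplier.LHom B).comp f

/-- The right action `(a, b) ↦ b f(a)` of `A` on `B` given by `f : A → M(B)`. -/
def rightAction (f : BHom A (Multiplier B)) : BHom A (BHom B B) := (Multiplier.RHom B).comp f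

@[simp] theorem leftAction_apply (f : BHom A (Multiplier B)) (a : A) (b : B) :
    leftAction f a b = (f a).L b := rfl
@[simp] theorem rightAction_apply (f : BHom A (Multiplier B)) (a : A) (b : B) :
    rightAction f a b = (f a).R b := rfl

/-- An essential homomorphism `f : A → M(B)`: a bounded algebra homomorphism which turns `B` into an
essential left and right `A`-module, that is, `A ⊗_A B ≅ B` and `B ⊗_A A ≅ B`. Here `B ⊗_A A` is
written with its factors interchanged, that is, as the quotient of `A ⊗ B` by the closed subspace
generated by the elements `(x a) ⊗ b - a ⊗ (b x)`. -/
structure EssHom (A : Type*) [NonUnitalRing A] [Module ℂ A] [BornAlgebra A]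
    (B : Type*) [NonUnitalRing B] [Module ℂ B] [BornAlgebra B] where
  toHom : BHom A (Multiplier B)
  map_mul : ∀ a a', toHom (a * a') = toHom a * toHom a'
  essential_left : IsEssentialAction (mulHom A) (leftAction toHom)
  essential_right : IsEssentialAction (mulOpHom A) (rightAction toHom)

namespace EssHom

theorem L_L (f : EssHom A B) (a a' : A) (b : B) :
    (f.toHom a).L ((f.toHom a').L b) = (f.toHom (a * a')).L b := by
  rw [f.map_mul, Multiplier.mul_L_apply]

theorem R_R (f : EssHom A B) (a a' : A) (b : B) :
    (f.toHom a).R ((f.toHom a').R b) = (f.toHom (a' * a)).R b := by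
  rw [f.map_mul, Multiplier.mul_R_apply]

/-- The left component of the extension to multipliers. -/
def extendL (f : EssHom A B) (m : Multiplier A) : BHom B B :=
  f.essential_left.extend m.L (fun a x => m.L_mul a x)

/-- The right component of the extension to multipliers. -/
def extendR (f : EssHom A B) (m : Multiplier A) : BHom B B :=
  f.essential_right.extend m.R (fun a x => m.R_mul x a)

theorem extendL_apply (f : EssHom A B) (m : Multiplier A) (a : A) (b : B) :
    f.extendL m ((f.toHom a).L b) = (f.toHom (m.L a)).L b :=
  f.essential_left.extend_apply m.L _ a b

theorem extendR_apply (f : EssHom A B) (m : Multiplier A) (a : A) (b : B) :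
    f.extendR m ((f.toHom a).R b) = (f.toHom (m.R a)).R b :=
  f.essential_right.extend_apply m.R _ a b

/-- The extension of an essential homomorphism `f : A → M(B)` to a unital homomorphism
`M(A) → M(B)`, determined by `f(m) (f(a) b) = f(m a) b` and `(b f(a)) f(m) = b f(a m)`. -/
def extend (f : EssHom A B) (m : Multiplier A) : Multiplier B :=
  Multiplier.mk (f.extendL m) (f.extendR m)
    (fun x y => DFunLike.congr_fun (f.essential_left.hom_ext
      (f := (f.extendL m).comp (BHom.flip (mulHom B) y))
      (g := (BHom.flip (mulHom B) y).comp (f.extendL m)) fun a b => by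
        simp only [BHom.comp_apply, BHom.flip_apply, mulHom_apply, leftAction_apply, extendL_apply]
        rw [← Multiplier.L_mul, extendL_apply, Multiplier.L_mul]) x)
    (fun x y => DFunLike.congr_fun (f.essential_right.hom_ext
      (f := (f.extendR m).comp (mulHom B x))
      (g := (mulHom B x).comp (f.extendR m)) fun a b => by
        simp only [BHom.comp_apply, mulHom_apply, rightAction_apply, extendR_apply]
        rw [← Multiplier.R_mul, extendR_apply, Multiplier.R_mul]) y)
    (fun x y => DFunLike.congr_fun (f.essential_left.hom_ext
      (f := (mulHom B x).comp (f.extendL m))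
      (g := (mulHom B (f.extendR m x))) fun a b => DFunLike.congr_fun (f.essential_right.hom_ext
        (f := (BHom.flip (mulHom B) (f.extendL m (leftAction f.toHom a b))))
        (g := (BHom.flip (mulHom B) (leftAction f.toHom a b)).comp
          (f.extendR m)) fun a' b' => by
          simp only [BHom.comp_apply, BHom.flip_apply, mulHom_apply, extendL_apply, extendR_apply,
            leftAction_apply, rightAction_apply]
          rw [← Multiplier.mul_L, ← Multiplier.mul_L, L_L, L_L, m.mul_L]) x) y)

/-- The extension is a homomorphism. -/
theorem extend_mul (f : EssHom A B) (m n : Multiplier A) :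
    f.extend (m * n) = f.extend m * f.extend n := by
  refine Multiplier.ext (fun x => DFunLike.congr_fun (f.essential_left.hom_ext
    (f := f.extendL (m * n)) (g := (f.extendL m).comp (f.extendL n)) fun a b => ?_) x)
    (fun x => DFunLike.congr_fun (f.essential_right.hom_ext
    (f := f.extendR (m * n)) (g := (f.extendR n).comp (f.extendR m)) fun a b => ?_) x)
  · simp [extendL_apply]
  · simp [extendR_apply]

/-- The extension is unital. -/
theorem extend_one (f : EssHom A B) : f.extend 1 = 1 := by
  refine Multiplier.ext (fun x => DFunLike.congr_fun (f.essential_left.hom_ext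
    (f := f.extendL 1) (g := BHom.id B) fun a b => ?_) x)
    (fun x => DFunLike.congr_fun (f.essential_right.hom_ext
    (f := f.extendR 1) (g := BHom.id B) fun a b => ?_) x)
  · simp [extendL_apply]
  · simp [extendR_apply]

/-- The extension extends `f`. -/
theorem extend_ι (f : EssHom A B) (a : A) : f.extend (Multiplier.ι A a) = f.toHom a := by
  refine Multiplier.ext (fun x => DFunLike.congr_fun (f.essential_left.hom_ext
    (f := f.extendL (Multiplier.ι A a)) (g := (f.toHom a).L) fun a' b => ?_) x)
    (fun x => DFunLike.congr_fun (f.essential_right.hom_ext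
    (f := f.extendR (Multiplier.ι A a)) (g := (f.toHom a).R) fun a' b => ?_) x)
  · simp [extendL_apply, L_L]
  · simp [extendR_apply, R_R]

end EssHom

end Essential

section TensorEssential

section Abstract

variable {A₁ : Type*} [AddCommGroup A₁] [Module ℂ A₁] [BornSpace A₁]
variable {A₂ : Type*} [AddCommGroup A₂] [Module ℂ A₂] [BornSpace A₂]
variable {B₁ : Type*} [AddCommGroup B₁] [Module ℂ B₁] [BornSpace B₁]
variable {B₂ : Type*} [AddCommGroup B₂] [Module ℂ B₂] [BornSpace B₂]
variable {C₁ : Type*} [AddCommGroup C₁] [Module ℂ C₁] [BornSpace C₁]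
variable {C₂ : Type*} [AddCommGroup C₂] [Module ℂ C₂] [BornSpace C₂]

/-- The bounded bilinear map `(a₁ ⊗ a₂, b₁ ⊗ b₂) ↦ β₁ a₁ b₁ ⊗ β₂ a₂ b₂`. -/
def BTensor.tensorBil (β₁ : BHom A₁ (BHom B₁ C₁)) (β₂ : BHom A₂ (BHom B₂ C₂)) :
    BHom (BTensor A₁ A₂) (BHom (BTensor B₁ B₂) (BTensor C₁ C₂)) :=
  BTensor.lift (BHom.comp₂ (BTensor.mapHom B₁ C₁ B₂ C₂) β₁ β₂)

@[simp] theorem BTensor.tensorBil_tmul (β₁ : BHom A₁ (BHom B₁ C₁)) (β₂ : BHom A₂ (BHom B₂ C₂))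
    (a₁ : A₁) (a₂ : A₂) (b₁ : B₁) (b₂ : B₂) :
    BTensor.tensorBil β₁ β₂ (BTensor.tmul a₁ a₂) (BTensor.tmul b₁ b₂) =
      BTensor.tmul (β₁ a₁ b₁) (β₂ a₂ b₂) := by
  simp [BTensor.tensorBil]

open BTensor in
theorem tensorBil_action {m₁ : BHom A₁ (BHom A₁ A₁)} {m₂ : BHom A₂ (BHom A₂ A₂)}
    {l₁ : BHom A₁ (BHom B₁ B₁)} {l₂ : BHom A₂ (BHom B₂ B₂)}
    (h₁ : ∀ a x b, l₁ (m₁ a x) b = l₁ a (l₁ x b)) (h₂ : ∀ a x b, l₂ (m₂ a x) b = l₂ a (l₂ x b))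
    (a x : BTensor A₁ A₂) (b : BTensor B₁ B₂) :
    tensorBil l₁ l₂ (tensorBil m₁ m₂ a x) b = tensorBil l₁ l₂ a (tensorBil l₁ l₂ x b) := by
  have e1 : ∀ a₁ a₂ x₁ x₂ (b : BTensor B₁ B₂),
      tensorBil l₁ l₂ (tensorBil m₁ m₂ (tmul a₁ a₂) (tmul x₁ x₂)) b =
        tensorBil l₁ l₂ (tmul a₁ a₂) (tensorBil l₁ l₂ (tmul x₁ x₂) b) := by
    intro a₁ a₂ x₁ x₂ b
    refine DFunLike.congr_fun (hom_ext
      (f := tensorBil l₁ l₂ (tensorBil m₁ m₂ (tmul a₁ a₂) (tmul x₁ x₂)))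
      (g := (tensorBil l₁ l₂ (tmul a₁ a₂)).comp (tensorBil l₁ l₂ (tmul x₁ x₂))) ?_) b
    intro b₁ b₂
    simp [h₁, h₂]
  have e2 : BHom.post (BHom.flip (tensorBil l₁ l₂) b) (tensorBil m₁ m₂) =
      BHom.comp₂ (tensorBil l₁ l₂) (BHom.id _) (BHom.flip (tensorBil l₁ l₂) b) :=
    hom_ext₂ fun a₁ a₂ x₁ x₂ => e1 a₁ a₂ x₁ x₂ b
  exact DFunLike.congr_fun (DFunLike.congr_fun e2 a) x

open BTensor in
/-- The tensor product of essential actions is essential. -/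
theorem IsEssentialAction.tensor {m₁ : BHom A₁ (BHom A₁ A₁)} {m₂ : BHom A₂ (BHom A₂ A₂)}
    {l₁ : BHom A₁ (BHom B₁ B₁)} {l₂ : BHom A₂ (BHom B₂ B₂)}
    (ha₁ : ∀ a x y, m₁ (m₁ a x) y = m₁ a (m₁ x y)) (ha₂ : ∀ a x y, m₂ (m₂ a x) y = m₂ a (m₂ x y))
    (h₁ : ∀ a x b, l₁ (m₁ a x) b = l₁ a (l₁ x b)) (h₂ : ∀ a x b, l₂ (m₂ a x) b = l₂ a (l₂ x b))
    (he₁ : IsEssentialAction m₁ m₁) (he₂ : IsEssentialAction m₂ m₂)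
    (hl₁ : IsEssentialAction m₁ l₁) (hl₂ : IsEssentialAction m₂ l₂) :
    IsEssentialAction (tensorBil m₁ m₂) (tensorBil l₁ l₂) := by
  set M := tensorBil m₁ m₂ with hM
  set Λ := tensorBil l₁ l₂ with hΛ
  have hact : ∀ a x b, Λ (M a x) b = Λ a (Λ x b) := tensorBil_action h₁ h₂
  have hΛt : ∀ a₁ a₂ b₁ b₂, Λ (tmul a₁ a₂) (tmul b₁ b₂) = tmul (l₁ a₁ b₁) (l₂ a₂ b₂) :=
    tensorBil_tmul l₁ l₂
  let fwd : BHom (Balanced M Λ) (BTensor B₁ B₂) := QuotBy.lift (BTensor.lift Λ) (by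
    rintro _ ⟨a, x, b, rfl⟩
    rw [map_sub, lift_tmul, lift_tmul, hact, sub_self])
  have fwd_tmul : ∀ a b, fwd (Balanced.tmul M Λ a b) = Λ a b := fun a b => lift_tmul Λ a b
  -- the class of `(a₁ ⊗ a₂) ⊗ (b₁ ⊗ b₂)`
  have key1 : ∀ a x b a₂ b₂, Balanced.tmul M Λ (tmul (m₁ a x) a₂) (tmul b b₂) =
      Balanced.tmul M Λ (tmul a a₂) (tmul (l₁ x b) b₂) := by
    intro a x b a₂ b₂
    let C : BHom (BTensor A₁ A₂) (BHom (BTensor B₁ B₂) (Balanced M Λ)) :=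
      BHom.post (QuotBy.mk _) (tmulHom (BTensor A₁ A₂) (BTensor B₁ B₂))
    refine DFunLike.congr_fun (he₂.hom_ext
      (f := (BHom.flip C (tmul b b₂)).comp (tmulHom A₁ A₂ (m₁ a x)))
      (g := (BHom.flip C (tmul (l₁ x b) b₂)).comp (tmulHom A₁ A₂ a)) fun p q => ?_) a₂
    refine DFunLike.congr_fun (he₁.hom_ext
      (f := (BHom.flip C (tmul b b₂)).comp ((BHom.flip (tmulHom A₁ A₂) (m₂ p q)).comp
        (BHom.flip m₁ x)))
      (g := (BHom.flip C (tmul (l₁ x b) b₂)).comp (BHom.flip (tmulHom A₁ A₂) (m₂ p q)))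
      fun r s => ?_) a
    change Balanced.tmul M Λ (tmul (m₁ (m₁ r s) x) (m₂ p q)) (tmul b b₂) =
      Balanced.tmul M Λ (tmul (m₁ r s) (m₂ p q)) (tmul (l₁ x b) b₂)
    rw [ha₁, ← tensorBil_tmul m₁ m₂, ← tensorBil_tmul m₁ m₂, ← hM, Balanced.tmul_rel,
      Balanced.tmul_rel, hΛ, tensorBil_tmul, tensorBil_tmul, h₁]
  have key2 : ∀ a x b a₁ b₁, Balanced.tmul M Λ (tmul a₁ (m₂ a x)) (tmul b₁ b) =
      Balanced.tmul M Λ (tmul a₁ a) (tmul b₁ (l₂ x b)) := by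
    intro a x b a₁ b₁
    let C : BHom (BTensor A₁ A₂) (BHom (BTensor B₁ B₂) (Balanced M Λ)) :=
      BHom.post (QuotBy.mk _) (tmulHom (BTensor A₁ A₂) (BTensor B₁ B₂))
    refine DFunLike.congr_fun (he₁.hom_ext
      (f := (BHom.flip C (tmul b₁ b)).comp (BHom.flip (tmulHom A₁ A₂) (m₂ a x)))
      (g := (BHom.flip C (tmul b₁ (l₂ x b))).comp (BHom.flip (tmulHom A₁ A₂) a))
      fun p q => ?_) a₁
    refine DFunLike.congr_fun (he₂.hom_ext
      (f := (BHom.flip C (tmul b₁ b)).comp ((tmulHom A₁ A₂ (m₁ p q)).comp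
        (BHom.flip m₂ x)))
      (g := (BHom.flip C (tmul b₁ (l₂ x b))).comp (tmulHom A₁ A₂ (m₁ p q)))
      fun r s => ?_) a
    change Balanced.tmul M Λ (tmul (m₁ p q) (m₂ (m₂ r s) x)) (tmul b₁ b) =
      Balanced.tmul M Λ (tmul (m₁ p q) (m₂ r s)) (tmul b₁ (l₂ x b))
    rw [ha₂, ← tensorBil_tmul m₁ m₂, ← tensorBil_tmul m₁ m₂, ← hM, Balanced.tmul_rel,
      Balanced.tmul_rel, hΛ, tensorBil_tmul, tensorBil_tmul, h₂]
  let P : BHom (BTensor A₁ B₁) (BHom (BTensor A₂ B₂) (Balanced M Λ)) :=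
    BHom.post (QuotBy.mk _) (tensorBil (tmulHom A₁ A₂) (tmulHom B₁ B₂))
  have hP : ∀ a₁ b₁ a₂ b₂, P (tmul a₁ b₁) (tmul a₂ b₂) =
      Balanced.tmul M Λ (tmul a₁ a₂) (tmul b₁ b₂) := by
    intro a₁ b₁ a₂ b₂
    simp [P, Balanced.tmul]
  let P₁ : BHom (Balanced m₁ l₁) (BHom (BTensor A₂ B₂) (Balanced M Λ)) := QuotBy.lift P (by
    rintro _ ⟨a, x, b, rfl⟩
    rw [map_sub, sub_eq_zero]
    refine BTensor.hom_ext fun a₂ b₂ => ?_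
    rw [hP, hP, key1])
  let P₂ : BHom (Balanced m₂ l₂) (BHom (Balanced m₁ l₁) (Balanced M Λ)) :=
    QuotBy.lift (BHom.flip P₁) (by
      rintro _ ⟨a, x, b, rfl⟩
      rw [map_sub, sub_eq_zero]
      refine Balanced.hom_ext fun a₁ b₁ => ?_
      change P (tmul a₁ b₁) (tmul (m₂ a x) b) = P (tmul a₁ b₁) (tmul a (l₂ x b))
      rw [hP, hP, key2])
  have hP₂ : ∀ a₁ b₁ a₂ b₂, P₂ (Balanced.tmul m₂ l₂ a₂ b₂) (Balanced.tmul m₁ l₁ a₁ b₁) =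
      Balanced.tmul M Λ (tmul a₁ a₂) (tmul b₁ b₂) := fun a₁ b₁ a₂ b₂ => hP a₁ b₁ a₂ b₂
  obtain ⟨e₁, he₁'⟩ := id hl₁
  obtain ⟨e₂, he₂'⟩ := id hl₂
  have inv₁ : ∀ a b, e₁.inv (l₁ a b) = Balanced.tmul m₁ l₁ a b := fun a b => by
    rw [← he₁', e₁.inv_toHom]
  have inv₂ : ∀ a b, e₂.inv (l₂ a b) = Balanced.tmul m₂ l₂ a b := fun a b => by
    rw [← he₂', e₂.inv_toHom]
  let bwd : BHom (BTensor B₁ B₂) (Balanced M Λ) :=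
    BTensor.lift (BHom.comp₂ (BHom.flip P₂) e₁.inv e₂.inv)
  have hbwd : ∀ a₁ b₁ a₂ b₂, bwd (tmul (l₁ a₁ b₁) (l₂ a₂ b₂)) =
      Balanced.tmul M Λ (tmul a₁ a₂) (tmul b₁ b₂) := by
    intro a₁ b₁ a₂ b₂
    rw [← hP₂, ← inv₁, ← inv₂]
    exact lift_tmul _ _ _
  refine ⟨⟨fwd, bwd, fun z => ?_, fun b => ?_⟩, fwd_tmul⟩
  · refine DFunLike.congr_fun (Balanced.hom_ext (f := bwd.comp fwd) (g := BHom.id _)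
      fun a b => ?_) z
    refine DFunLike.congr_fun (DFunLike.congr_fun (hom_ext₂
      (f := BHom.post (bwd.comp fwd) (BHom.post (QuotBy.mk _) (tmulHom _ _)))
      (g := BHom.post (QuotBy.mk (balancedRel M Λ)) (tmulHom (BTensor A₁ A₂) (BTensor B₁ B₂)))
      fun a₁ a₂ b₁ b₂ => ?_) a) b
    change bwd (fwd (Balanced.tmul M Λ (tmul a₁ a₂) (tmul b₁ b₂))) = Balanced.tmul M Λ _ _
    rw [fwd_tmul, hΛt, hbwd]
  · refine DFunLike.congr_fun (BTensor.hom_ext (f := fwd.comp bwd) (g := BHom.id _)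
      fun b₁ b₂ => ?_) b
    refine DFunLike.congr_fun (hl₁.hom_ext
      (f := (fwd.comp bwd).comp (BHom.flip (tmulHom B₁ B₂) b₂))
      (g := BHom.flip (tmulHom B₁ B₂) b₂) fun a₁ b₁ => ?_) b₁
    refine DFunLike.congr_fun (hl₂.hom_ext
      (f := (fwd.comp bwd).comp (tmulHom B₁ B₂ (l₁ a₁ b₁)))
      (g := tmulHom B₁ B₂ (l₁ a₁ b₁)) fun a₂ b₂ => ?_) b₂
    change fwd (bwd (tmul (l₁ a₁ b₁) (l₂ a₂ b₂))) = tmul (l₁ a₁ b₁) (l₂ a₂ b₂)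
    rw [hbwd, fwd_tmul, hΛt]

/-- An essential algebra is also essential with the opposite multiplication. -/
theorem IsEssentialAction.op {m : BHom A₁ (BHom A₁ A₁)}
    (h : IsEssentialAction m m) : IsEssentialAction (BHom.flip m) (BHom.flip m) := by
  obtain ⟨e, he⟩ := h
  let fwd : BHom (Balanced (BHom.flip m) (BHom.flip m)) (Balanced m m) :=
    QuotBy.lift ((QuotBy.mk _).comp (BTensor.swap A₁ A₁)) (by
      rintro _ ⟨a, x, b, rfl⟩
      have := Balanced.tmul_rel m m b x a
      rw [map_sub, sub_eq_zero]
      simp only [BHom.comp_apply, BTensor.swap_tmul]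
      exact this.symm)
  let bwd : BHom (Balanced m m) (Balanced (BHom.flip m) (BHom.flip m)) :=
    QuotBy.lift ((QuotBy.mk _).comp (BTensor.swap A₁ A₁)) (by
      rintro _ ⟨a, x, b, rfl⟩
      have := Balanced.tmul_rel (BHom.flip m) (BHom.flip m) b x a
      rw [map_sub, sub_eq_zero]
      simp only [BHom.comp_apply, BTensor.swap_tmul]
      exact this.symm)
  have hf : ∀ a b, fwd (Balanced.tmul _ _ a b) = Balanced.tmul m m b a := fun a b => by
    simp [fwd, Balanced.tmul]
  have hb : ∀ a b, bwd (Balanced.tmul m m a b) = Balanced.tmul _ _ b a := fun a b => by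
    simp [bwd, Balanced.tmul]
  have h1 : bwd.comp fwd = BHom.id _ := Balanced.hom_ext fun a b => by simp [hf, hb]
  have h2 : fwd.comp bwd = BHom.id _ := Balanced.hom_ext fun a b => by simp [hf, hb]
  refine ⟨⟨e.toHom.comp fwd, bwd.comp e.inv, fun z => ?_, fun z => ?_⟩, fun a b => ?_⟩
  · simp only [BHom.comp_apply, e.inv_toHom]
    exact DFunLike.congr_fun h1 z
  · have := DFunLike.congr_fun h2 (e.inv z)
    simp only [BHom.comp_apply, BHom.id_apply] at this ⊢
    rw [this, e.toHom_inv]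
  · simp [hf, he]

end Abstract

variable {A : Type*} [NonUnitalRing A] [Module ℂ A] [BornAlgebra A]
variable {B : Type*} [NonUnitalRing B] [Module ℂ B] [BornAlgebra B]
variable {A' : Type*} [NonUnitalRing A'] [Module ℂ A'] [BornAlgebra A']
variable {B' : Type*} [NonUnitalRing B'] [Module ℂ B'] [BornAlgebra B']

namespace EssHom

/-- The canonical map `A → M(A)` as an essential homomorphism. -/
def id (A : Type*) [NonUnitalRing A] [Module ℂ A] [BornAlgebra A] [EssentialAlgebra A] :
    EssHom A A where
  toHom := Multiplier.ι A
  map_mul a a' := Multiplier.ext (fun x => mul_assoc a a' x) (fun x => (mul_assoc x a a').symm)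
  essential_left := EssentialAlgebra.essential
  essential_right := (EssentialAlgebra.essential (A := A)).op

/-- The homomorphism `f ⊗ g : A ⊗ A' → M(B ⊗ B')` induced by `f : A → M(B)` and
`g : A' → M(B')`. -/
def tensorHom (f : BHom A (Multiplier B)) (g : BHom A' (Multiplier B')) :
    BHom (BTensor A A') (Multiplier (BTensor B B')) :=
  BTensor.lift (BHom.comp₂ (Multiplier.tmulHom B B') f g)

@[simp] theorem tensorHom_tmul (f : BHom A (Multiplier B)) (g : BHom A' (Multiplier B')) (a : A)
    (a' : A') : tensorHom f g (BTensor.tmul a a') = Multiplier.tmul (f a) (g a') := by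
  simp [tensorHom]

/-- The tensor product of essential homomorphisms defined on essential algebras is an essential
homomorphism. -/
def tensor [EssentialAlgebra A] [EssentialAlgebra A'] (f : EssHom A B) (g : EssHom A' B') :
    EssHom (BTensor A A') (BTensor B B') where
  toHom := tensorHom f.toHom g.toHom
  map_mul a a' := DFunLike.congr_fun (DFunLike.congr_fun (BTensor.hom_ext₂
    (f := BHom.post (tensorHom f.toHom g.toHom) (mulHom (BTensor A A')))
    (g := BHom.comp₂ (Multiplier.mulHom _) (tensorHom f.toHom g.toHom)
      (tensorHom f.toHom g.toHom)) fun a b a' b' => by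
      simp only [BHom.post_apply, BHom.comp₂_apply, mulHom_apply, BTensor.tmul_mul_tmul,
        tensorHom_tmul, f.map_mul, g.map_mul, Multiplier.mulHom_apply]
      exact Multiplier.ext (fun x => DFunLike.congr_fun (BTensor.hom_ext
        (f := BTensor.map _ _) (g := (BTensor.map _ _).comp (BTensor.map _ _)) (by simp)) x)
        (fun x => DFunLike.congr_fun (BTensor.hom_ext
        (f := BTensor.map _ _) (g := (BTensor.map _ _).comp (BTensor.map _ _)) (by simp)) x)) a) a'
  essential_left := by
    have e1 : mulHom (BTensor A A') = BTensor.tensorBil (mulHom A) (mulHom A') :=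
      BTensor.hom_ext₂ (by simp)
    have e2 : leftAction (tensorHom f.toHom g.toHom) =
        BTensor.tensorBil (leftAction f.toHom) (leftAction g.toHom) :=
      BTensor.hom_ext₂ (by simp)
    rw [e1, e2]
    exact IsEssentialAction.tensor mul_assoc mul_assoc (fun a x b => (L_L f a x b).symm)
      (fun a x b => (L_L g a x b).symm) EssentialAlgebra.essential EssentialAlgebra.essential
      f.essential_left g.essential_left
  essential_right := by
    have e1 : mulOpHom (BTensor A A') = BTensor.tensorBil (mulOpHom A) (mulOpHom A') :=
      BTensor.hom_ext₂ (by simp)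
    have e2 : rightAction (tensorHom f.toHom g.toHom) =
        BTensor.tensorBil (rightAction f.toHom) (rightAction g.toHom) :=
      BTensor.hom_ext₂ (by simp)
    rw [e1, e2]
    exact IsEssentialAction.tensor (fun a x y => (mul_assoc y x a).symm)
      (fun a x y => (mul_assoc y x a).symm) (fun a x b => (R_R f a x b).symm)
      (fun a x b => (R_R g a x b).symm) (EssentialAlgebra.essential (A := A)).op
      (EssentialAlgebra.essential (A := A')).op f.essential_right g.essential_right

end EssHom

end TensorEssential

/-! ## The approximation property -/

section Approximation

variable {V : Type*} [AddCommGroup V] [Module ℂ V] [BornSpace V]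
variable {W : Type*} [AddCommGroup W] [Module ℂ W] [BornSpace W]

/-- A compact subset of `V` is a compact subset of the Banach space `⟨T⟩` for some completant small
disk `T`. As `⟨T⟩` is a normed space, this means that every sequence in the subset has a subsequence
which converges in `⟨T⟩` to a point of the subset. -/
def IsCompactSubset (S : Set V) : Prop :=
  ∃ T : Set V, IsBounded T ∧ IsCompletant T ∧ S ⊆ Submodule.span ℂ T ∧
    ∀ x : ℕ → V, (∀ n, x n ∈ S) → ∃ y ∈ S, ∃ k : ℕ → ℕ, StrictMono k ∧
      ∀ ε : ℝ, 0 < ε → ∃ N, ∀ n ≥ N, x (k n) - y ∈ (ε : ℂ) • T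

/-- Operators of finite rank: the finite sums of operators `x ↦ l(x) w` with `w ∈ W` and a bounded
linear functional `l` on `V`. -/
def IsFiniteRank (f : BHom V W) : Prop :=
  ∃ (n : ℕ) (w : Fin n → W) (l : Fin n → BHom V ℂ), ∀ x, f x = ∑ i, l i x • w i

/-- The approximation property: for every compact disk `S` there are operators `f n` of finite rank
which converge to the identity in `Hom(⟨S⟩, V)`. This means that for some small disk `T` and for
every `ε > 0` the map `f n - id` maps `S` into `ε T` for almost all `n`. -/
def HasApproximationProperty (V : Type*) [AddCommGroup V] [Module ℂ V] [BornSpace V] : Prop :=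
  ∀ S : Set V, IsDisk S → IsCompactSubset S → ∃ f : ℕ → BHom V V, (∀ n, IsFiniteRank (f n)) ∧
    ∃ T : Set V, IsBounded T ∧ IsDisk T ∧
      ∀ ε : ℝ, 0 < ε → ∃ N, ∀ n ≥ N, ∀ x ∈ S, f n x - x ∈ (ε : ℂ) • T

end Approximation

/-! ## Slice maps -/

section Slices

variable {V : Type*} [AddCommGroup V] [Module ℂ V] [BornSpace V]
variable {W : Type*} [AddCommGroup W] [Module ℂ W] [BornSpace W]

/-- A bounded linear map is an isomorphism of bornological vector spaces. -/
def IsIso (f : BHom V W) : Prop := ∃ e : BIso V W, e.toHom = f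

/-- Scalar multiplication as a bounded bilinear map. -/
def smulHom (V : Type*) [AddCommGroup V] [Module ℂ V] [BornSpace V] : BHom ℂ (BHom V V) :=
  BHom.mk₂ (LinearMap.lsmul ℂ V) (by
    intro S T hS hT
    obtain ⟨r, hr⟩ := isBounded_iff_forall_norm_le.1 hS
    obtain ⟨D, h1, h2, h3, -⟩ := exists_disk hT
    refine (isBounded_smul ((max r 0 : ℝ) : ℂ) h2).subset ?_
    rintro _ ⟨a, ha, x, hx, rfl⟩
    have h4 := h3.toIsDisk.smul_mem a (r := 1) (x := x) (by simpa using h1 hx)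
    exact h3.toIsDisk.mono_mem (by positivity)
      (by rw [mul_one]; exact (hr a ha).trans (le_max_left _ _)) h4)

@[simp] theorem smulHom_apply (a : ℂ) (x : V) : smulHom V a x = a • x := rfl

/-- The isomorphism `ℂ ⊗ V ≅ V`. -/
def BTensor.lid (V : Type*) [AddCommGroup V] [Module ℂ V] [BornSpace V] :
    BIso (BTensor ℂ V) V where
  toHom := BTensor.lift (smulHom V)
  inv := BTensor.tmulHom ℂ V 1
  inv_toHom x := DFunLike.congr_fun (BTensor.hom_ext
    (f := (BTensor.tmulHom ℂ V 1).comp (BTensor.lift (smulHom V))) (g := BHom.id _) (fun a v => by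
      simp [← BTensor.smul_tmul])) x
  toHom_inv y := by simp

/-- The isomorphism `V ⊗ ℂ ≅ V`. -/
def BTensor.rid (V : Type*) [AddCommGroup V] [Module ℂ V] [BornSpace V] :
    BIso (BTensor V ℂ) V where
  toHom := BTensor.lift (BHom.flip (smulHom V))
  inv := BHom.flip (BTensor.tmulHom V ℂ) 1
  inv_toHom x := DFunLike.congr_fun (BTensor.hom_ext
    (f := (BHom.flip (BTensor.tmulHom V ℂ) 1).comp (BTensor.lift (BHom.flip (smulHom V))))
    (g := BHom.id _) (fun v a => by
      simp [← BTensor.tmul_smul])) x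
  toHom_inv y := by simp

@[simp] theorem BTensor.lid_tmul (a : ℂ) (v : V) : (lid V).toHom (tmul a v) = a • v := by
  simp [lid]

@[simp] theorem BTensor.rid_tmul (v : V) (a : ℂ) : (rid V).toHom (tmul v a) = a • v := by
  simp [rid]

/-- The slice map `ω ⊗ id : V ⊗ W → W` of a functional `ω` on `V`. -/
def sliceLeft (ω : BHom V ℂ) : BHom (BTensor V W) W :=
  (BTensor.lid W).toHom.comp (BTensor.map ω (BHom.id W))

/-- The slice map `id ⊗ ω : V ⊗ W → V` of a functional `ω` on `W`. -/
def sliceRight (ω : BHom W ℂ) : BHom (BTensor V W) V :=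
  (BTensor.rid V).toHom.comp (BTensor.map (BHom.id V) ω)

@[simp] theorem sliceLeft_tmul (ω : BHom V ℂ) (v : V) (w : W) :
    sliceLeft ω (BTensor.tmul v w) = ω v • w := by
  simp [sliceLeft]

@[simp] theorem sliceRight_tmul (ω : BHom W ℂ) (v : V) (w : W) :
    sliceRight ω (BTensor.tmul v w) = ω w • v := by
  simp [sliceRight]

end Slices

/-! ## Bornological quantum groups -/

section QuantumGroups

/-- Multipliers `m` of `A` and `n` of `B` agree under the identification `A ≅ B` given by an
isomorphism `e`. -/
def Multiplier.Corresponds {A : Type*} [NonUnitalRing A] [Module ℂ A] [BornAlgebra A]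
    {B : Type*} [NonUnitalRing B] [Module ℂ B] [BornAlgebra B] (e : BIso A B)
    (m : Multiplier A) (n : Multiplier B) : Prop :=
  ∀ x, e.toHom (m.L x) = n.L (e.toHom x) ∧ e.toHom (m.R x) = n.R (e.toHom x)

variable {H : Type*} [NonUnitalRing H] [Module ℂ H] [BornAlgebra H]

/-- A bounded linear functional `ω` is faithful if the bilinear form `(f, g) ↦ ω(f g)` is
nondegenerate in both variables. -/
def IsFaithful (ω : BHom H ℂ) : Prop :=
  (∀ f, (∀ g, ω (f * g) = 0) → f = 0) ∧ ∀ g, (∀ f, ω (f * g) = 0) → g = 0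

/-- `f ↦ f ⊗ 1 ∈ M(H ⊗ H)`. -/
def leg₁ (H : Type*) [NonUnitalRing H] [Module ℂ H] [BornAlgebra H] :
    BHom H (Multiplier (BTensor H H)) :=
  (BHom.flip (Multiplier.tmulHom H H) 1).comp (Multiplier.ι H)

/-- `f ↦ 1 ⊗ f ∈ M(H ⊗ H)`. -/
def leg₂ (H : Type*) [NonUnitalRing H] [Module ℂ H] [BornAlgebra H] :
    BHom H (Multiplier (BTensor H H)) :=
  (Multiplier.tmulHom H H 1).comp (Multiplier.ι H)

/-- The Galois map `f ⊗ g ↦ Δ(f) (g ⊗ 1)`. -/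
def gammaL (Δ : EssHom H (BTensor H H)) : BHom (BTensor H H) (Multiplier (BTensor H H)) :=
  BTensor.lift (BHom.comp₂ (Multiplier.mulHom (BTensor H H)) Δ.toHom (leg₁ H))

/-- The Galois map `f ⊗ g ↦ Δ(f) (1 ⊗ g)`. -/
def gammaR (Δ : EssHom H (BTensor H H)) : BHom (BTensor H H) (Multiplier (BTensor H H)) :=
  BTensor.lift (BHom.comp₂ (Multiplier.mulHom (BTensor H H)) Δ.toHom (leg₂ H))

/-- The Galois map `f ⊗ g ↦ (f ⊗ 1) Δ(g)`. -/
def rhoL (Δ : EssHom H (BTensor H H)) : BHom (BTensor H H) (Multiplier (BTensor H H)) :=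
  BTensor.lift (BHom.comp₂ (Multiplier.mulHom (BTensor H H)) (leg₁ H) Δ.toHom)

/-- The Galois map `f ⊗ g ↦ (1 ⊗ f) Δ(g)`. -/
def rhoR (Δ : EssHom H (BTensor H H)) : BHom (BTensor H H) (Multiplier (BTensor H H)) :=
  BTensor.lift (BHom.comp₂ (Multiplier.mulHom (BTensor H H)) (leg₂ H) Δ.toHom)

/-- The Galois maps define bounded linear maps from `H ⊗ H` into itself: a choice of bounded linear
maps `H ⊗ H → H ⊗ H` whose compositions with the canonical map `H ⊗ H → M(H ⊗ H)` are the Galois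
maps. (The choice is unique if the canonical map is injective.) -/
structure GaloisMaps (Δ : EssHom H (BTensor H H)) where
  γl : BHom (BTensor H H) (BTensor H H)
  γr : BHom (BTensor H H) (BTensor H H)
  ρl : BHom (BTensor H H) (BTensor H H)
  ρr : BHom (BTensor H H) (BTensor H H)
  γl_spec : ∀ x, Multiplier.ι (BTensor H H) (γl x) = gammaL Δ x
  γr_spec : ∀ x, Multiplier.ι (BTensor H H) (γr x) = gammaR Δ x
  ρl_spec : ∀ x, Multiplier.ι (BTensor H H) (ρl x) = rhoL Δ x
  ρr_spec : ∀ x, Multiplier.ι (BTensor H H) (ρr x) = rhoR Δ x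

/-- Left invariance `(id ⊗ φ) Δ(f) = φ(f) 1` of a bounded linear functional `φ`, where the multiplier
`(id ⊗ φ) Δ(f)` of `H` is given by `(id ⊗ φ) Δ(f) · g = (id ⊗ φ) γl (f ⊗ g)` and
`g · (id ⊗ φ) Δ(f) = (id ⊗ φ) ρl (g ⊗ f)`. -/
def IsLeftInvariant {Δ : EssHom H (BTensor H H)} (G : GaloisMaps Δ) (φ : BHom H ℂ) : Prop :=
  ∀ f g : H, sliceRight φ (G.γl (BTensor.tmul f g)) = φ f • g ∧
    sliceRight φ (G.ρl (BTensor.tmul g f)) = φ f • g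

/-- The antiautomorphism `f ⊗ g ↦ S(g) ⊗ S(f)`, that is, `(S ⊗ S) τ` where `τ` is the flip. -/
def antiSwap (S : BHom H H) : BHom (BTensor H H) (BTensor H H) :=
  (BTensor.map S S).comp (BTensor.swap H H)

/-- A bijective antihomomorphism of algebras `S` is an antihomomorphism of coalgebras if
`Δ(S(f)) = (S ⊗ S) τ Δ(f)`. On the right hand side, the algebra antiautomorphism `σ = (S ⊗ S) τ` of
`H ⊗ H` is extended to multipliers: `σ(m) σ(x) = σ(x m)` and `σ(x) σ(m) = σ(m x)`. -/
def IsCoalgebraAntihom (Δ : EssHom H (BTensor H H)) (S : BIso H H) : Prop :=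
  ∀ (f : H) (x : BTensor H H),
    (Δ.toHom (S.toHom f)).L (antiSwap S.toHom x) = antiSwap S.toHom ((Δ.toHom f).R x) ∧
    (Δ.toHom (S.toHom f)).R (antiSwap S.toHom x) = antiSwap S.toHom ((Δ.toHom f).L x)

variable [EssentialAlgebra H]

/-- Coassociativity `(Δ ⊗ id) Δ = (id ⊗ Δ) Δ` of an essential homomorphism, where `Δ ⊗ id` and
`id ⊗ Δ` are extended to multipliers and `(H ⊗ H) ⊗ H` is identified with `H ⊗ (H ⊗ H)`. An essential
homomorphism `Δ : H → M(H ⊗ H)` with this property is called a comultiplication. -/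
def IsComultiplication (Δ : EssHom H (BTensor H H)) : Prop :=
  ∀ f, Multiplier.Corresponds (BTensor.assoc H H H)
    ((Δ.tensor (EssHom.id H)).extend (Δ.toHom f)) (((EssHom.id H).tensor Δ).extend (Δ.toHom f))

/-- A bornological quantum group: an essential algebra `H` with the approximation property, together
with a comultiplication `Δ` such that all Galois maps are isomorphisms of `H ⊗ H` onto itself, and
a faithful left invariant functional `φ`. -/
structure IsBornologicalQuantumGroup (Δ : EssHom H (BTensor H H)) (φ : BHom H ℂ) : Prop where
  approximation : HasApproximationProperty H
  comultiplication : IsComultiplication Δ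
  galois : ∃ G : GaloisMaps Δ, IsIso G.γl ∧ IsIso G.γr ∧ IsIso G.ρl ∧ IsIso G.ρr ∧
    IsLeftInvariant G φ
  faithful : IsFaithful φ

/-- The functional `ε` is an essential algebra homomorphism, that is, it defines an essential
homomorphism from `H` into `M(ℂ) = ℂ`, and it satisfies `(ε ⊗ id) Δ = id = (id ⊗ ε) Δ`. Here
`ε ⊗ id` and `id ⊗ ε` are extended to multipliers, `ℂ ⊗ H` and `H ⊗ ℂ` are identified with `H`, and
`id` denotes the canonical map from `H` to `M(H)`. -/
def IsCounit (Δ : EssHom H (BTensor H H)) (ε : BHom H ℂ) : Prop :=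
  ∃ e : EssHom H ℂ, e.toHom = (Multiplier.ι ℂ).comp ε ∧ ∀ f : H,
    Multiplier.Corresponds (BTensor.lid H) ((e.tensor (EssHom.id H)).extend (Δ.toHom f))
      (Multiplier.ι H f) ∧
    Multiplier.Corresponds (BTensor.rid H) (((EssHom.id H).tensor e).extend (Δ.toHom f))
      (Multiplier.ι H f)

/-- The functional `ε` is a counit, and the isomorphism `S` is an antihomomorphism of algebras and
of coalgebras which satisfies `μ (S ⊗ id) γr = ε ⊗ id` and `μ (id ⊗ S) ρl = id ⊗ ε`. -/
structure IsCounitAntipode {Δ : EssHom H (BTensor H H)} (G : GaloisMaps Δ) (ε : BHom H ℂ)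
    (S : BIso H H) : Prop where
  counit : IsCounit Δ ε
  map_mul : ∀ f g, S.toHom (f * g) = S.toHom g * S.toHom f
  coalgebra : IsCoalgebraAntihom Δ S
  antipode_left : ∀ x, mulMap H (BTensor.map S.toHom (BHom.id H) (G.γr x)) = sliceLeft ε x
  antipode_right : ∀ x, mulMap H (BTensor.map (BHom.id H) S.toHom (G.ρl x)) = sliceRight ε x

end QuantumGroups

end Born

end

/-! Write Δ(f) = f₁ ⊗ f₂ for the legs of the multiplier Δ(f). Such a formula has a meaning only when
enough legs are covered by elements of H, so the identities of Hopf algebra theory must be tested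
after multiplication by further elements. This is legitimate if H, H ⊗ H and H ⊗ (H ⊗ H) are
nondegenerate. For H that follows from faithfulness of φ. For the tensor products it needs the
approximation property: functionals on one factor then separate the points of a completed tensor
product (`BTensor.eq_zero_of_sliceLeft`), so nondegeneracy passes from the factors to the product
(`IsNondegenerate.tensor`, `IsNondegenerate.tensor₃`).

From ε and S to the Galois maps: f ⊗ g ↦ f₁ ⊗ S(f₂)g inverts γr, because f₁ ⊗ S(f₂)f₃g and f₁ ⊗
f₂S(f₃)g both collapse to f ⊗ g (`IsAntipode.γr_inverse`). Up to isomorphisms built from S and the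
flip this inverse is ρr, so ρr is invertible too. Conjugation by (S ⊗ S)τ exchanges γr with ρl and
γl with ρr.

From the Galois maps to ε: coassociativity makes ρl on the first two legs commute with γr on the
last two (`onLeft_ρl_onRight_γr`). For the inverses this yields p ⊗ μγr⁻¹(q ⊗ c) = μρl⁻¹(p ⊗ q) ⊗ c,
so both sides are a scalar ε(q) times p ⊗ c (`exists_slice_eq_mul`).

From the Galois maps to S: the antipode must satisfy S(v)c = (ε ⊗ id)γr⁻¹(v ⊗ c), and the difficulty
is that S(v) has to lie in H and not only act on it. Here left invariance enters through strong
invariance, S((id ⊗ φ)(Δ(a)(1 ⊗ b))) = (id ⊗ φ)((1 ⊗ a)Δ(b)) (`IsGaloisPair.strong_invariance`):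
since γr is onto and φ ≠ 0, every v is a slice as on the left, and the right-hand side is an element
of H. The same argument for the opposite multiplication produces S⁻¹ (`exists_antipode`). The
remaining properties of S are checked on the images of Galois maps.

Uniqueness: two counits agree on comparing the iterated slices of one element, and the formula for
S(v)c leaves no choice for S. -/

noncomputable section

open scoped Pointwise
open Bornology

namespace Born

/-! ## Compact disks and the approximation property -/

section CompactDisks

/-- A summable family of nonnegative real numbers remains summable after division by suitable
weights which tend to zero. -/
theorem exists_summable_div {ι : Type*} {c : ι → ℝ} (hc : ∀ i, 0 < c i) (hs : Summable c) :
    ∃ w : ι → ℝ, (∀ i, 0 < w i) ∧ Filter.Tendsto w Filter.cofinite (nhds 0) ∧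
      Summable fun i => c i / w i := by
  classical
  have h1 : ∀ n : ℕ, ∃ s : Finset ι, ∑' i, (if i ∈ s then 0 else ENNReal.ofReal (c i)) <
      ENNReal.ofReal ((1 / 2) ^ n) := by
    intro n
    -- The halving leaves room for the strict inequality, since the supremum over finite sums only
    -- gives `≤`.
    obtain ⟨s, hsn⟩ := summable_iff_vanishing_norm.1 hs ((1 / 2) ^ n / 2) (by positivity)
    refine ⟨s, lt_of_le_of_lt (b := ENNReal.ofReal ((1 / 2) ^ n / 2)) ?_ ?_⟩
    · rw [ENNReal.tsum_eq_iSup_sum]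
      refine iSup_le fun t => ?_
      have e : ∑ i ∈ t, (if i ∈ s then 0 else ENNReal.ofReal (c i)) =
          ENNReal.ofReal (∑ i ∈ t \ s, c i) := by
        rw [ENNReal.ofReal_sum_of_nonneg fun i _ => (hc i).le,
          ← Finset.sum_filter_not_add_sum_filter
          t (· ∈ s), Finset.sum_congr rfl (g := fun i => ENNReal.ofReal (c i)),
          Finset.sum_eq_zero (s := t.filter (· ∈ s)), add_zero, Finset.filter_notMem_eq_sdiff]
        · intro i hi
          simp [(Finset.mem_filter.1 hi).2]
        · intro i hi
          simp [(Finset.mem_filter.1 hi).2]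
      rw [e]
      exact ENNReal.ofReal_le_ofReal
        ((le_abs_self _).trans (hsn _ Finset.sdiff_disjoint).le)
    · exact (ENNReal.ofReal_lt_ofReal_iff (by positivity)).2 (half_lt_self (by positivity))
  choose s hs1 using h1
  -- One plus the number of the sets `s n` that miss `i`. Exchanging the order of summation turns `∑
  -- c i * v i` into the total mass plus the tails outside the `s n`, which are dominated by a
  -- geometric series; and `v i ≥ N` off the union of the first `N` sets. The weight will be `1 / v
  -- i`.
  let v : ι → ENNReal := fun i => 1 + ∑' n, if i ∈ s n then 0 else 1
  have hv : ∑' i, ENNReal.ofReal (c i) * v i ≠ ⊤ := by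
    have e : ∀ i, ENNReal.ofReal (c i) * v i = ENNReal.ofReal (c i) +
        ∑' n, (if i ∈ s n then 0 else ENNReal.ofReal (c i)) := by
      intro i
      rw [mul_add, mul_one, ← ENNReal.tsum_mul_left]
      congr 2
      ext n
      split_ifs <;> simp
    simp_rw [e]
    rw [ENNReal.tsum_add, ENNReal.tsum_comm]
    refine ENNReal.add_ne_top.2 ⟨?_, ?_⟩
    · rw [← ENNReal.ofReal_tsum_of_nonneg (fun i => (hc i).le) hs]
      exact ENNReal.ofReal_ne_top
    · refine ne_top_of_le_ne_top ?_ (ENNReal.tsum_le_tsum fun n => (hs1 n).le)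
      rw [← ENNReal.ofReal_tsum_of_nonneg (fun n => by positivity) summable_geometric_two]
      exact ENNReal.ofReal_ne_top
  have hv1 : ∀ i, v i ≠ ⊤ := by
    intro i hi
    have := ENNReal.ne_top_of_tsum_ne_top hv i
    rw [hi, ENNReal.mul_top (by simpa using hc i)] at this
    exact this rfl
  have hv0 : ∀ i, 0 < (v i).toReal := fun i =>
    ENNReal.toReal_pos (fun h => by simp [v] at h) (hv1 i)
  refine ⟨fun i => (v i).toReal⁻¹, fun i => inv_pos.2 (hv0 i), ?_, ?_⟩
  · refine tendsto_inv_atTop_zero.comp ?_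
    rw [Filter.tendsto_atTop]
    intro b
    obtain ⟨N, hN⟩ := exists_nat_ge b
    rw [Filter.eventually_cofinite]
    refine ((Finset.range N).biUnion s).finite_toSet.subset fun i hi => ?_
    by_contra hcon
    apply hi
    refine hN.trans ?_
    have h2 : (N : ENNReal) ≤ v i := by
      refine le_trans ?_ le_add_self
      refine le_trans ?_ (ENNReal.sum_le_tsum (Finset.range N))
      rw [Finset.sum_congr rfl (g := fun _ => 1)]
      · simp
      · intro n hn
        rw [if_neg]
        intro h
        exact hcon (Finset.mem_coe.2 (Finset.mem_biUnion.2 ⟨n, hn, h⟩))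
    have := ENNReal.toReal_mono (hv1 i) h2
    simpa using this
  · have := ENNReal.summable_toReal hv
    refine this.congr fun i => ?_
    rw [ENNReal.toReal_mul, ENNReal.toReal_ofReal (hc i).le, div_inv_eq_mul]

variable {X : Type*} [AddCommGroup X] [Module ℂ X] [BornSpace X] {ι : Type*}

/-- A quantitative bound for a sum already known to exist. After rescaling the coefficients to total
mass at most 1, `exists_hasBSum` puts the sum in `(1 + 1) D`, which is the origin of the factor 2.
Its users halve their `ε` beforehand. -/
theorem HasBSum.mem_smul {D : Set X} (hb : IsBounded D) (hD : IsCompletant D) (h0 : (0 : X) ∈ D)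
    {c : ι → ℂ} {x : ι → X} (hx : ∀ i, x i ∈ D) {ε : ℝ} (hε : 0 < ε)
    (hc : ∀ s : Finset ι, ∑ i ∈ s, ‖c i‖ ≤ ε) {y : X} (hy : HasBSum (fun i => c i • x i) y) :
    y ∈ ((2 * ε : ℝ) : ℂ) • D := by
  have hε' : (ε : ℂ) ≠ 0 := by exact_mod_cast hε.ne'
  have hn : ∀ i, ‖(ε : ℂ)⁻¹ * c i‖ = ε⁻¹ * ‖c i‖ := fun i => by
    rw [norm_mul, norm_inv, Complex.norm_real, Real.norm_of_nonneg hε.le]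
  have hle : ∀ s : Finset ι, ∑ i ∈ s, ‖(ε : ℂ)⁻¹ * c i‖ ≤ 1 := fun s => by
    simp_rw [hn]
    rw [← Finset.mul_sum, inv_mul_le_iff₀ hε, mul_one]
    exact hc s
  have hs : Summable fun i => ‖(ε : ℂ)⁻¹ * c i‖ :=
    summable_of_sum_le (fun _ => norm_nonneg _) hle
  obtain ⟨z, ⟨d, hd, rfl⟩, hz⟩ := exists_hasBSum hb hD h0 (fun i _ => hx i) hs
    (hs.tsum_le_of_sum_le hle)
  have h1 := hz.smul (ε : ℂ)
  simp only [smul_smul, mul_inv_cancel_left₀ hε'] at h1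
  refine ⟨d, hd, ?_⟩
  rw [hy.unique h1]
  simp only
  congr 1
  push_cast
  ring

/-- The image of the unit ball of `ℓ¹` under a weighted family which tends to zero. -/
def weightedDisk (w : ι → ℝ) (h : ι → X) : Set X :=
  {y | ∃ a : ι → ℂ, (∀ s : Finset ι, ∑ i ∈ s, ‖a i‖ ≤ 1) ∧
    HasBSum (fun i => (a i * w i) • h i) y}

theorem isDisk_weightedDisk (w : ι → ℝ) (h : ι → X) : IsDisk (weightedDisk w h) := by
  refine IsDisk.of_comb ?_
  rintro x ⟨a, ha, hx⟩ y ⟨b, hb, hy⟩ α β hαβ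
  refine ⟨fun i => α * a i + β * b i, fun s => ?_, ?_⟩
  · calc ∑ i ∈ s, ‖α * a i + β * b i‖ ≤ ∑ i ∈ s, (‖α‖ * ‖a i‖ + ‖β‖ * ‖b i‖) :=
          Finset.sum_le_sum fun i _ => (norm_add_le _ _).trans (by rw [norm_mul, norm_mul])
      _ = ‖α‖ * ∑ i ∈ s, ‖a i‖ + ‖β‖ * ∑ i ∈ s, ‖b i‖ := by
          rw [Finset.sum_add_distrib, Finset.mul_sum, Finset.mul_sum]
      _ ≤ ‖α‖ * 1 + ‖β‖ * 1 := by gcongr <;> [exact ha s; exact hb s]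
      _ ≤ 1 := by linarith
  · have := (hx.smul α).add (hy.smul β)
    simp only [smul_smul, ← add_smul] at this
    convert this using 3
    ring

theorem smul_mem_weightedDisk (w : ι → ℝ) (h : ι → X) (i : ι) :
    (w i : ℂ) • h i ∈ weightedDisk w h := by
  classical
  refine ⟨Pi.single i 1, fun s => ?_, {0}, isBounded_singleton, fun ε _ => ⟨{i}, fun s hs => ?_⟩⟩
  · calc ∑ j ∈ s, ‖(Pi.single i 1 : ι → ℂ) j‖ = ∑ j ∈ s, if j = i then 1 else 0 :=
          Finset.sum_congr rfl fun j _ => by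
            by_cases hj : j = i <;> simp [hj]
      _ ≤ 1 := by
          rw [Finset.sum_ite_eq']
          split_ifs <;> norm_num
  · refine ⟨0, rfl, ?_⟩
    rw [Finset.sum_eq_single i]
    · simp
    · intro j _ hj
      simp [hj]
    · intro hi
      exact absurd (hs (Finset.mem_singleton_self i)) hi

/-- The unit ball of `ℓ¹` is compact for pointwise convergence of the coefficients. Weights tending
to zero turn pointwise convergence of bounded coefficient sequences into norm convergence in `⟨D⟩`:
finitely many coordinates converge by hypothesis, and all others carry a small weight. -/
theorem isCompactSubset_weightedDisk [Countable ι] {D : Set X} (hb : IsBounded D)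
    (hD : IsCompletant D) (h0 : (0 : X) ∈ D) {w : ι → ℝ} {h : ι → X} (hw : ∀ i, 0 < w i)
    (hw0 : Filter.Tendsto w Filter.cofinite (nhds 0)) (hh : ∀ i, h i ∈ D) :
    IsCompactSubset (weightedDisk w h) := by
  classical
  have hfin : ∀ ε : ℝ, 0 < ε → ∃ s : Finset ι, ∀ i, i ∉ s → w i ≤ ε := by
    intro ε hε
    have := hw0.eventually (gt_mem_nhds hε)
    rw [Filter.eventually_cofinite] at this
    refine ⟨this.toFinset, fun i hi => ?_⟩
    by_contra hcon
    exact hi (by simpa using (not_le.1 hcon).le)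
  obtain ⟨W, hW1, hW⟩ : ∃ W : ℝ, 1 ≤ W ∧ ∀ i, w i ≤ W := by
    obtain ⟨s, hs⟩ := hfin 1 one_pos
    refine ⟨1 + ∑ i ∈ s, w i, ?_, fun i => ?_⟩
    · have := Finset.sum_nonneg (s := s) fun i _ => (hw i).le
      linarith
    · by_cases hi : i ∈ s
      · have := Finset.single_le_sum (f := w) (fun i _ => (hw i).le) hi
        linarith
      · have := Finset.sum_nonneg (s := s) fun i _ => (hw i).le
        have := hs i hi
        linarith
  have hnorm : ∀ (a : ι → ℂ) i, ‖a i * w i‖ = ‖a i‖ * w i := fun a i => by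
    rw [norm_mul, Complex.norm_real, Real.norm_of_nonneg (hw i).le]
  have hle : ∀ a : ι → ℂ, (∀ s : Finset ι, ∑ i ∈ s, ‖a i‖ ≤ 1) →
      ∀ s : Finset ι, ∑ i ∈ s, ‖a i * w i‖ ≤ W := by
    intro a ha s
    calc ∑ i ∈ s, ‖a i * w i‖ ≤ ∑ i ∈ s, ‖a i‖ * W := Finset.sum_le_sum fun i _ => by
          rw [hnorm]
          exact mul_le_mul_of_nonneg_left (hW i) (norm_nonneg _)
      _ = (∑ i ∈ s, ‖a i‖) * W := by rw [Finset.sum_mul]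
      _ ≤ 1 * W := mul_le_mul_of_nonneg_right (ha s) (by linarith)
      _ = W := one_mul W
  refine ⟨D, hb, hD, ?_, ?_⟩
  · rintro y ⟨a, ha, hy⟩
    obtain ⟨d, hd, rfl⟩ := hy.mem_smul hb hD h0 hh (by linarith) (hle a ha)
    exact Submodule.smul_mem _ _ (Submodule.subset_span hd)
  · intro x hx
    choose a ha hxa using hx
    -- A closed subset of a product of discs, compact by Tychonoff. Countability of `ι` makes the
    -- product first countable, hence gives convergent subsequences.
    have hcomp : IsCompact {a : ι → ℂ | ∀ s : Finset ι, ∑ i ∈ s, ‖a i‖ ≤ 1} := by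
      refine (isCompact_univ_pi fun _ : ι => isCompact_closedBall (0 : ℂ) 1).of_isClosed_subset
        ?_ ?_
      · simp only [Set.ofPred_forall]
        exact isClosed_iInter fun s => isClosed_le (by fun_prop) continuous_const
      · intro a ha i _
        simpa using ha {i}
    obtain ⟨b, hbA, k, hk, hlim⟩ := hcomp.isSeqCompact (x := a) ha
    have hs : Summable fun i => ‖b i * w i‖ :=
      summable_of_sum_le (fun _ => norm_nonneg _) (hle b hbA)
    obtain ⟨y, -, hy⟩ := exists_hasBSum hb hD h0 (fun i _ => hh i) hs
      (hs.tsum_le_of_sum_le (hle b hbA))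
    refine ⟨y, ⟨b, hbA, hy⟩, k, hk, fun ε hε => ?_⟩
    -- Off `s` the two coefficient families have total mass at most 2, contributing `ε / 4`; on `s`
    -- another `ε / 4` is allowed. `HasBSum.mem_smul` doubles the sum `ε / 2`.
    obtain ⟨s, hs⟩ := hfin (ε / 8) (by linarith)
    have hlim' : Filter.Tendsto (fun n => ∑ i ∈ s, ‖a (k n) i - b i‖ * w i) Filter.atTop
        (nhds 0) := by
      have : Filter.Tendsto (fun n => ∑ i ∈ s, ‖a (k n) i - b i‖ * w i) Filter.atTop
          (nhds (∑ i ∈ s, ‖b i - b i‖ * w i)) := by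
        refine tendsto_finsetSum _ fun i _ => ?_
        exact ((((tendsto_pi_nhds.1 hlim i)).sub_const _).norm).mul_const _
      simpa using this
    obtain ⟨N, hN⟩ := Filter.eventually_atTop.1 (hlim'.eventually (gt_mem_nhds
      (show (0 : ℝ) < ε / 4 by linarith)))
    refine ⟨N, fun n hn => ?_⟩
    have hdiff : HasBSum (fun i => ((a (k n) i - b i) * w i) • h i) (x (k n) - y) := by
      have := (hxa (k n)).add (hy.smul (-1))
      convert this using 1
      · ext i
        rw [sub_mul, sub_smul, neg_one_smul, sub_eq_add_neg]
      · rw [neg_one_smul, sub_eq_add_neg]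
    have := hdiff.mem_smul hb hD h0 hh (ε := ε / 2) (by linarith) fun t => ?_
    · rwa [mul_div_cancel₀ _ (two_ne_zero)] at this
    · have e1 : ∑ i ∈ t, ‖(a (k n) i - b i) * w i‖ ≤
          ∑ i ∈ s, ‖a (k n) i - b i‖ * w i + ∑ i ∈ t \ s, ‖a (k n) i - b i‖ * w i := by
        simp_rw [hnorm fun i => a (k n) i - b i]
        rw [← Finset.sum_union Finset.disjoint_sdiff]
        refine Finset.sum_le_sum_of_subset_of_nonneg (fun i hi => ?_) fun i _ _ =>
          mul_nonneg (norm_nonneg _) (hw i).le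
        by_cases h : i ∈ s <;> simp [h, hi]
      have e2 : ∑ i ∈ t \ s, ‖a (k n) i - b i‖ * w i ≤
          ∑ i ∈ t \ s, (‖a (k n) i‖ + ‖b i‖) * (ε / 8) := by
        refine Finset.sum_le_sum fun i hi => ?_
        exact mul_le_mul (norm_sub_le _ _) (hs i (Finset.mem_sdiff.1 hi).2) (hw i).le
          (by positivity)
      rw [← Finset.sum_mul, Finset.sum_add_distrib] at e2
      have e3 := ha (k n) (t \ s)
      have e4 := hbA (t \ s)
      have e5 := hN n hn
      nlinarith

end CompactDisks

/-! ### Functionals and separating families on completed tensor products. -/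

section Separation

variable {V : Type*} [AddCommGroup V] [Module ℂ V] [BornSpace V]
variable {V' : Type*} [AddCommGroup V'] [Module ℂ V'] [BornSpace V']
variable {W : Type*} [AddCommGroup W] [Module ℂ W] [BornSpace W]
variable {X : Type*} [AddCommGroup X] [Module ℂ X] [BornSpace X]

/-- Every element of the completed tensor product is the sum of an absolutely convergent series of
elementary tensors. -/
theorem BTensor.exists_hasBSum (x : BTensor V W) :
    ∃ (ι : Set (V × W)) (c : ι → ℂ) (S : Set V) (T : Set W), ι.Countable ∧ (∀ i, c i ≠ 0) ∧
      Summable (fun i => ‖c i‖) ∧ IsBounded S ∧ IsBounded T ∧ (∀ i : ι, i.1.1 ∈ S ∧ i.1.2 ∈ T) ∧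
      ∀ f : BHom (BTensor V W) (BTensor V W),
        HasBSum (fun i : ι => c i • f (tmul i.1.1 i.1.2)) (f x) := by
  classical
  obtain ⟨z, rfl⟩ := proj_surjective x
  obtain ⟨S, T, hS, hT, hz⟩ := z.2
  -- Restricting to the support gives a countable index set, as the compactness argument requires,
  -- and nonzero coefficients, as `exists_summable_div` requires.
  refine ⟨{i | z.1 i ≠ 0}, fun i => z.1 i, S, T, ?_, fun i => i.2, ?_, hS, hT,
    fun i => hz i i.2, ?_⟩
  · have := z.summable.countable_support
    refine this.mono fun i hi => ?_
    simpa using hi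
  · exact z.summable.subtype _
  · intro f
    have h1 : f (proj V W z) = FormalSum.eval (BHom.post f (tmulHom V W)) z := by
      have : f = lift (BHom.post f (tmulHom V W)) := hom_ext (by simp)
      conv_lhs => rw [this]
      rfl
    obtain ⟨D, hD, h⟩ := FormalSum.hasBSum_eval (BHom.post f (tmulHom V W)) z
    rw [h1]
    refine ⟨D, hD, fun ε hε => ?_⟩
    obtain ⟨s₀, hs₀⟩ := h ε hε
    refine ⟨s₀.subtype _, fun s hs => ?_⟩
    have := hs₀ (s.map (Function.Embedding.subtype _) ∪ s₀) Finset.subset_union_right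
    rw [← Finset.sum_subset Finset.subset_union_left, Finset.sum_map] at this
    · exact this
    · intro i hi hi'
      rcases Finset.mem_union.1 hi with h | h
      · exact absurd h hi'
      · by_contra hcon
        have hne : z.1 i ≠ 0 := fun h0 => hcon (by rw [h0, zero_smul])
        exact hi' (Finset.mem_map.2 ⟨⟨i, hne⟩, hs (Finset.mem_subtype.2 h), rfl⟩)

theorem BHom.sum_apply {κ : Type*} (s : Finset κ) (g : κ → BHom V W) (z : V) :
    (∑ i ∈ s, g i) z = ∑ i ∈ s, g i z :=
  map_sum (BHom.flip (BHom.id _) z) g s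

/-- If `f = ∑ l i (·) v i`, then `f ⊗ id` is `∑ v i ⊗ (l i ⊗ id)(·)`, which only sees the slices of
`x`. -/
theorem IsFiniteRank.map_id_eq_zero {f : BHom V V} (hf : IsFiniteRank f) {x : BTensor V W}
    (h : ∀ l : BHom V ℂ, sliceLeft l x = 0) : BTensor.map f (BHom.id W) x = 0 := by
  obtain ⟨n, v, l, hf⟩ := hf
  have : BTensor.map f (BHom.id W) =
      ∑ i, (BTensor.tmulHom V W (v i)).comp (sliceLeft (l i)) := by
    refine BTensor.hom_ext fun a b => ?_
    rw [BHom.sum_apply, BTensor.map_tmul, hf, ← BTensor.tmulHom_apply, map_sum, BHom.sum_apply]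
    simp
  rw [this, BHom.sum_apply]
  exact Finset.sum_eq_zero fun i _ => by simp [h, -BTensor.tmulHom_apply]

/-- If `V` has the approximation property, then the slice maps of functionals on `V` separate the
points of `V ⊗ W`. -/
theorem BTensor.eq_zero_of_sliceLeft (hV : HasApproximationProperty V) {x : BTensor V W}
    (h : ∀ l : BHom V ℂ, sliceLeft l x = 0) : x = 0 := by
  obtain ⟨ι, c, S, T, hι, hc, hcs, hS, hT, hST, hx⟩ := BTensor.exists_hasBSum x
  have := hι.to_subtype
  -- The first factors of the series for `x` need only be bounded. Moving a null factor `w i` from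
  -- the coefficients to the vectors places the scaled vectors in a compact disk, to which the
  -- approximation property applies, while the coefficients `c i / w i` stay summable.
  obtain ⟨w, hw, hw0, hws⟩ := exists_summable_div (fun i => norm_pos_iff.2 (hc i)) hcs
  obtain ⟨D, hD1, hD2, hD3, hD4⟩ := exists_disk hS
  obtain ⟨f, hf, B, hB, hBd, hconv⟩ := hV _ (isDisk_weightedDisk w fun i : ι => i.1.1)
    (isCompactSubset_weightedDisk hD2 hD3 hD4 hw hw0 fun i => hD1 (hST i).1)
  obtain ⟨E, hE1, hE2, hE3, hE4⟩ := exists_disk ((tmulHom V W).bounded₂ hB hT)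
  obtain ⟨C, hC0, hC⟩ : ∃ C : ℝ, 0 < C ∧ ∀ s : Finset ι, ∑ i ∈ s, ‖c i‖ / w i ≤ C := by
    refine ⟨∑' i, ‖c i‖ / w i + 1, ?_, fun s => ?_⟩
    · have : 0 ≤ ∑' i, ‖c i‖ / w i := tsum_nonneg fun i => div_nonneg (norm_nonneg _) (hw i).le
      linarith
    · have := hws.sum_le_tsum s fun i _ => div_nonneg (norm_nonneg _) (hw i).le
      linarith
  -- As `f N ⊗ id` kills `x`, the element `-x` is the value of `f N ⊗ id - id` at `x`, and this is
  -- small because `f N - id` is small on the compact disk.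
  rw [← neg_eq_zero]
  refine eq_of_forall_mem hE2 fun ε hε => ?_
  -- With `∑ ‖c i‖ / w i ≤ C` the total mass becomes `ε / 2`, which `HasBSum.mem_smul` doubles.
  obtain ⟨N, hN⟩ := hconv (ε / (2 * C)) (by positivity)
  have hN' := fun i => hN N le_rfl _ (smul_mem_weightedDisk w (fun i : ι => i.1.1) i)
  choose t ht ht' using hN'
  have hsum : HasBSum (fun i : ι => ((ε / (2 * C) : ℝ) * (c i / w i) : ℂ) •
      (tmul (t i) i.1.2 : BTensor V W)) (-x) := by
    have := hx (BTensor.map (f N) (BHom.id W) - BHom.id _)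
    rw [BHom.sub_apply, (hf N).map_id_eq_zero h, BHom.id_apply, zero_sub] at this
    convert this using 2 with i
    have hwi : (w i : ℂ) ≠ 0 := by exact_mod_cast (hw i).ne'
    have e1 : f N i.1.1 - i.1.1 = ((w i : ℂ)⁻¹ * (ε / (2 * C) : ℝ)) • t i := by
      have e2 : ((ε / (2 * C) : ℝ) : ℂ) • t i = f N ((w i : ℂ) • i.1.1) - (w i : ℂ) • i.1.1 := ht' i
      rw [mul_smul, e2, map_smul, ← smul_sub, smul_smul, inv_mul_cancel₀ hwi, one_smul]
    have e3 : (BTensor.map (f N) (BHom.id W) - BHom.id (BTensor V W)) (tmul i.1.1 i.1.2) =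
        tmul (f N i.1.1 - i.1.1) i.1.2 := by
      rw [← tmulHom_apply (f N i.1.1 - i.1.1), map_sub]
      simp
    rw [e3, e1, smul_tmul, smul_smul]
    congr 1
    field_simp
  have := hsum.mem_smul hE2 hE3 hE4 (fun i => hE1 ⟨t i, ht i, i.1.2, (hST i).2, rfl⟩)
    (ε := ε / 2) (by linarith) fun s => ?_
  · rwa [mul_div_cancel₀ _ two_ne_zero] at this
  · have e : ∀ i : ι, ‖((ε / (2 * C) : ℝ) * (c i / w i) : ℂ)‖ = ε / (2 * C) * (‖c i‖ / w i) := by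
      intro i
      rw [norm_mul, norm_div, Complex.norm_real, Complex.norm_real,
        Real.norm_of_nonneg (hw i).le, Real.norm_of_nonneg (by positivity)]
    simp_rw [e]
    rw [← Finset.mul_sum]
    calc ε / (2 * C) * ∑ i ∈ s, ‖c i‖ / w i ≤ ε / (2 * C) * C :=
          mul_le_mul_of_nonneg_left (hC s) (by positivity)
      _ = ε / 2 := by field_simp

theorem BTensor.swap_injective : Function.Injective (swap V W) :=
  Function.LeftInverse.injective (g := swap W V) swap_swap

theorem BTensor.eq_zero_of_sliceRight (hW : HasApproximationProperty W) {x : BTensor V W}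
    (h : ∀ l : BHom W ℂ, sliceRight l x = 0) : x = 0 := by
  have : swap V W x = 0 := eq_zero_of_sliceLeft hW fun l => by
    rw [← h l]
    exact DFunLike.congr_fun (hom_ext (f := (sliceLeft l).comp (swap V W)) (g := sliceRight l)
      (by simp)) x
  exact swap_injective (this.trans (map_zero _).symm)

/-- A family of maps which separates the points of `V` separates those of `V ⊗ W`. -/
theorem BTensor.eq_zero_of_map_left (hW : HasApproximationProperty W) {κ : Sort*}
    {f : κ → BHom V V'} (hf : ∀ v, (∀ k, f k v = 0) → v = 0) {x : BTensor V W}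
    (h : ∀ k, map (f k) (BHom.id W) x = 0) : x = 0 := by
  refine eq_zero_of_sliceRight hW fun l => hf _ fun k => ?_
  have : (f k).comp (sliceRight l) = (sliceRight l).comp (map (f k) (BHom.id W)) :=
    hom_ext (by simp)
  have := DFunLike.congr_fun this x
  simpa [h k] using this

theorem BTensor.eq_zero_of_map_right (hV : HasApproximationProperty V) {κ : Sort*}
    {f : κ → BHom W V'} (hf : ∀ v, (∀ k, f k v = 0) → v = 0) {x : BTensor V W}
    (h : ∀ k, map (BHom.id V) (f k) x = 0) : x = 0 := by
  refine eq_zero_of_sliceLeft hV fun l => hf _ fun k => ?_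
  have : (f k).comp (sliceLeft l) = (sliceLeft l).comp (map (BHom.id V) (f k)) :=
    hom_ext (by simp)
  have := DFunLike.congr_fun this x
  simpa [h k] using this

/-- A family of maps which separates the points of `V` separates those of `V ⊗ (W ⊗ X)`. -/
theorem BTensor.eq_zero_of_map_left₃ (hW : HasApproximationProperty W)
    (hX : HasApproximationProperty X) {κ : Sort*}
    {f : κ → BHom V V'} (hf : ∀ v, (∀ k, f k v = 0) → v = 0) {x : BTensor V (BTensor W X)}
    (h : ∀ k, map (f k) (BHom.id (BTensor W X)) x = 0) : x = 0 := by
  -- Rebracketing as `(V ⊗ W) ⊗ X` lets the factors `W` and `X` be removed one at a time, so that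
  -- the approximation property is never needed for `W ⊗ X`.
  have : (assoc V W X).inv x = 0 := by
    refine eq_zero_of_map_left hX (f := fun k => map (f k) (BHom.id W))
      (fun v hv => eq_zero_of_map_left hW hf hv) fun k => ?_
    have e : (assoc V' W X).toHom.comp (map (map (f k) (BHom.id W)) (BHom.id X)) =
        (map (f k) (BHom.id (BTensor W X))).comp (assoc V W X).toHom :=
      hom_ext_left (by simp)
    have := DFunLike.congr_fun e ((assoc V W X).inv x)
    simp only [BHom.comp_apply, BIso.toHom_inv, h k] at this
    rw [← (assoc V' W X).inv_toHom (map _ _ _), this, map_zero]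
  rw [← (assoc V W X).toHom_inv x, this, map_zero]

end Separation

/-! ## Nondegenerate algebras -/

section Nondegenerate

/-- An algebra is nondegenerate if its multiplication is nondegenerate in both variables. -/
structure IsNondegenerate (A : Type*) [NonUnitalRing A] : Prop where
  left : ∀ a : A, (∀ b, a * b = 0) → a = 0
  right : ∀ b : A, (∀ a, a * b = 0) → b = 0

theorem IsNondegenerate.ext_left {A : Type*} [NonUnitalRing A] (hA : IsNondegenerate A) {a a' : A}
    (h : ∀ b, a * b = a' * b) : a = a' :=
  sub_eq_zero.1 (hA.left _ fun b => by rw [sub_mul, h, sub_self])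

theorem IsNondegenerate.ext_right {A : Type*} [NonUnitalRing A] (hA : IsNondegenerate A) {b b' : A}
    (h : ∀ a, a * b = a * b') : b = b' :=
  sub_eq_zero.1 (hA.right _ fun a => by rw [mul_sub, h, sub_self])

theorem IsFaithful.isNondegenerate {H : Type*} [NonUnitalRing H] [Module ℂ H] [BornAlgebra H]
    {φ : BHom H ℂ} (hφ : IsFaithful φ) : IsNondegenerate H where
  left a h := hφ.1 a fun b => by rw [h, map_zero]
  right b h := hφ.2 b fun a => by rw [h, map_zero]

end Nondegenerate

/-! ## One-sided multiplications on tensor products -/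

section OneSided

variable {A : Type*} [NonUnitalRing A] [Module ℂ A] [BornAlgebra A]
variable {B : Type*} [NonUnitalRing B] [Module ℂ B] [BornAlgebra B]
variable {C : Type*} [NonUnitalRing C] [Module ℂ C] [BornAlgebra C]
variable {V : Type*} [AddCommGroup V] [Module ℂ V] [BornSpace V]

open BTensor

/-- `x ↦ (a ⊗ 1) x`. -/
def lmul₁ (a : A) : BHom (BTensor A V) (BTensor A V) := BTensor.map (mulHom A a) (BHom.id V)

/-- `x ↦ x (a ⊗ 1)`. -/
def rmul₁ (a : A) : BHom (BTensor A V) (BTensor A V) := BTensor.map (mulOpHom A a) (BHom.id V)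

/-- `x ↦ (1 ⊗ a) x`. -/
def lmul₂ (a : A) : BHom (BTensor V A) (BTensor V A) := BTensor.map (BHom.id V) (mulHom A a)

/-- `x ↦ x (1 ⊗ a)`. -/
def rmul₂ (a : A) : BHom (BTensor V A) (BTensor V A) := BTensor.map (BHom.id V) (mulOpHom A a)

@[simp] theorem lmul₁_tmul (a b : A) (v : V) : lmul₁ a (tmul b v) = tmul (a * b) v := by
  simp [lmul₁]

@[simp] theorem rmul₁_tmul (a b : A) (v : V) : rmul₁ a (tmul b v) = tmul (b * a) v := by
  simp [rmul₁]

@[simp] theorem lmul₂_tmul (a b : A) (v : V) : lmul₂ a (tmul v b) = tmul v (a * b) := by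
  simp [lmul₂]

@[simp] theorem rmul₂_tmul (a b : A) (v : V) : rmul₂ a (tmul v b) = tmul v (b * a) := by
  simp [rmul₂]

theorem rmul₁_mul (a : A) (x y : BTensor A B) : rmul₁ a (x * y) = x * rmul₁ a y :=
  (Multiplier.tmul (Multiplier.ι A a) (1 : Multiplier B)).R_mul x y

theorem mul_lmul₁ (a : A) (x y : BTensor A B) : x * lmul₁ a y = rmul₁ a x * y :=
  (Multiplier.tmul (Multiplier.ι A a) (1 : Multiplier B)).mul_L x y

theorem rmul₂_mul (b : B) (x y : BTensor A B) : rmul₂ b (x * y) = x * rmul₂ b y :=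
  (Multiplier.tmul (1 : Multiplier A) (Multiplier.ι B b)).R_mul x y

theorem mul_lmul₂ (b : B) (x y : BTensor A B) : x * lmul₂ b y = rmul₂ b x * y :=
  (Multiplier.tmul (1 : Multiplier A) (Multiplier.ι B b)).mul_L x y

theorem lmul₁_lmul₂ (a : A) (b : B) (x : BTensor A B) : lmul₁ a (lmul₂ b x) = tmul a b * x :=
  DFunLike.congr_fun (hom_ext (f := (lmul₁ a).comp (lmul₂ b)) (g := mulHom _ (tmul a b))
    (by simp)) x

theorem lmul₂_lmul₁ (a : A) (b : B) (x : BTensor A B) : lmul₂ b (lmul₁ a x) = tmul a b * x :=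
  DFunLike.congr_fun (hom_ext (f := (lmul₂ b).comp (lmul₁ a)) (g := mulHom _ (tmul a b))
    (by simp)) x

theorem rmul₁_rmul₂ (a : A) (b : B) (x : BTensor A B) : rmul₁ a (rmul₂ b x) = x * tmul a b :=
  DFunLike.congr_fun (hom_ext (f := (rmul₁ a).comp (rmul₂ b)) (g := mulOpHom _ (tmul a b))
    (by simp)) x

theorem rmul₂_rmul₁ (a : A) (b : B) (x : BTensor A B) : rmul₂ b (rmul₁ a x) = x * tmul a b :=
  DFunLike.congr_fun (hom_ext (f := (rmul₂ b).comp (rmul₁ a)) (g := mulOpHom _ (tmul a b))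
    (by simp)) x

theorem lmul₁_lmul₁ (a b : A) (x : BTensor A V) : lmul₁ a (lmul₁ b x) = lmul₁ (a * b) x :=
  DFunLike.congr_fun (hom_ext (f := (lmul₁ a).comp (lmul₁ b)) (g := lmul₁ (a * b))
    (by simp [mul_assoc])) x

theorem rmul₁_rmul₁ (a b : A) (x : BTensor A V) : rmul₁ a (rmul₁ b x) = rmul₁ (b * a) x :=
  DFunLike.congr_fun (hom_ext (f := (rmul₁ a).comp (rmul₁ b)) (g := rmul₁ (b * a))
    (by simp [mul_assoc])) x

theorem lmul₂_lmul₂ (a b : A) (x : BTensor V A) : lmul₂ a (lmul₂ b x) = lmul₂ (a * b) x :=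
  DFunLike.congr_fun (hom_ext (f := (lmul₂ a).comp (lmul₂ b)) (g := lmul₂ (a * b))
    (by simp [mul_assoc])) x

theorem rmul₂_rmul₂ (a b : A) (x : BTensor V A) : rmul₂ a (rmul₂ b x) = rmul₂ (b * a) x :=
  DFunLike.congr_fun (hom_ext (f := (rmul₂ a).comp (rmul₂ b)) (g := rmul₂ (b * a))
    (by simp [mul_assoc])) x

theorem assoc_mul_assoc (x y : BTensor (BTensor A B) C) :
    (assoc A B C).toHom x * (assoc A B C).toHom y = (assoc A B C).toHom (x * y) := by
  have : ∀ a b c, (mulHom _ ((assoc A B C).toHom (tmul (tmul a b) c))).comp (assoc A B C).toHom =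
      (assoc A B C).toHom.comp (mulHom _ (tmul (tmul a b) c)) := fun a b c =>
    hom_ext_left (by simp)
  exact DFunLike.congr_fun (hom_ext_left
    (f := (mulOpHom _ ((assoc A B C).toHom y)).comp (assoc A B C).toHom)
    (g := (assoc A B C).toHom.comp (mulOpHom _ y))
    fun a b c => DFunLike.congr_fun (this a b c) y) x

theorem lmul₁_assoc (a : A) (x : BTensor A B) (c : C) :
    lmul₁ a ((assoc A B C).toHom (tmul x c)) = (assoc A B C).toHom (tmul (lmul₁ a x) c) :=
  DFunLike.congr_fun (hom_ext
    (f := ((lmul₁ a).comp (assoc A B C).toHom).comp (BHom.flip (tmulHom _ _) c))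
    (g := ((assoc A B C).toHom.comp (BHom.flip (tmulHom _ _) c)).comp (lmul₁ a)) (by simp)) x

/-- A product `x (a ⊗ b)` is a multiplication in one leg followed by one in the other.
Multiplications in a nondegenerate factor form a separating family, and the approximation property
of the other factor keeps this family separating on the tensor product. -/
theorem IsNondegenerate.tensor (hA : HasApproximationProperty A) (hB : HasApproximationProperty B)
    (nA : IsNondegenerate A) (nB : IsNondegenerate B) : IsNondegenerate (BTensor A B) where
  left x h := eq_zero_of_map_left hB (f := fun a : A => mulOpHom A a) nA.left fun a =>
    eq_zero_of_map_right hA (f := fun b : B => mulOpHom B b) nB.left fun b =>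
      (rmul₂_rmul₁ a b x).trans (h _)
  right x h := eq_zero_of_map_left hB (f := fun a : A => mulHom A a) nA.right fun a =>
    eq_zero_of_map_right hA (f := fun b : B => mulHom B b) nB.right fun b =>
      (lmul₂_lmul₁ a b x).trans (h _)

/-- Not an instance of `IsNondegenerate.tensor`, which would ask for the approximation property of
`B ⊗ C`; the three-factor separation lemma avoids it. -/
theorem IsNondegenerate.tensor₃ (hA : HasApproximationProperty A) (hB : HasApproximationProperty B)
    (hC : HasApproximationProperty C) (nA : IsNondegenerate A) (nB : IsNondegenerate B)
    (nC : IsNondegenerate C) : IsNondegenerate (BTensor A (BTensor B C)) where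
  left x h := eq_zero_of_map_left₃ hB hC (f := fun a : A => mulOpHom A a) nA.left fun a =>
    eq_zero_of_map_right hA (f := fun b : BTensor B C => mulOpHom _ b) (nB.tensor hB hC nC).left
      fun b => (rmul₂_rmul₁ a b x).trans (h _)
  right x h := eq_zero_of_map_left₃ hB hC (f := fun a : A => mulHom A a) nA.right fun a =>
    eq_zero_of_map_right hA (f := fun b : BTensor B C => mulHom _ b) (nB.tensor hB hC nC).right
      fun b => (lmul₂_lmul₁ a b x).trans (h _)

theorem Multiplier.ι_injective (hA : IsNondegenerate A) : Function.Injective (Multiplier.ι A) :=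
  fun a b h => hA.ext_left fun x => by
    rw [← ι_L, h, ι_L]

end OneSided

/-! ## Relations between the Galois maps -/

section Galois

variable {H : Type*} [NonUnitalRing H] [Module ℂ H] [BornAlgebra H]
variable {Δ : EssHom H (BTensor H H)}

open BTensor

namespace GaloisMaps

variable (G : GaloisMaps Δ)

/-- The values of a `GaloisMaps` structure are specified only through their images in `M(H ⊗ H)`.
This formula and its seven companions are all that is known about them, and every later identity is
obtained by multiplying with a test element `x` and cancelling it by nondegeneracy. -/
theorem γl_mul (f g : H) (x : BTensor H H) :
    G.γl (tmul f g) * x = (Δ.toHom f).L (lmul₁ g x) := by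
  rw [← Multiplier.ι_L, G.γl_spec, gammaL, lift_tmul]
  rfl

theorem mul_γl (f g : H) (x : BTensor H H) :
    x * G.γl (tmul f g) = rmul₁ g ((Δ.toHom f).R x) := by
  rw [← Multiplier.ι_R, G.γl_spec, gammaL, lift_tmul]
  rfl

theorem γr_mul (f g : H) (x : BTensor H H) :
    G.γr (tmul f g) * x = (Δ.toHom f).L (lmul₂ g x) := by
  rw [← Multiplier.ι_L, G.γr_spec, gammaR, lift_tmul]
  rfl

theorem mul_γr (f g : H) (x : BTensor H H) :
    x * G.γr (tmul f g) = rmul₂ g ((Δ.toHom f).R x) := by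
  rw [← Multiplier.ι_R, G.γr_spec, gammaR, lift_tmul]
  rfl

theorem ρl_mul (f g : H) (x : BTensor H H) :
    G.ρl (tmul f g) * x = lmul₁ f ((Δ.toHom g).L x) := by
  rw [← Multiplier.ι_L, G.ρl_spec, rhoL, lift_tmul]
  rfl

theorem mul_ρl (f g : H) (x : BTensor H H) :
    x * G.ρl (tmul f g) = (Δ.toHom g).R (rmul₁ f x) := by
  rw [← Multiplier.ι_R, G.ρl_spec, rhoL, lift_tmul]
  rfl

theorem ρr_mul (f g : H) (x : BTensor H H) :
    G.ρr (tmul f g) * x = lmul₂ f ((Δ.toHom g).L x) := by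
  rw [← Multiplier.ι_L, G.ρr_spec, rhoR, lift_tmul]
  rfl

theorem mul_ρr (f g : H) (x : BTensor H H) :
    x * G.ρr (tmul f g) = (Δ.toHom g).R (rmul₂ f x) := by
  rw [← Multiplier.ι_R, G.ρr_spec, rhoR, lift_tmul]
  rfl

variable (hN : IsNondegenerate (BTensor H H))
include hN

/-- Covering the remaining leg of `Δ(f)(a ⊗ 1)` by `c` gives `Δ(f)(a ⊗ c)`, which is in `H ⊗ H` for
any multiplier. This and its three mirror images connect the different Galois maps with each other.
-/
theorem rmul₂_γl (f a c : H) : rmul₂ c (G.γl (tmul f a)) = (Δ.toHom f).L (tmul a c) :=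
  hN.ext_left fun x => by
    rw [← mul_lmul₂, γl_mul, lmul₁_lmul₂, Multiplier.L_mul]

theorem rmul₁_γr (f a c : H) : rmul₁ a (G.γr (tmul f c)) = (Δ.toHom f).L (tmul a c) :=
  hN.ext_left fun x => by
    rw [← mul_lmul₁, γr_mul, lmul₂_lmul₁, Multiplier.L_mul]

theorem lmul₂_ρl (f a c : H) : lmul₂ c (G.ρl (tmul a f)) = (Δ.toHom f).R (tmul a c) :=
  hN.ext_right fun x => by
    rw [mul_lmul₂, mul_ρl, rmul₁_rmul₂, Multiplier.R_mul]

theorem lmul₁_ρr (f a c : H) : lmul₁ a (G.ρr (tmul c f)) = (Δ.toHom f).R (tmul a c) :=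
  hN.ext_right fun x => by
    rw [mul_lmul₁, mul_ρr, rmul₂_rmul₁, Multiplier.R_mul]

theorem rmul₁_γl (f a b : H) : rmul₁ b (G.γl (tmul f a)) = G.γl (tmul f (a * b)) :=
  hN.ext_left fun x => by
    rw [← mul_lmul₁, γl_mul, γl_mul, lmul₁_lmul₁]

theorem rmul₂_γr (f a b : H) : rmul₂ b (G.γr (tmul f a)) = G.γr (tmul f (a * b)) :=
  hN.ext_left fun x => by
    rw [← mul_lmul₂, γr_mul, γr_mul, lmul₂_lmul₂]

theorem lmul₁_ρl (f a b : H) : lmul₁ b (G.ρl (tmul a f)) = G.ρl (tmul (b * a) f) :=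
  hN.ext_right fun x => by
    rw [mul_lmul₁, mul_ρl, mul_ρl, rmul₁_rmul₁]

theorem lmul₂_ρr (f a b : H) : lmul₂ b (G.ρr (tmul a f)) = G.ρr (tmul (b * a) f) :=
  hN.ext_right fun x => by
    rw [mul_lmul₂, mul_ρr, mul_ρr, rmul₂_rmul₂]

/-- Multiplicativity of `Δ`: a Galois map intertwines multiplication in the argument of `Δ` with the
action of `H` through `Δ`. -/
theorem γl_mul_left (f g h : H) : G.γl (tmul (f * g) h) = (Δ.toHom f).L (G.γl (tmul g h)) :=
  hN.ext_left fun x => by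
    rw [← Multiplier.L_mul, γl_mul, γl_mul, Δ.L_L]

theorem γr_mul_left (f g h : H) : G.γr (tmul (f * g) h) = (Δ.toHom f).L (G.γr (tmul g h)) :=
  hN.ext_left fun x => by
    rw [← Multiplier.L_mul, γr_mul, γr_mul, Δ.L_L]

theorem ρl_mul_right (f g h : H) : G.ρl (tmul h (f * g)) = (Δ.toHom g).R (G.ρl (tmul h f)) :=
  hN.ext_right fun x => by
    rw [← Multiplier.R_mul, mul_ρl, mul_ρl, Δ.R_R]

/-- Both sides are `(b ⊗ 1) Δ(f) (1 ⊗ c)`, covered on different sides in the two legs. -/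
theorem lmul₁_γr (f b c : H) : lmul₁ b (G.γr (tmul f c)) = rmul₂ c (G.ρl (tmul b f)) :=
  hN.ext_right fun x => by
    rw [mul_lmul₁, mul_γr, ← rmul₂_mul, mul_ρl]

theorem lmul₂_γl (f b c : H) : lmul₂ b (G.γl (tmul f c)) = rmul₁ c (G.ρr (tmul b f)) :=
  hN.ext_right fun x => by
    rw [mul_lmul₂, mul_γl, ← rmul₁_mul, mul_ρr]

/-- Two ways of writing `(b ⊗ d) Δ(f)`. -/
theorem lmul₂_ρl_eq (f b d : H) : lmul₂ d (G.ρl (tmul b f)) = lmul₁ b (G.ρr (tmul d f)) := by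
  rw [G.lmul₂_ρl hN, G.lmul₁_ρr hN]

/-- The Galois maps with values in `H ⊗ H` are unique. -/
theorem eq (G' : GaloisMaps Δ) :
    G.γl = G'.γl ∧ G.γr = G'.γr ∧ G.ρl = G'.ρl ∧ G.ρr = G'.ρr := by
  have := Multiplier.ι_injective hN
  refine ⟨?_, ?_, ?_, ?_⟩ <;> ext x <;> apply this
  · rw [G.γl_spec, G'.γl_spec]
  · rw [G.γr_spec, G'.γr_spec]
  · rw [G.ρl_spec, G'.ρl_spec]
  · rw [G.ρr_spec, G'.ρr_spec]

end GaloisMaps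

end Galois

/-! ## Coassociativity -/

section Coassociativity

variable {H : Type*} [NonUnitalRing H] [Module ℂ H] [BornAlgebra H] [EssentialAlgebra H]

open BTensor

/-- The multiplier `(id ⊗ Δ) Δ(f)`. -/
def comul₂ (Δ : EssHom H (BTensor H H)) (f : H) : Multiplier (BTensor H (BTensor H H)) :=
  ((EssHom.id H).tensor Δ).extend (Δ.toHom f)

variable {Δ : EssHom H (BTensor H H)} (hN : IsNondegenerate (BTensor H H)) (G : GaloisMaps Δ)
include hN

/-- Informally `(id ⊗ Δ)Δ(f) (p ⊗ y) = f₁p ⊗ Δ(f₂)y`, where `f₁p ⊗ f₂` is an honest element. An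
extended homomorphism is defined by its values on vectors `(id ⊗ Δ)(a ⊗ c)(b ⊗ y)`, so the formula
is proved for `p = ab` and for vectors `Δ(c)y`; essentiality of `H` and of `Δ` then gives it in
general. -/
theorem comul₂_L (f p : H) (y : BTensor H H) : (comul₂ Δ f).L (tmul p y) =
    BTensor.map (BHom.id H) (BHom.flip (leftAction Δ.toHom) y) (G.γl (tmul f p)) := by
  have key : ∀ (a b c : H) (y : BTensor H H), (comul₂ Δ f).L (tmul (a * b) ((Δ.toHom c).L y)) =
      BTensor.map (BHom.id H) (BHom.flip (leftAction Δ.toHom) ((Δ.toHom c).L y))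
        (G.γl (tmul f (a * b))) := by
    intro a b c y
    -- Here `(id ⊗ Δ)(a ⊗ c)(b ⊗ y) = ab ⊗ Δ(c)y`, while `Δ(f)(a ⊗ c)` is `γl(f ⊗ a)(1 ⊗ c)`.
    have h1 := ((EssHom.id H).tensor Δ).extendL_apply (Δ.toHom f) (tmul a c) (tmul b y)
    rw [← G.rmul₂_γl hN] at h1
    refine Eq.trans ?_ (h1.trans ?_)
    · change _ = (comul₂ Δ f).L ((EssHom.tensorHom (EssHom.id H).toHom Δ.toHom (tmul a c)).L _)
      rw [EssHom.tensorHom_tmul, Multiplier.tmul_L, BTensor.map_tmul]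
      rfl
    · rw [← G.rmul₁_γl hN]
      refine DFunLike.congr_fun (hom_ext
        (f := (BHom.flip (leftAction ((EssHom.id H).tensor Δ).toHom) (tmul b y)).comp (rmul₂ c))
        (g := (BTensor.map (BHom.id H) (BHom.flip (leftAction Δ.toHom) ((Δ.toHom c).L y))).comp
          (rmul₁ b)) fun r k => ?_) _
      simp only [BHom.comp_apply, rmul₂_tmul, rmul₁_tmul, BHom.flip_apply, leftAction_apply,
        BTensor.map_tmul, BHom.id_apply]
      change (EssHom.tensorHom (EssHom.id H).toHom Δ.toHom (tmul r (k * c))).L _ = _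
      rw [EssHom.tensorHom_tmul, Multiplier.tmul_L, BTensor.map_tmul, Δ.L_L]
      rfl
  have key2 : ∀ (c : H) (y : BTensor H H), (comul₂ Δ f).L (tmul p ((Δ.toHom c).L y)) =
      BTensor.map (BHom.id H) (BHom.flip (leftAction Δ.toHom) ((Δ.toHom c).L y))
        (G.γl (tmul f p)) := fun c y =>
    DFunLike.congr_fun (EssentialAlgebra.essential.hom_ext
      (f := (comul₂ Δ f).L.comp (BHom.flip (tmulHom _ _) ((Δ.toHom c).L y)))
      (g := (BTensor.map (BHom.id H) (BHom.flip (leftAction Δ.toHom) ((Δ.toHom c).L y))).comp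
        (G.γl.comp (tmulHom _ _ f))) fun a b => key a b c y) p
  exact DFunLike.congr_fun (Δ.essential_left.hom_ext
    (f := (comul₂ Δ f).L.comp (tmulHom _ _ p))
    (g := (BHom.flip (mapHom H H H (BTensor H H) (BHom.id H)) (G.γl (tmul f p))).comp
      (BHom.flip (leftAction Δ.toHom))) key2) y

theorem comul₂_R (f p : H) (y : BTensor H H) : (comul₂ Δ f).R (tmul p y) =
    BTensor.map (BHom.id H) (BHom.flip (rightAction Δ.toHom) y) (G.ρl (tmul p f)) := by
  have key : ∀ (a b c : H) (y : BTensor H H), (comul₂ Δ f).R (tmul (b * a) ((Δ.toHom c).R y)) =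
      BTensor.map (BHom.id H) (BHom.flip (rightAction Δ.toHom) ((Δ.toHom c).R y))
        (G.ρl (tmul (b * a) f)) := by
    intro a b c y
    have h1 := ((EssHom.id H).tensor Δ).extendR_apply (Δ.toHom f) (tmul a c) (tmul b y)
    rw [← G.lmul₂_ρl hN] at h1
    refine Eq.trans ?_ (h1.trans ?_)
    · change _ = (comul₂ Δ f).R ((EssHom.tensorHom (EssHom.id H).toHom Δ.toHom (tmul a c)).R _)
      rw [EssHom.tensorHom_tmul, Multiplier.tmul_R, BTensor.map_tmul]
      rfl
    · rw [← G.lmul₁_ρl hN]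
      refine DFunLike.congr_fun (hom_ext
        (f := (BHom.flip (rightAction ((EssHom.id H).tensor Δ).toHom) (tmul b y)).comp (lmul₂ c))
        (g := (BTensor.map (BHom.id H) (BHom.flip (rightAction Δ.toHom) ((Δ.toHom c).R y))).comp
          (lmul₁ b)) fun r k => ?_) _
      simp only [BHom.comp_apply, lmul₂_tmul, lmul₁_tmul, BHom.flip_apply, rightAction_apply,
        BTensor.map_tmul, BHom.id_apply]
      change (EssHom.tensorHom (EssHom.id H).toHom Δ.toHom (tmul r (c * k))).R _ = _
      rw [EssHom.tensorHom_tmul, Multiplier.tmul_R, BTensor.map_tmul, Δ.R_R]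
      rfl
  have key2 : ∀ (c : H) (y : BTensor H H), (comul₂ Δ f).R (tmul p ((Δ.toHom c).R y)) =
      BTensor.map (BHom.id H) (BHom.flip (rightAction Δ.toHom) ((Δ.toHom c).R y))
        (G.ρl (tmul p f)) := fun c y =>
    DFunLike.congr_fun (EssentialAlgebra.essential.hom_ext
      (f := (comul₂ Δ f).R.comp (BHom.flip (tmulHom _ _) ((Δ.toHom c).R y)))
      (g := (BTensor.map (BHom.id H) (BHom.flip (rightAction Δ.toHom) ((Δ.toHom c).R y))).comp
        (G.ρl.comp (BHom.flip (tmulHom _ _) f))) fun a b => key b a c y) p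
  exact DFunLike.congr_fun (Δ.essential_right.hom_ext
    (f := (comul₂ Δ f).R.comp (tmulHom _ _ p))
    (g := (BHom.flip (mapHom H H H (BTensor H H) (BHom.id H)) (G.ρl (tmul p f))).comp
      (BHom.flip (rightAction Δ.toHom))) key2) y

variable (hΔ : IsComultiplication Δ)
include hΔ

/-- The counterpart of `comul₂_L` for `(Δ ⊗ id)Δ(f)`, informally `Δ(f₁)y ⊗ f₂r`, carried over to
`(id ⊗ Δ)Δ(f)` by coassociativity. Having both formulas for the single multiplier `comul₂ Δ f` is
the form in which coassociativity is used from here on. -/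
theorem comul₂_L_assoc (f r : H) (y : BTensor H H) :
    (comul₂ Δ f).L ((assoc H H H).toHom (tmul y r)) = (assoc H H H).toHom
      (BTensor.map (BHom.flip (leftAction Δ.toHom) y) (BHom.id H) (G.γr (tmul f r))) := by
  rw [comul₂, ← (hΔ f _).1]
  congr 1
  set D := (Δ.tensor (EssHom.id H)).extend (Δ.toHom f) with hD
  have key : ∀ (a b c : H) (y : BTensor H H), D.L (tmul ((Δ.toHom c).L y) (a * b)) =
      BTensor.map (BHom.flip (leftAction Δ.toHom) ((Δ.toHom c).L y)) (BHom.id H)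
        (G.γr (tmul f (a * b))) := by
    intro a b c y
    have h1 := (Δ.tensor (EssHom.id H)).extendL_apply (Δ.toHom f) (tmul c a) (tmul y b)
    rw [← G.rmul₁_γr hN] at h1
    refine Eq.trans ?_ (h1.trans ?_)
    · change _ = D.L ((EssHom.tensorHom Δ.toHom (EssHom.id H).toHom (tmul c a)).L _)
      rw [EssHom.tensorHom_tmul, Multiplier.tmul_L, BTensor.map_tmul]
      rfl
    · rw [← G.rmul₂_γr hN]
      refine DFunLike.congr_fun (hom_ext
        (f := (BHom.flip (leftAction (Δ.tensor (EssHom.id H)).toHom) (tmul y b)).comp (rmul₁ c))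
        (g := (BTensor.map (BHom.flip (leftAction Δ.toHom) ((Δ.toHom c).L y)) (BHom.id H)).comp
          (rmul₂ b)) fun k r => ?_) _
      simp only [BHom.comp_apply, rmul₂_tmul, rmul₁_tmul, BHom.flip_apply, leftAction_apply,
        BTensor.map_tmul, BHom.id_apply]
      change (EssHom.tensorHom Δ.toHom (EssHom.id H).toHom (tmul (k * c) r)).L _ = _
      rw [EssHom.tensorHom_tmul, Multiplier.tmul_L, BTensor.map_tmul, Δ.L_L]
      rfl
  have key2 : ∀ (c : H) (y : BTensor H H), D.L (tmul ((Δ.toHom c).L y) r) =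
      BTensor.map (BHom.flip (leftAction Δ.toHom) ((Δ.toHom c).L y)) (BHom.id H)
        (G.γr (tmul f r)) := fun c y =>
    DFunLike.congr_fun (EssentialAlgebra.essential.hom_ext
      (f := D.L.comp (tmulHom _ _ ((Δ.toHom c).L y)))
      (g := (BTensor.map (BHom.flip (leftAction Δ.toHom) ((Δ.toHom c).L y)) (BHom.id H)).comp
        (G.γr.comp (tmulHom _ _ f))) fun a b => key a b c y) r
  exact DFunLike.congr_fun (Δ.essential_left.hom_ext
    (f := D.L.comp (BHom.flip (tmulHom _ _) r))
    (g := (BHom.flip (BHom.flip (mapHom H (BTensor H H) H H) (BHom.id H)) (G.γr (tmul f r))).comp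
      (BHom.flip (leftAction Δ.toHom))) key2) y

theorem comul₂_R_assoc (f r : H) (y : BTensor H H) :
    (comul₂ Δ f).R ((assoc H H H).toHom (tmul y r)) = (assoc H H H).toHom
      (BTensor.map (BHom.flip (rightAction Δ.toHom) y) (BHom.id H) (G.ρr (tmul r f))) := by
  rw [comul₂, ← (hΔ f _).2]
  congr 1
  set D := (Δ.tensor (EssHom.id H)).extend (Δ.toHom f) with hD
  have key : ∀ (a b c : H) (y : BTensor H H), D.R (tmul ((Δ.toHom c).R y) (b * a)) =
      BTensor.map (BHom.flip (rightAction Δ.toHom) ((Δ.toHom c).R y)) (BHom.id H)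
        (G.ρr (tmul (b * a) f)) := by
    intro a b c y
    have h1 := (Δ.tensor (EssHom.id H)).extendR_apply (Δ.toHom f) (tmul c a) (tmul y b)
    rw [← G.lmul₁_ρr hN] at h1
    refine Eq.trans ?_ (h1.trans ?_)
    · change _ = D.R ((EssHom.tensorHom Δ.toHom (EssHom.id H).toHom (tmul c a)).R _)
      rw [EssHom.tensorHom_tmul, Multiplier.tmul_R, BTensor.map_tmul]
      rfl
    · rw [← G.lmul₂_ρr hN]
      refine DFunLike.congr_fun (hom_ext
        (f := (BHom.flip (rightAction (Δ.tensor (EssHom.id H)).toHom) (tmul y b)).comp (lmul₁ c))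
        (g := (BTensor.map (BHom.flip (rightAction Δ.toHom) ((Δ.toHom c).R y)) (BHom.id H)).comp
          (lmul₂ b)) fun k r => ?_) _
      simp only [BHom.comp_apply, lmul₂_tmul, lmul₁_tmul, BHom.flip_apply, rightAction_apply,
        BTensor.map_tmul, BHom.id_apply]
      change (EssHom.tensorHom Δ.toHom (EssHom.id H).toHom (tmul (c * k) r)).R _ = _
      rw [EssHom.tensorHom_tmul, Multiplier.tmul_R, BTensor.map_tmul, Δ.R_R]
      rfl
  have key2 : ∀ (c : H) (y : BTensor H H), D.R (tmul ((Δ.toHom c).R y) r) =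
      BTensor.map (BHom.flip (rightAction Δ.toHom) ((Δ.toHom c).R y)) (BHom.id H)
        (G.ρr (tmul r f)) := fun c y =>
    DFunLike.congr_fun (EssentialAlgebra.essential.hom_ext
      (f := D.R.comp (tmulHom _ _ ((Δ.toHom c).R y)))
      (g := (BTensor.map (BHom.flip (rightAction Δ.toHom) ((Δ.toHom c).R y)) (BHom.id H)).comp
        (G.ρr.comp (BHom.flip (tmulHom _ _) f))) fun a b => key b a c y) r
  exact DFunLike.congr_fun (Δ.essential_right.hom_ext
    (f := D.R.comp (BHom.flip (tmulHom _ _) r))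
    (g := (BHom.flip (BHom.flip (mapHom H (BTensor H H) H H) (BHom.id H)) (G.ρr (tmul r f))).comp
      (BHom.flip (rightAction Δ.toHom))) key2) y

end Coassociativity

/-! ### Coassociativity as commutation relations between Galois maps. -/

section CoassociativityGalois

variable {H : Type*} [NonUnitalRing H] [Module ℂ H] [BornAlgebra H] [EssentialAlgebra H]
variable {Δ : EssHom H (BTensor H H)}

open BTensor

/-- The operator `g ⊗ id` on `V ⊗ (V ⊗ V)`, where `g` acts on the first two factors. -/
def onLeft {V : Type*} [AddCommGroup V] [Module ℂ V] [BornSpace V]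
    (g : BHom (BTensor V V) (BTensor V V)) :
    BHom (BTensor V (BTensor V V)) (BTensor V (BTensor V V)) :=
  (assoc V V V).toHom.comp ((BTensor.map g (BHom.id V)).comp (assoc V V V).inv)

/-- The operator `id ⊗ g` on `V ⊗ (V ⊗ V)`, where `g` acts on the last two factors. -/
def onRight {V : Type*} [AddCommGroup V] [Module ℂ V] [BornSpace V]
    (g : BHom (BTensor V V) (BTensor V V)) :
    BHom (BTensor V (BTensor V V)) (BTensor V (BTensor V V)) :=
  BTensor.map (BHom.id V) g

section

variable {V : Type*} [AddCommGroup V] [Module ℂ V] [BornSpace V]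

@[simp] theorem assoc_inv_tmul {W X : Type*} [AddCommGroup W] [Module ℂ W] [BornSpace W]
    [AddCommGroup X] [Module ℂ X] [BornSpace X] (a : V) (b : W) (c : X) :
    (assoc V W X).inv (tmul a (tmul b c)) = tmul (tmul a b) c := by
  rw [← assoc_tmul, BIso.inv_toHom]

@[simp] theorem onLeft_tmul (g : BHom (BTensor V V) (BTensor V V)) (a b c : V) :
    onLeft g (tmul a (tmul b c)) = (assoc V V V).toHom (tmul (g (tmul a b)) c) := by
  simp [onLeft]

theorem onLeft_assoc (g : BHom (BTensor V V) (BTensor V V)) (x : BTensor V V) (c : V) :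
    onLeft g ((assoc V V V).toHom (tmul x c)) = (assoc V V V).toHom (tmul (g x) c) := by
  simp [onLeft, BIso.inv_toHom]

@[simp] theorem onRight_tmul (g : BHom (BTensor V V) (BTensor V V)) (a : V) (x : BTensor V V) :
    onRight g (tmul a x) = tmul a (g x) := by
  simp [onRight]

theorem onLeft_onLeft (g g' : BHom (BTensor V V) (BTensor V V)) (x) :
    onLeft g (onLeft g' x) = onLeft (g.comp g') x :=
  DFunLike.congr_fun (hom_ext_right (f := (onLeft g).comp (onLeft g')) (g := onLeft (g.comp g'))
    (by simp [onLeft_assoc])) x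

theorem onRight_onRight (g g' : BHom (BTensor V V) (BTensor V V)) (x) :
    onRight g (onRight g' x) = onRight (g.comp g') x :=
  DFunLike.congr_fun (hom_ext_right (f := (onRight g).comp (onRight g'))
    (g := onRight (g.comp g')) (by simp)) x

theorem onLeft_id (x : BTensor V (BTensor V V)) : onLeft (BHom.id _) x = x :=
  DFunLike.congr_fun (hom_ext_right (f := onLeft (BHom.id _)) (g := BHom.id _) (by simp)) x

theorem onRight_id (x : BTensor V (BTensor V V)) : onRight (BHom.id _) x = x :=
  DFunLike.congr_fun (hom_ext_right (f := onRight (BHom.id _)) (g := BHom.id _) (by simp)) x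

/-- The permutation `(a ⊗ b) ⊗ c ↦ a ⊗ (c ⊗ b)`. -/
def swapRight (V : Type*) [AddCommGroup V] [Module ℂ V] [BornSpace V] :
    BHom (BTensor (BTensor V V) V) (BTensor V (BTensor V V)) :=
  (onRight (swap V V)).comp (assoc V V V).toHom

@[simp] theorem swapRight_tmul (a b c : V) :
    swapRight V (tmul (tmul a b) c) = tmul a (tmul c b) := by
  simp [swapRight]

end

variable (hN : IsNondegenerate (BTensor H H)) (hN₃ : IsNondegenerate (BTensor H (BTensor H H)))
variable (G : GaloisMaps Δ) (hΔ : IsComultiplication Δ)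
include hN hN₃ hΔ

/-- `(f ⊗ 1 ⊗ 1) Δ²(g) (1 ⊗ 1 ⊗ h)` in terms of Galois maps. -/
theorem onLeft_ρl_onRight_γr (z : BTensor H (BTensor H H)) :
    onLeft G.ρl (onRight G.γr z) = onRight G.γr (onLeft G.ρl z) := by
  refine DFunLike.congr_fun (hom_ext_right (f := (onLeft G.ρl).comp (onRight G.γr))
    (g := (onRight G.γr).comp (onLeft G.ρl)) fun b f c => ?_) z
  simp only [BHom.comp_apply, onRight_tmul, onLeft_tmul]
  set lm : BHom (BTensor H (BTensor H H)) (BTensor H (BTensor H H)) :=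
    BTensor.map (BHom.id H) (lmul₂ c) with hlm
  set rm : BHom (BTensor H (BTensor H H)) (BTensor H (BTensor H H)) :=
    BTensor.map (BHom.id H) (rmul₂ c) with hrm
  -- The left side of the identity is evaluated by right factors through `(Δ ⊗ id)Δ`; `hY` below
  -- evaluates the other side by left factors through `(id ⊗ Δ)Δ`.
  have hX : ∀ w, onLeft G.ρl (tmul b (G.γr (tmul f c))) * w =
      lmul₁ b ((comul₂ Δ f).L (lm w)) := by
    refine fun w => DFunLike.congr_fun (hom_ext_right
      (f := mulHom _ (onLeft G.ρl (tmul b (G.γr (tmul f c)))))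
      (g := (lmul₁ b).comp ((comul₂ Δ f).L.comp lm)) fun s t u => ?_) w
    simp only [BHom.comp_apply, mulHom_apply, hlm, BTensor.map_tmul, lmul₂_tmul, BHom.id_apply]
    rw [← assoc_tmul, ← assoc_tmul, comul₂_L_assoc hN G hΔ, ← G.rmul₂_γr hN]
    refine DFunLike.congr_fun (hom_ext
      (f := (mulOpHom _ ((assoc H H H).toHom (tmul (tmul s t) u))).comp
        ((onLeft G.ρl).comp (tmulHom _ _ b)))
      (g := ((lmul₁ b).comp (assoc H H H).toHom).comp ((BTensor.map
        (BHom.flip (leftAction Δ.toHom) (tmul s t)) (BHom.id H)).comp (rmul₂ u)))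
      fun k l => ?_) _
    simp only [BHom.comp_apply, mulOpHom_apply, tmulHom_apply, onLeft_tmul, assoc_mul_assoc,
      tmul_mul_tmul, rmul₂_tmul, BTensor.map_tmul, lmul₁_assoc, BHom.flip_apply,
      leftAction_apply, BHom.id_apply, G.ρl_mul]
  have hY : ∀ w, w * onRight G.γr ((assoc H H H).toHom (tmul (G.ρl (tmul b f)) c)) =
      rm ((comul₂ Δ f).R (rmul₁ b w)) := by
    refine fun w => DFunLike.congr_fun (hom_ext_right
      (f := mulOpHom _ (onRight G.γr ((assoc H H H).toHom (tmul (G.ρl (tmul b f)) c))))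
      (g := rm.comp ((comul₂ Δ f).R.comp (rmul₁ b))) fun p q r => ?_) w
    simp only [BHom.comp_apply, mulOpHom_apply, rmul₁_tmul]
    rw [comul₂_R hN G, ← G.lmul₁_ρl hN]
    refine DFunLike.congr_fun (hom_ext
      (f := (mulHom _ (tmul p (tmul q r))).comp
        ((onRight G.γr).comp ((assoc H H H).toHom.comp (BHom.flip (tmulHom _ _) c))))
      (g := rm.comp ((BTensor.map (BHom.id H)
        (BHom.flip (rightAction Δ.toHom) (tmul q r))).comp (lmul₁ p)))
      fun k l => ?_) _
    simp only [BHom.comp_apply, mulHom_apply, BHom.flip_apply, tmulHom_apply, assoc_tmul,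
      onRight_tmul, tmul_mul_tmul, lmul₁_tmul, BTensor.map_tmul, BHom.id_apply,
      rightAction_apply, hrm, G.mul_γr]
  have hlr : ∀ x y, x * lm y = rm x * y := fun x y =>
    (Multiplier.tmul (1 : Multiplier H) (leg₂ H c)).mul_L x y
  have hr : ∀ x y, rm (x * y) = x * rm y := fun x y =>
    (Multiplier.tmul (1 : Multiplier H) (leg₂ H c)).R_mul x y
  -- Sandwiching between `w` and `w'` makes the two descriptions comparable: both become `w (b ⊗ 1 ⊗
  -- 1) Δ²(f) (1 ⊗ 1 ⊗ c) w'`, by compatibility of left and right multipliers.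
  refine hN₃.ext_left fun w' => hN₃.ext_right fun w => ?_
  rw [hX, ← mul_assoc, hY, mul_lmul₁, Multiplier.mul_L, hlr]

/-- `(f ⊗ g ⊗ 1) Δ²(h) (1 ⊗ 1 ⊗ 1)` in terms of Galois maps. -/
theorem onLeft_ρl_ρr (b d a : H) : onLeft G.ρl (tmul b (G.ρr (tmul d a))) =
    onRight G.ρr (swapRight H (tmul (G.ρl (tmul b a)) d)) := by
  refine hN₃.ext_right fun w => ?_
  refine DFunLike.congr_fun (hom_ext_right
    (f := mulOpHom _ (onLeft G.ρl (tmul b (G.ρr (tmul d a)))))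
    (g := mulOpHom _ (onRight G.ρr (swapRight H (tmul (G.ρl (tmul b a)) d)))) fun p q r => ?_) w
  simp only [mulOpHom_apply]
  -- Both sides are `(b ⊗ 1 ⊗ d) Δ²(a)`. A factor `p ⊗ q ⊗ r` on the left covers all three legs at
  -- once, and the middle term is the common value.
  trans (comul₂ Δ a).R (tmul (p * b) (tmul q (r * d)))
  · rw [← assoc_tmul, ← assoc_tmul, comul₂_R_assoc hN G hΔ, ← G.lmul₂_ρr hN]
    refine DFunLike.congr_fun (hom_ext
      (f := (mulHom _ ((assoc H H H).toHom (tmul (tmul p q) r))).comp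
        ((onLeft G.ρl).comp (tmulHom _ _ b)))
      (g := (assoc H H H).toHom.comp ((BTensor.map
        (BHom.flip (rightAction Δ.toHom) (tmul (p * b) q)) (BHom.id H)).comp (lmul₂ r)))
      fun k l => ?_) _
    simp only [BHom.comp_apply, mulHom_apply, tmulHom_apply, onLeft_tmul, assoc_mul_assoc,
      tmul_mul_tmul, lmul₂_tmul, BTensor.map_tmul, BHom.flip_apply, rightAction_apply,
      BHom.id_apply, G.mul_ρl, rmul₁_tmul]
  · rw [comul₂_R hN G, ← G.lmul₁_ρl hN]
    refine DFunLike.congr_fun (hom_ext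
      (f := (BTensor.map (BHom.id H)
        (BHom.flip (rightAction Δ.toHom) (tmul q (r * d)))).comp (lmul₁ p))
      (g := (mulHom _ (tmul p (tmul q r))).comp
        ((onRight G.ρr).comp ((swapRight H).comp (BHom.flip (tmulHom _ _) d))))
      fun k l => ?_) _
    simp only [BHom.comp_apply, mulHom_apply, BHom.flip_apply, tmulHom_apply, swapRight_tmul,
      onRight_tmul, tmul_mul_tmul, lmul₁_tmul, BTensor.map_tmul, BHom.id_apply,
      rightAction_apply, G.mul_ρr, rmul₂_tmul]

end CoassociativityGalois

/-! ## Strong invariance -/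

section StrongInvariance

open BTensor

variable {V : Type*} [AddCommGroup V] [Module ℂ V] [BornSpace V]

/-- The operator `a ⊗ (p ⊗ q) ↦ g₁₂ g₁₃ (a ⊗ (p ⊗ q))`, where the indices indicate the factors
on which `g` acts. -/
def doubleGalois (g : BHom (BTensor V V) (BTensor V V)) :
    BHom (BTensor V (BTensor V V)) (BTensor V (BTensor V V)) :=
  (onLeft g).comp ((swapRight V).comp ((BTensor.map g (BHom.id V)).comp
    ((assoc V V V).inv.comp (onRight (swap V V)))))

theorem doubleGalois_tmul (g : BHom (BTensor V V) (BTensor V V)) (a p q : V) :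
    doubleGalois g (tmul a (tmul p q)) = onLeft g (swapRight V (tmul (g (tmul a q)) p)) := by
  simp [doubleGalois]

/-- A bounded bilinear map `r`, to be thought of as the multiplication `r a v = v a` of an algebra
or of its opposite, with an action `d` on `V ⊗ V`, to be thought of as the action given by a
comultiplication, and with Galois maps `γl (f ⊗ a) = d f (a ⊗ 1)` and `γr (f ⊗ c) = d f (1 ⊗ c)`
which satisfy coassociativity. -/
structure IsGaloisPair (r : BHom V (BHom V V)) (d : BHom V (BHom (BTensor V V) (BTensor V V)))
    (γl γr : BHom (BTensor V V) (BTensor V V)) : Prop where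
  nondegenerate : ∀ v, (∀ a, r a v = 0) → v = 0
  left : ∀ f a c, BTensor.map (BHom.id V) (r c) (γl (tmul f a)) = d f (tmul a c)
  right : ∀ f a c, BTensor.map (r a) (BHom.id V) (γr (tmul f c)) = d f (tmul a c)
  left_mul : ∀ f g a, γl (tmul (r g f) a) = d f (γl (tmul g a))
  coassoc : ∀ f p q s, (assoc V V V).toHom
    (BTensor.map (BHom.flip d (tmul p q)) (BHom.id V) (γr (tmul f s))) =
      BTensor.map (BHom.id V) (BHom.flip d (tmul q s)) (γl (tmul f p))

variable {r : BHom V (BHom V V)} {d : BHom V (BHom (BTensor V V) (BTensor V V))}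
  {γl γr : BHom (BTensor V V) (BTensor V V)}

namespace IsGaloisPair

/-- For the multiplication of `V` itself, `doubleGalois γr (a ⊗ y)` is `Δ²(a)(1 ⊗ y)`. Covering the
first leg by `s` permits the other reading of `Δ²`, namely `a₁s ⊗ Δ(a₂)y`. -/
theorem map_doubleGalois (h : IsGaloisPair r d γl γr) (a s : V) (y : BTensor V V) :
    BTensor.map (r s) (BHom.id _) (doubleGalois γr (tmul a y)) =
      BTensor.map (BHom.id V) (BHom.flip d y) (γl (tmul a s)) := by
  refine DFunLike.congr_fun (hom_ext
    (f := (BTensor.map (r s) (BHom.id _)).comp ((doubleGalois γr).comp (tmulHom _ _ a)))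
    (g := (BHom.flip (mapHom V V V (BTensor V V) (BHom.id V)) (γl (tmul a s))).comp
      (BHom.flip d)) fun p q => ?_) y
  simp only [BHom.comp_apply, tmulHom_apply, doubleGalois_tmul, BHom.flip_apply, mapHom_apply]
  rw [← h.coassoc]
  refine DFunLike.congr_fun (hom_ext
    (f := (BTensor.map (r s) (BHom.id _)).comp ((onLeft γr).comp ((swapRight V).comp
      (BHom.flip (tmulHom _ _) p))))
    (g := (assoc V V V).toHom.comp (BTensor.map (BHom.flip d (tmul s p)) (BHom.id V)))
      fun k l => ?_) _
  simp only [BHom.comp_apply, BHom.flip_apply, tmulHom_apply, swapRight_tmul, onLeft_tmul,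
    BTensor.map_tmul, BHom.id_apply, ← h.right]
  exact DFunLike.congr_fun (hom_ext
    (f := (BTensor.map (r s) (BHom.id _)).comp ((assoc V V V).toHom.comp
      (BHom.flip (tmulHom _ _) l)))
    (g := (assoc V V V).toHom.comp ((BHom.flip (tmulHom _ _) l).comp
      (BTensor.map (r s) (BHom.id _)))) (by simp)) _

/-- The hypothesis on `T` is module linearity, `T(lb) = Δ(l)T(b)`, so `a₁ ⊗ T(a₂b) = a₁ ⊗ Δ(a₂)T(b)
= Δ²(a)(1 ⊗ T(b))`. The calculation is made after covering the first leg by an arbitrary `s`. It is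
applied to `T = γl(· ⊗ c)` for strong invariance, and to `T = Δ(·)z` for the coalgebra property of
the antipode. -/
theorem map_γr (h : IsGaloisPair r d γl γr) (hV : HasApproximationProperty V)
    {T : BHom V (BTensor V V)} (hT : ∀ l b, T (r b l) = d l (T b)) (a b : V) :
    BTensor.map (BHom.id V) T (γr (tmul a b)) = doubleGalois γr (tmul a (T b)) := by
  rw [← sub_eq_zero]
  refine eq_zero_of_map_left₃ hV hV (f := fun s => r s) h.nondegenerate fun s => ?_
  rw [map_sub, h.map_doubleGalois, sub_eq_zero]
  have e1 : (BTensor.map (r s) (BHom.id _)).comp (BTensor.map (BHom.id V) T) =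
      (BTensor.map (BHom.id V) T).comp (BTensor.map (r s) (BHom.id _)) := hom_ext (by simp)
  have e2 : (BTensor.map (BHom.id V) T).comp (BTensor.map (BHom.id V) (r b)) =
      BTensor.map (BHom.id V) (BHom.flip d (T b)) := hom_ext (by simp [hT])
  have h1 := DFunLike.congr_fun e1 (γr (tmul a b))
  have h2 := DFunLike.congr_fun e2 (γl (tmul a s))
  simp only [BHom.comp_apply] at h1 h2
  rw [h1, h.right, ← h.left, h2]

/-- Strong invariance: `S ((id ⊗ φ) (Δ(a) (1 ⊗ b))) = (id ⊗ φ) ((1 ⊗ a) Δ(b))`, where `S` is the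
antipode expressed by the inverse of a Galois map. -/
theorem strong_invariance (h : IsGaloisPair r d γl γr) (hV : HasApproximationProperty V)
    {ε φ : BHom V ℂ} (hε : ∀ a b, sliceLeft ε (γr (tmul a b)) = r b a)
    (hφ : ∀ f g, sliceRight φ (γl (tmul f g)) = φ f • g) {σ : BHom (BTensor V V) V}
    (hσ : ∀ x, σ (γr x) = sliceLeft ε x) (a b c : V) :
    σ (tmul (sliceRight φ (γr (tmul a b))) c) =
      sliceRight φ (BTensor.map (BHom.id V) (BHom.flip r a) (γl (tmul b c))) := by
  -- With `σ(f ⊗ g) = S(f)g`, the computation to be justified is `S(a₁)c φ(a₂b) = S(a₁)a₂b₁c φ(a₃b₂)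
  -- = b₁c φ(ab₂)`. This gives `a₁ ⊗ Δ(a₂b)(c ⊗ 1) = Δ²(a)(1 ⊗ Δ(b)(c ⊗ 1))`.
  have h1 := h.map_γr hV (T := γl.comp (BHom.flip (tmulHom V V) c))
    (fun l b => h.left_mul l b c) a b
  -- Left invariance, read backwards: `φ(a₂b) c` is expanded to `(id ⊗ φ)(Δ(a₂b)(c ⊗ 1))`.
  have h2 : tmul (sliceRight φ (γr (tmul a b))) c = BTensor.map (BHom.id V) (sliceRight φ)
      (BTensor.map (BHom.id V) (γl.comp (BHom.flip (tmulHom V V) c)) (γr (tmul a b))) :=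
    DFunLike.congr_fun (hom_ext
      (f := (BHom.flip (tmulHom V V) c).comp (sliceRight φ))
      (g := (BTensor.map (BHom.id V) (sliceRight φ)).comp
        (BTensor.map (BHom.id V) (γl.comp (BHom.flip (tmulHom V V) c)))) (by simp [hφ])) _
  rw [h2, h1]
  refine DFunLike.congr_fun (hom_ext
    (f := (σ.comp (BTensor.map (BHom.id V) (sliceRight φ))).comp
      ((doubleGalois γr).comp (tmulHom _ _ a)))
    (g := (sliceRight φ).comp (BTensor.map (BHom.id V) (BHom.flip r a))) fun p q => ?_)
    (γl (tmul b c))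
  simp only [BHom.comp_apply, tmulHom_apply, doubleGalois_tmul, BTensor.map_tmul, BHom.id_apply,
    BHom.flip_apply, sliceRight_tmul]
  -- The product of `a` and `q` is written as `(ε ⊗ id)γr(a ⊗ q)`, so that both sides become bounded
  -- linear maps evaluated at `γr(a ⊗ q)`.
  rw [← hε]
  refine DFunLike.congr_fun (hom_ext
    (f := (σ.comp (BTensor.map (BHom.id V) (sliceRight φ))).comp
      ((onLeft γr).comp ((swapRight V).comp (BHom.flip (tmulHom _ _) p))))
    (g := (BHom.flip (smulHom V) p).comp (φ.comp (sliceLeft ε))) fun k l => ?_) (γr (tmul a q))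
  simp only [BHom.comp_apply, BHom.flip_apply, tmulHom_apply, swapRight_tmul, onLeft_tmul,
    sliceLeft_tmul, smulHom_apply, map_smul]
  have e : (BTensor.map (BHom.id V) (sliceRight φ)).comp ((assoc V V V).toHom.comp
      (BHom.flip (tmulHom _ _) l)) = φ l • BHom.id (BTensor V V) := hom_ext (by simp)
  have e' := DFunLike.congr_fun e (γr (tmul k p))
  simp only [BHom.comp_apply, BHom.flip_apply, tmulHom_apply, BHom.smul_apply,
    BHom.id_apply] at e'
  rw [e', map_smul, hσ, sliceLeft_tmul, smul_comm]

end IsGaloisPair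

end StrongInvariance

/-! ### The multiplication of `H` and the opposite one as Galois pairs. -/

section GaloisPairs

open BTensor

variable {H : Type*} [NonUnitalRing H] [Module ℂ H] [BornAlgebra H] [EssentialAlgebra H]
variable {Δ : EssHom H (BTensor H H)}

theorem GaloisMaps.isGaloisPair (G : GaloisMaps Δ) (hΔ : IsComultiplication Δ)
    (nH : IsNondegenerate H) (hN : IsNondegenerate (BTensor H H)) :
    IsGaloisPair (mulOpHom H) (leftAction Δ.toHom) G.γl G.γr where
  nondegenerate := nH.left
  left := G.rmul₂_γl hN
  right := G.rmul₁_γr hN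
  left_mul := G.γl_mul_left hN
  coassoc f p q s := by
    rw [← comul₂_L hN G, ← comul₂_L_assoc hN G hΔ, assoc_tmul]

/-- The opposite algebra with the same comultiplication: the maps with `Δ` on the right take over
the role of `γl`, `γr`. Strong invariance for this pair yields the inverse of the antipode. -/
theorem GaloisMaps.isGaloisPair_op (G : GaloisMaps Δ) (hΔ : IsComultiplication Δ)
    (nH : IsNondegenerate H) (hN : IsNondegenerate (BTensor H H)) :
    IsGaloisPair (mulHom H) (rightAction Δ.toHom) (G.ρl.comp (swap H H))
      (G.ρr.comp (swap H H)) where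
  nondegenerate := nH.right
  left f a c := by
    rw [BHom.comp_apply, swap_tmul]
    exact G.lmul₂_ρl hN f a c
  right f a c := by
    rw [BHom.comp_apply, swap_tmul]
    exact G.lmul₁_ρr hN f a c
  left_mul f g a := by
    simp only [BHom.comp_apply, swap_tmul]
    exact G.ρl_mul_right hN g f a
  coassoc f p q s := by
    simp only [BHom.comp_apply, swap_tmul]
    rw [← comul₂_R hN G, ← comul₂_R_assoc hN G hΔ, assoc_tmul]

end GaloisPairs

/-! ## Isomorphisms -/

section Iso

variable {V : Type*} [AddCommGroup V] [Module ℂ V] [BornSpace V]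
variable {W : Type*} [AddCommGroup W] [Module ℂ W] [BornSpace W]
variable {X : Type*} [AddCommGroup X] [Module ℂ X] [BornSpace X]

theorem IsIso.of_inverse {f : BHom V W} (g : BHom W V) (h1 : ∀ x, g (f x) = x)
    (h2 : ∀ y, f (g y) = y) : IsIso f := ⟨⟨f, g, h1, h2⟩, rfl⟩

theorem IsIso.exists_inverse {f : BHom V W} (hf : IsIso f) :
    ∃ g : BHom W V, (∀ x, g (f x) = x) ∧ ∀ y, f (g y) = y := by
  obtain ⟨e, rfl⟩ := hf
  exact ⟨e.inv, e.inv_toHom, e.toHom_inv⟩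

theorem IsIso.comp {g : BHom W X} {f : BHom V W} (hg : IsIso g) (hf : IsIso f) :
    IsIso (g.comp f) := by
  obtain ⟨g', hg1, hg2⟩ := hg.exists_inverse
  obtain ⟨f', hf1, hf2⟩ := hf.exists_inverse
  exact IsIso.of_inverse (f'.comp g') (by simp [hg1, hf1]) (by simp [hg2, hf2])

/-- If `f ∘ g = h` with isomorphisms `f` and `h`, then `g` is an isomorphism. -/
theorem IsIso.of_comp_left {f : BHom W X} {g : BHom V W} (hf : IsIso f) (h : IsIso (f.comp g)) :
    IsIso g := by
  obtain ⟨f', hf1, hf2⟩ := hf.exists_inverse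
  have e : g = f'.comp (f.comp g) := BHom.ext fun x => by simp [hf1]
  rw [e]
  exact (IsIso.of_inverse f hf2 hf1).comp h

/-- If `f ∘ g = h` with isomorphisms `g` and `h`, then `f` is an isomorphism. -/
theorem IsIso.of_comp_right {f : BHom W X} {g : BHom V W} (hg : IsIso g) (h : IsIso (f.comp g)) :
    IsIso f := by
  obtain ⟨g', hg1, hg2⟩ := hg.exists_inverse
  have e : f = (f.comp g).comp g' := BHom.ext fun x => by simp [hg2]
  rw [e]
  exact h.comp (IsIso.of_inverse g hg2 hg1)

theorem BIso.isIso (e : BIso V W) : IsIso e.toHom := ⟨e, rfl⟩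

theorem BIso.isIso_inv (e : BIso V W) : IsIso e.inv :=
  IsIso.of_inverse e.toHom e.toHom_inv e.inv_toHom

open BTensor in
theorem IsIso.map {V' W' : Type*} [AddCommGroup V'] [Module ℂ V'] [BornSpace V']
    [AddCommGroup W'] [Module ℂ W'] [BornSpace W'] {f : BHom V V'} {g : BHom W W'} (hf : IsIso f)
    (hg : IsIso g) : IsIso (BTensor.map f g) := by
  obtain ⟨f', hf1, hf2⟩ := hf.exists_inverse
  obtain ⟨g', hg1, hg2⟩ := hg.exists_inverse
  exact IsIso.of_inverse (BTensor.map f' g')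
    (fun x => DFunLike.congr_fun (hom_ext (f := (BTensor.map f' g').comp (BTensor.map f g))
      (g := BHom.id _) (by simp [hf1, hg1])) x)
    (fun x => DFunLike.congr_fun (hom_ext (f := (BTensor.map f g).comp (BTensor.map f' g'))
      (g := BHom.id _) (by simp [hf2, hg2])) x)

theorem IsIso.id : IsIso (BHom.id V) := IsIso.of_inverse (BHom.id V) (fun _ => rfl) fun _ => rfl

theorem isIso_swap : IsIso (BTensor.swap V W) :=
  IsIso.of_inverse (BTensor.swap W V) BTensor.swap_swap BTensor.swap_swap

theorem BTensor.slice_slice (ω : BHom V ℂ) (η : BHom W ℂ) (x : BTensor V W) :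
    η (sliceLeft ω x) = ω (sliceRight η x) :=
  DFunLike.congr_fun (hom_ext (f := η.comp (sliceLeft ω)) (g := ω.comp (sliceRight η))
    (by simp [mul_comm])) x

end Iso

/-! ## Counits -/

section Counit

open BTensor

variable {H : Type*} [NonUnitalRing H] [Module ℂ H] [BornAlgebra H]
variable {Δ : EssHom H (BTensor H H)}

/-- The counit axioms in terms of the slice maps of a character. -/
structure IsSliceCounit (Δ : EssHom H (BTensor H H)) (ε : BHom H ℂ) : Prop where
  map_mul : ∀ f g, ε (f * g) = ε f * ε g
  exists_eq_one : ∃ k, ε k = 1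
  left_L : ∀ f x, sliceLeft ε ((Δ.toHom f).L x) = f * sliceLeft ε x
  left_R : ∀ f x, sliceLeft ε ((Δ.toHom f).R x) = sliceLeft ε x * f
  right_L : ∀ f x, sliceRight ε ((Δ.toHom f).L x) = f * sliceRight ε x
  right_R : ∀ f x, sliceRight ε ((Δ.toHom f).R x) = sliceRight ε x * f

theorem mulMap_tmul (a b : H) : mulMap H (tmul a b) = a * b := by
  simp [mulMap]

section Slices

theorem sliceLeft_lmul₂ {V : Type*} [AddCommGroup V] [Module ℂ V] [BornSpace V] (ω : BHom V ℂ)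
    (a : H) (x : BTensor V H) : sliceLeft ω (lmul₂ a x) = a * sliceLeft ω x :=
  DFunLike.congr_fun (hom_ext (f := (sliceLeft ω).comp (lmul₂ a))
    (g := (mulHom H a).comp (sliceLeft ω)) (by simp)) x

theorem sliceLeft_rmul₂ {V : Type*} [AddCommGroup V] [Module ℂ V] [BornSpace V] (ω : BHom V ℂ)
    (a : H) (x : BTensor V H) : sliceLeft ω (rmul₂ a x) = sliceLeft ω x * a :=
  DFunLike.congr_fun (hom_ext (f := (sliceLeft ω).comp (rmul₂ a))
    (g := (mulOpHom H a).comp (sliceLeft ω)) (by simp)) x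

theorem sliceRight_lmul₁ {V : Type*} [AddCommGroup V] [Module ℂ V] [BornSpace V] (ω : BHom V ℂ)
    (a : H) (x : BTensor H V) : sliceRight ω (lmul₁ a x) = a * sliceRight ω x :=
  DFunLike.congr_fun (hom_ext (f := (sliceRight ω).comp (lmul₁ a))
    (g := (mulHom H a).comp (sliceRight ω)) (by simp)) x

theorem sliceRight_rmul₁ {V : Type*} [AddCommGroup V] [Module ℂ V] [BornSpace V] (ω : BHom V ℂ)
    (a : H) (x : BTensor H V) : sliceRight ω (rmul₁ a x) = sliceRight ω x * a :=
  DFunLike.congr_fun (hom_ext (f := (sliceRight ω).comp (rmul₁ a))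
    (g := (mulOpHom H a).comp (sliceRight ω)) (by simp)) x

variable {ε : BHom H ℂ} (hε : ∀ f g, ε (f * g) = ε f * ε g)
include hε

theorem sliceRight_lmul₂ {V : Type*} [AddCommGroup V] [Module ℂ V] [BornSpace V]
    (a : H) (x : BTensor V H) : sliceRight ε (lmul₂ a x) = ε a • sliceRight ε x :=
  DFunLike.congr_fun (hom_ext (f := (sliceRight ε).comp (lmul₂ a))
    (g := ε a • sliceRight ε) (by simp [hε, mul_smul])) x

theorem sliceLeft_lmul₁ {V : Type*} [AddCommGroup V] [Module ℂ V] [BornSpace V]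
    (a : H) (x : BTensor H V) : sliceLeft ε (lmul₁ a x) = ε a • sliceLeft ε x :=
  DFunLike.congr_fun (hom_ext (f := (sliceLeft ε).comp (lmul₁ a))
    (g := ε a • sliceLeft ε) (by simp [hε, mul_smul])) x

theorem sliceLeft_rmul₁ {V : Type*} [AddCommGroup V] [Module ℂ V] [BornSpace V]
    (a : H) (x : BTensor H V) : sliceLeft ε (rmul₁ a x) = ε a • sliceLeft ε x :=
  DFunLike.congr_fun (hom_ext (f := (sliceLeft ε).comp (rmul₁ a))
    (g := ε a • sliceLeft ε) (by simp [hε, smul_smul, mul_comm])) x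

theorem sliceLeft_mul {B : Type*} [NonUnitalRing B] [Module ℂ B] [BornAlgebra B]
    (x y : BTensor H B) : sliceLeft ε (x * y) = sliceLeft ε x * sliceLeft ε y :=
  DFunLike.congr_fun (DFunLike.congr_fun (hom_ext₂
    (f := BHom.post (sliceLeft ε) (mulHom (BTensor H B)))
    (g := BHom.comp₂ (mulHom B) (sliceLeft ε) (sliceLeft ε))
    (by simp [hε, smul_smul, mul_comm])) x) y

theorem sliceRight_mul {B : Type*} [NonUnitalRing B] [Module ℂ B] [BornAlgebra B]
    (x y : BTensor B H) : sliceRight ε (x * y) = sliceRight ε x * sliceRight ε y :=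
  DFunLike.congr_fun (DFunLike.congr_fun (hom_ext₂
    (f := BHom.post (sliceRight ε) (mulHom (BTensor B H)))
    (g := BHom.comp₂ (mulHom B) (sliceRight ε) (sliceRight ε))
    (by simp [hε, smul_smul, mul_comm])) x) y

end Slices

section TensorCharacter

variable [EssentialAlgebra H] {ε : BHom H ℂ} (e : EssHom H ℂ)
  (he : e.toHom = (Multiplier.ι ℂ).comp ε)
include he

/-- Under `ℂ ⊗ H ≅ H` the homomorphism `ε ⊗ id` into multipliers is multiplication by the slice.
This and its variants translate between `IsCounit` and `IsSliceCounit`. -/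
theorem lid_tensor_L (x : BTensor H H) (y : BTensor ℂ H) :
    (lid H).toHom (((e.tensor (EssHom.id H)).toHom x).L y) = sliceLeft ε x * (lid H).toHom y := by
  refine DFunLike.congr_fun (DFunLike.congr_fun (hom_ext₂
    (f := BHom.post (lid H).toHom (leftAction (e.tensor (EssHom.id H)).toHom))
    (g := (BHom.comp₂ (mulHom H) (sliceLeft ε) (lid H).toHom)) fun a b z h => ?_) x) y
  change (lid H).toHom ((EssHom.tensorHom e.toHom (EssHom.id H).toHom (tmul a b)).L (tmul z h)) =
    sliceLeft ε (tmul a b) * (lid H).toHom (tmul z h)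
  rw [EssHom.tensorHom_tmul, Multiplier.tmul_L, BTensor.map_tmul, he]
  simp [mul_smul_comm, smul_mul_assoc, smul_smul, mul_comm, EssHom.id]

theorem lid_tensor_R (x : BTensor H H) (y : BTensor ℂ H) :
    (lid H).toHom (((e.tensor (EssHom.id H)).toHom x).R y) = (lid H).toHom y * sliceLeft ε x := by
  refine DFunLike.congr_fun (DFunLike.congr_fun (hom_ext₂
    (f := BHom.post (lid H).toHom (rightAction (e.tensor (EssHom.id H)).toHom))
    (g := (BHom.comp₂ (mulOpHom H) (sliceLeft ε) (lid H).toHom)) fun a b z h => ?_) x) y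
  change (lid H).toHom ((EssHom.tensorHom e.toHom (EssHom.id H).toHom (tmul a b)).R (tmul z h)) =
    (lid H).toHom (tmul z h) * sliceLeft ε (tmul a b)
  rw [EssHom.tensorHom_tmul, Multiplier.tmul_R, BTensor.map_tmul, he]
  simp [mul_smul_comm, smul_mul_assoc, smul_smul, mul_comm, EssHom.id]

theorem rid_tensor_L (x : BTensor H H) (y : BTensor H ℂ) :
    (rid H).toHom ((((EssHom.id H).tensor e).toHom x).L y) = sliceRight ε x * (rid H).toHom y := by
  refine DFunLike.congr_fun (DFunLike.congr_fun (hom_ext₂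
    (f := BHom.post (rid H).toHom (leftAction ((EssHom.id H).tensor e).toHom))
    (g := (BHom.comp₂ (mulHom H) (sliceRight ε) (rid H).toHom)) fun a b h z => ?_) x) y
  change (rid H).toHom ((EssHom.tensorHom (EssHom.id H).toHom e.toHom (tmul a b)).L (tmul h z)) =
    sliceRight ε (tmul a b) * (rid H).toHom (tmul h z)
  rw [EssHom.tensorHom_tmul, Multiplier.tmul_L, BTensor.map_tmul, he]
  simp [mul_smul_comm, smul_mul_assoc, smul_smul, mul_comm, EssHom.id]

theorem rid_tensor_R (x : BTensor H H) (y : BTensor H ℂ) :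
    (rid H).toHom ((((EssHom.id H).tensor e).toHom x).R y) = (rid H).toHom y * sliceRight ε x := by
  refine DFunLike.congr_fun (DFunLike.congr_fun (hom_ext₂
    (f := BHom.post (rid H).toHom (rightAction ((EssHom.id H).tensor e).toHom))
    (g := (BHom.comp₂ (mulOpHom H) (sliceRight ε) (rid H).toHom)) fun a b h z => ?_) x) y
  change (rid H).toHom ((EssHom.tensorHom (EssHom.id H).toHom e.toHom (tmul a b)).R (tmul h z)) =
    (rid H).toHom (tmul h z) * sliceRight ε (tmul a b)
  rw [EssHom.tensorHom_tmul, Multiplier.tmul_R, BTensor.map_tmul, he]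
  simp [mul_smul_comm, smul_mul_assoc, smul_smul, mul_comm, EssHom.id]

end TensorCharacter

theorem IsCounit.isSliceCounit [EssentialAlgebra H] (nH : IsNondegenerate H) {ε : BHom H ℂ}
    (h : IsCounit Δ ε) : IsSliceCounit Δ ε := by
  obtain ⟨e, he, hc⟩ := h
  have he' : ∀ a, e.toHom a = Multiplier.ι ℂ (ε a) := fun a => by rw [he]; rfl
  refine ⟨fun f g => ?_, ?_, fun f x => nH.ext_left fun h => ?_,
    fun f x => nH.ext_right fun h => ?_, fun f x => nH.ext_left fun h => ?_,
    fun f x => nH.ext_right fun h => ?_⟩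
  · have := congrArg (fun m => Multiplier.L m (1 : ℂ)) (e.map_mul f g)
    simpa [he'] using this
  -- If `ε` vanished, the essential action of `H` on `ℂ` would be zero, forcing `ℂ = 0`.
  · by_contra hcon
    push Not at hcon
    have h0 : ∀ k, ε k = 0 := by
      intro k
      by_contra hk
      exact hcon ((ε k)⁻¹ • k) (by simp [hk])
    have := e.essential_left.hom_ext (f := BHom.id ℂ) (g := 0) fun a b => by
      rw [leftAction_apply, he', h0, map_zero]
      rfl
    have := DFunLike.congr_fun this (1 : ℂ)
    simp at this
  -- The extension of `ε ⊗ id` to `Δ(f)` is only accessible on vectors of the form `(ε ⊗ id)(x) · (1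
  -- ⊗ h)`. There the counit axiom reads `(ε ⊗ id)(Δ(f)x) h = f (ε ⊗ id)(x) h`, and `h` is
  -- cancelled.
  · have h1 := (e.tensor (EssHom.id H)).extendL_apply (Δ.toHom f) x (tmul 1 h)
    have h2 := ((hc f).1 (((e.tensor (EssHom.id H)).toHom x).L (tmul 1 h))).1
    have h3 : (lid H).toHom ((e.tensor (EssHom.id H)).extendL (Δ.toHom f)
      (((e.tensor (EssHom.id H)).toHom x).L (tmul 1 h))) = _ := h2
    rw [h1, lid_tensor_L e he, lid_tensor_L e he, lid_tmul, one_smul,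
      Multiplier.ι_L, ← mul_assoc] at h3
    exact h3
  · have h1 := (e.tensor (EssHom.id H)).extendR_apply (Δ.toHom f) x (tmul 1 h)
    have h2 := ((hc f).1 (((e.tensor (EssHom.id H)).toHom x).R (tmul 1 h))).2
    have h3 : (lid H).toHom ((e.tensor (EssHom.id H)).extendR (Δ.toHom f)
      (((e.tensor (EssHom.id H)).toHom x).R (tmul 1 h))) = _ := h2
    rw [h1, lid_tensor_R e he, lid_tensor_R e he, lid_tmul, one_smul,
      Multiplier.ι_R, mul_assoc] at h3
    exact h3
  · have h1 := ((EssHom.id H).tensor e).extendL_apply (Δ.toHom f) x (tmul h 1)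
    have h2 := ((hc f).2 ((((EssHom.id H).tensor e).toHom x).L (tmul h 1))).1
    have h3 : (rid H).toHom (((EssHom.id H).tensor e).extendL (Δ.toHom f)
      ((((EssHom.id H).tensor e).toHom x).L (tmul h 1))) = _ := h2
    rw [h1, rid_tensor_L e he, rid_tensor_L e he, rid_tmul, one_smul,
      Multiplier.ι_L, ← mul_assoc] at h3
    exact h3
  · have h1 := ((EssHom.id H).tensor e).extendR_apply (Δ.toHom f) x (tmul h 1)
    have h2 := ((hc f).2 ((((EssHom.id H).tensor e).toHom x).R (tmul h 1))).2
    have h3 : (rid H).toHom (((EssHom.id H).tensor e).extendR (Δ.toHom f)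
      ((((EssHom.id H).tensor e).toHom x).R (tmul h 1))) = _ := h2
    rw [h1, rid_tensor_R e he, rid_tensor_R e he, rid_tmul, one_smul,
      Multiplier.ι_R, mul_assoc] at h3
    exact h3

namespace IsSliceCounit

variable {ε : BHom H ℂ} (hε : IsSliceCounit Δ ε) (nH : IsNondegenerate H)
  (hN : IsNondegenerate (BTensor H H)) (G : GaloisMaps Δ)
include hε hN

/-- The second leg of `(b ⊗ 1)Δ(a)` is covered by some `k` with `ε(k) = 1`; this does not change the
slice by the character `ε`, and turns the element into `(b ⊗ k)Δ(a)`, where the counit axiom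
applies. -/
theorem sliceRight_ρl (b a : H) : sliceRight ε (G.ρl (tmul b a)) = b * a := by
  obtain ⟨k, hk⟩ := hε.exists_eq_one
  have := sliceRight_lmul₂ hε.map_mul k (G.ρl (tmul b a))
  rw [G.lmul₂_ρl hN, hε.right_R, sliceRight_tmul, hk, one_smul, one_smul] at this
  exact this.symm

theorem sliceLeft_γr (a b : H) : sliceLeft ε (G.γr (tmul a b)) = a * b := by
  obtain ⟨k, hk⟩ := hε.exists_eq_one
  have := sliceLeft_rmul₁ hε.map_mul k (G.γr (tmul a b))
  rw [G.rmul₁_γr hN, hε.left_L, sliceLeft_tmul, hk, one_smul, one_smul] at this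
  exact this.symm

theorem sliceLeft_ρr (a b : H) : sliceLeft ε (G.ρr (tmul b a)) = b * a := by
  obtain ⟨k, hk⟩ := hε.exists_eq_one
  have := sliceLeft_lmul₁ hε.map_mul k (G.ρr (tmul b a))
  rw [G.lmul₁_ρr hN, hε.left_R, sliceLeft_tmul, hk, one_smul, one_smul] at this
  exact this.symm

include nH

theorem sliceLeft_ρl (b a : H) : sliceLeft ε (G.ρl (tmul b a)) = ε b • a :=
  nH.ext_right fun c => by
    rw [← sliceLeft_lmul₂, G.lmul₂_ρl hN, hε.left_R, sliceLeft_tmul, smul_mul_assoc, mul_smul_comm]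

theorem sliceRight_γr (a b : H) : sliceRight ε (G.γr (tmul a b)) = ε b • a :=
  nH.ext_left fun c => by
    rw [← sliceRight_rmul₁, G.rmul₁_γr hN, hε.right_L, sliceRight_tmul, smul_mul_assoc,
      mul_smul_comm]

-- For the characters `ε'` and `ε`, applied to the first and second leg of `(k ⊗ 1)Δ(a)`, the two
-- orders of slicing give `ε'(k)ε(a)` and `ε'(ka)`. It suffices to choose `ε'(k) = 1`.
include G in
theorem unique {ε' : BHom H ℂ} (hε' : IsSliceCounit Δ ε') : ε = ε' := by
  obtain ⟨k, hk⟩ := hε'.exists_eq_one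
  ext a
  have := slice_slice ε' ε (G.ρl (tmul k a))
  rw [hε'.sliceLeft_ρl nH hN, hε.sliceRight_ρl hN, map_smul, hε'.map_mul, hk] at this
  simpa using this

end IsSliceCounit

end Counit

/-! ## From the antipode to the Galois maps -/

section Antipode

open BTensor

variable {H : Type*} [NonUnitalRing H] [Module ℂ H] [BornAlgebra H]

theorem eq_of_lmul₁ (hH : HasApproximationProperty H) (nH : IsNondegenerate H)
    {x y : BTensor H H} (h : ∀ b, lmul₁ b x = lmul₁ b y) : x = y := by
  rw [← sub_eq_zero]
  refine eq_zero_of_map_left hH (f := fun a : H => mulHom H a) nH.right fun b => ?_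
  rw [map_sub]
  exact sub_eq_zero.2 (h b)

theorem isIso_antiSwap (S : BIso H H) : IsIso (antiSwap S.toHom) :=
  (IsIso.map S.isIso S.isIso).comp isIso_swap

theorem antiSwap_mul {S : BHom H H} (hS : ∀ f g, S (f * g) = S g * S f) (x y : BTensor H H) :
    antiSwap S (x * y) = antiSwap S y * antiSwap S x :=
  DFunLike.congr_fun (DFunLike.congr_fun (hom_ext₂
    (f := BHom.post (antiSwap S) (mulHom (BTensor H H)))
    (g := BHom.flip (BHom.comp₂ (mulHom _) (antiSwap S) (antiSwap S)))
    (by simp [antiSwap, hS])) x) y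

@[simp] theorem antiSwap_tmul (S : BHom H H) (a b : H) :
    antiSwap S (tmul a b) = tmul (S b) (S a) := by
  simp [antiSwap]

variable {Δ : EssHom H (BTensor H H)} {G : GaloisMaps Δ} {ε : BHom H ℂ} {S : BIso H H}

/-- On `x = f ⊗ g` both sides are `bf₁ ⊗ f₂g`. -/
theorem map_mulMap_onLeft_ρl (G : GaloisMaps Δ) (hN : IsNondegenerate (BTensor H H)) (b : H)
    (x : BTensor H H) :
    BTensor.map (BHom.id H) (mulMap H) (onLeft G.ρl (tmul b x)) = lmul₁ b (G.γr x) := by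
  refine DFunLike.congr_fun (hom_ext
    (f := (BTensor.map (BHom.id H) (mulMap H)).comp ((onLeft G.ρl).comp (tmulHom _ _ b)))
    (g := (lmul₁ b).comp G.γr) fun f g => ?_) x
  simp only [BHom.comp_apply, G.lmul₁_γr hN, tmulHom_apply, onLeft_tmul]
  exact DFunLike.congr_fun (hom_ext
    (f := (BTensor.map (BHom.id H) (mulMap H)).comp ((assoc H H H).toHom.comp
      (BHom.flip (tmulHom _ _) g))) (g := rmul₂ g) (by simp [mulMap_tmul])) _

/-- The conditions on counit and antipode which do not involve the comultiplication of the values of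
the antipode. -/
structure IsAntipode (G : GaloisMaps Δ) (ε : BHom H ℂ) (S : BIso H H) : Prop where
  counit : IsSliceCounit Δ ε
  map_mul : ∀ f g, S.toHom (f * g) = S.toHom g * S.toHom f
  antipode_left : ∀ x, mulMap H (BTensor.map S.toHom (BHom.id H) (G.γr x)) = sliceLeft ε x
  antipode_right : ∀ x, mulMap H (BTensor.map (BHom.id H) S.toHom (G.ρl x)) = sliceRight ε x

theorem IsCounitAntipode.isAntipode [EssentialAlgebra H] (h : IsCounitAntipode G ε S)
    (nH : IsNondegenerate H) : IsAntipode G ε S :=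
  ⟨h.counit.isSliceCounit nH, h.map_mul, h.antipode_left, h.antipode_right⟩

namespace IsAntipode

variable (h : IsAntipode G ε S)
include h

/-- The calculation is `f₁S(df₂) = f₁S(f₂)S(d) = ε(f)S(d)`. A factor `e` on the left is needed to
cover `f₁`, so that the axiom for `ρl` can be used. -/
theorem antipode_ρr (nH : IsNondegenerate H) (hN : IsNondegenerate (BTensor H H)) (d f : H) :
    mulMap H (BTensor.map (BHom.id H) S.toHom (G.ρr (tmul d f))) = ε f • S.toHom d := by
  refine nH.ext_right fun e => ?_
  have h1 : ∀ x, e * mulMap H (BTensor.map (BHom.id H) S.toHom x) =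
      mulMap H (BTensor.map (BHom.id H) S.toHom (lmul₁ e x)) := fun x =>
    DFunLike.congr_fun (hom_ext
      (f := (mulHom H e).comp ((mulMap H).comp (BTensor.map (BHom.id H) S.toHom)))
      (g := ((mulMap H).comp (BTensor.map (BHom.id H) S.toHom)).comp (lmul₁ e))
      (by simp [mulMap_tmul, mul_assoc])) x
  have h2 : ∀ x, mulMap H (BTensor.map (BHom.id H) S.toHom (lmul₂ d x)) =
      mulMap H (BTensor.map (BHom.id H) S.toHom x) * S.toHom d := fun x =>
    DFunLike.congr_fun (hom_ext
      (f := ((mulMap H).comp (BTensor.map (BHom.id H) S.toHom)).comp (lmul₂ d))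
      (g := (mulOpHom H (S.toHom d)).comp ((mulMap H).comp (BTensor.map (BHom.id H) S.toHom)))
      (by simp [mulMap_tmul, mul_assoc, h.map_mul])) x
  rw [h1, ← G.lmul₂_ρl_eq hN, h2, h.antipode_right, sliceRight_tmul, smul_mul_assoc, mul_smul_comm]

/-- The inverse of `f ⊗ g ↦ Δ(f) (1 ⊗ g)` is `f ⊗ g ↦ (id ⊗ S) ((1 ⊗ S⁻¹(g)) Δ(f))`. -/
theorem γr_inverse [EssentialAlgebra H] (hH : HasApproximationProperty H)
    (nH : IsNondegenerate H) (hΔ : IsComultiplication Δ) :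
    let A := (BTensor.map (BHom.id H) S.toHom).comp (G.ρr.comp
      ((BTensor.map S.inv (BHom.id H)).comp (swap H H)))
    (∀ x, A (G.γr x) = x) ∧ ∀ x, G.γr (A x) = x := by
  intro A
  have hN := nH.tensor hH hH nH
  have hN₃ := nH.tensor₃ hH hH hH nH nH
  have hε := h.counit
  -- Informally `f₁ ⊗ S(f₂)g`. Since `id ⊗ S` acts on `H ⊗ H` and not on multipliers, `g` is first
  -- moved inside as `S(f₂)g = S(S⁻¹(g)f₂)`, which covers the second leg of `Δ(f)`.
  have hA : ∀ f g, A (tmul f g) = BTensor.map (BHom.id H) S.toHom (G.ρr (tmul (S.inv g) f)) :=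
    fun f g => by simp [A]
  constructor
  -- The identity `a₁ ⊗ S(a₂)a₃c = a ⊗ c`. With `b` covering the first leg, the commutation of `ρl`
  -- and `γr` brings `γr` next to `S`, where the left antipode axiom applies; the counit removes the
  -- remaining leg.
  · refine fun x => DFunLike.congr_fun (hom_ext (f := A.comp G.γr) (g := BHom.id _)
      fun a c => eq_of_lmul₁ hH nH fun b => ?_) x
    let m : BHom (BTensor H (BTensor H H)) (BTensor H H) :=
      BTensor.map (BHom.id H) ((mulMap H).comp (BTensor.map S.toHom (BHom.id H)))
    have h1 : ∀ x, lmul₁ b (A x) = m (onLeft G.ρl (tmul b x)) := by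
      refine fun x => DFunLike.congr_fun (hom_ext (f := (lmul₁ b).comp A)
        (g := m.comp ((onLeft G.ρl).comp (tmulHom _ _ b))) fun f g => ?_) x
      have e : (lmul₁ b).comp (BTensor.map (BHom.id H) S.toHom) =
          (BTensor.map (BHom.id H) S.toHom).comp (lmul₁ b) := hom_ext (by simp)
      have e' := DFunLike.congr_fun e (G.ρr (tmul (S.inv g) f))
      simp only [BHom.comp_apply] at e'
      simp only [BHom.comp_apply, hA, e', ← G.lmul₂_ρl_eq hN, tmulHom_apply, onLeft_tmul]
      exact DFunLike.congr_fun (hom_ext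
        (f := (BTensor.map (BHom.id H) S.toHom).comp (lmul₂ (S.inv g)))
        (g := m.comp ((assoc H H H).toHom.comp (BHom.flip (tmulHom _ _) g)))
        (by simp [m, mulMap_tmul, h.map_mul, S.toHom_inv])) _
    have h2 : m.comp (onRight G.γr) = BTensor.map (BHom.id H) (sliceLeft ε) :=
      hom_ext fun k y => by
        simp only [BHom.comp_apply, onRight_tmul, m, BTensor.map_tmul, h.antipode_left]
    have h3 : (BTensor.map (BHom.id H) (sliceLeft ε)).comp ((assoc H H H).toHom.comp
        (BHom.flip (tmulHom _ _) c)) = (BHom.flip (tmulHom H H) c).comp (sliceRight ε) :=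
      hom_ext (by simp)
    have h4 := onLeft_ρl_onRight_γr hN hN₃ G hΔ (tmul b (tmul a c))
    rw [onRight_tmul, onLeft_tmul] at h4
    have h5 := DFunLike.congr_fun h2 ((assoc H H H).toHom (tmul (G.ρl (tmul b a)) c))
    have h6 := DFunLike.congr_fun h3 (G.ρl (tmul b a))
    simp only [BHom.comp_apply, BHom.flip_apply, tmulHom_apply] at h5 h6
    rw [BHom.comp_apply, h1, h4, h5, h6, hε.sliceRight_ρl hN, BHom.id_apply, lmul₁_tmul]
  -- The identity `a₁ ⊗ a₂S(a₃)c = a ⊗ c`, again with `b` in the first leg. Here `onLeft_ρl_ρr`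
  -- supplies the other bracketing and `antipode_ρr` contracts the last two legs.
  · refine fun x => DFunLike.congr_fun (hom_ext (f := G.γr.comp A) (g := BHom.id _)
      fun a c => eq_of_lmul₁ hH nH fun b => ?_) x
    have h2 : ∀ y, onLeft G.ρl (tmul b (BTensor.map (BHom.id H) S.toHom y)) =
        BTensor.map (BHom.id H) (BTensor.map (BHom.id H) S.toHom) (onLeft G.ρl (tmul b y)) := by
      refine fun y => DFunLike.congr_fun (hom_ext
        (f := (onLeft G.ρl).comp ((tmulHom _ _ b).comp (BTensor.map (BHom.id H) S.toHom)))
        (g := (BTensor.map (BHom.id H) (BTensor.map (BHom.id H) S.toHom)).comp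
          ((onLeft G.ρl).comp (tmulHom _ _ b))) fun f g => ?_) y
      simp only [BHom.comp_apply, tmulHom_apply, BTensor.map_tmul, onLeft_tmul, BHom.id_apply]
      exact DFunLike.congr_fun (hom_ext
        (f := (assoc H H H).toHom.comp (BHom.flip (tmulHom _ _) (S.toHom g)))
        (g := (BTensor.map (BHom.id H) (BTensor.map (BHom.id H) S.toHom)).comp
          ((assoc H H H).toHom.comp (BHom.flip (tmulHom _ _) g))) (by simp)) _
    have h3 : ((BTensor.map (BHom.id H) (mulMap H)).comp ((BTensor.map (BHom.id H)
        (BTensor.map (BHom.id H) S.toHom)).comp ((onRight G.ρr).comp ((swapRight H).comp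
          (BHom.flip (tmulHom _ _) (S.inv c)))))) =
        (BHom.flip (tmulHom H H) c).comp (sliceRight ε) := hom_ext fun k l => by
      simp only [BHom.comp_apply, BHom.flip_apply, tmulHom_apply, swapRight_tmul, onRight_tmul,
        BTensor.map_tmul, BHom.id_apply, h.antipode_ρr nH hN, S.toHom_inv, sliceRight_tmul,
        tmul_smul, smul_tmul]
    have h4 := DFunLike.congr_fun h3 (G.ρl (tmul b a))
    simp only [BHom.comp_apply, BHom.flip_apply, tmulHom_apply] at h4
    rw [BHom.comp_apply, hA, ← map_mulMap_onLeft_ρl G hN, h2, onLeft_ρl_ρr hN hN₃ G hΔ, h4,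
      hε.sliceRight_ρl hN, BHom.id_apply, lmul₁_tmul]

end IsAntipode

namespace IsCounitAntipode

variable [EssentialAlgebra H] (h : IsCounitAntipode G ε S)
include h

/-- The antiautomorphism `(S ⊗ S)τ` reverses products and preserves `Δ` up to `S`, so it sends
`Δ(f)(1 ⊗ g)` to `(S(g) ⊗ 1)Δ(S(f))`. -/
theorem antiSwap_γr (hN : IsNondegenerate (BTensor H H)) (x : BTensor H H) :
    antiSwap S.toHom (G.γr x) = G.ρl (antiSwap S.toHom x) := by
  refine DFunLike.congr_fun (hom_ext (f := (antiSwap S.toHom).comp G.γr)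
    (g := G.ρl.comp (antiSwap S.toHom)) fun f g => hN.ext_left fun y => ?_) x
  obtain ⟨σ, -, hσ⟩ := (isIso_antiSwap S).exists_inverse
  rw [← hσ y]
  have e : ∀ z, antiSwap S.toHom (rmul₂ g z) = lmul₁ (S.toHom g) (antiSwap S.toHom z) := fun z =>
    DFunLike.congr_fun (hom_ext (f := (antiSwap S.toHom).comp (rmul₂ g))
      (g := (lmul₁ (S.toHom g)).comp (antiSwap S.toHom)) (by simp [h.map_mul])) z
  simp only [BHom.comp_apply, antiSwap_tmul, G.ρl_mul, ← antiSwap_mul h.map_mul, G.mul_γr,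
    (h.coalgebra f _).1, e]

theorem antiSwap_γl (hN : IsNondegenerate (BTensor H H)) (x : BTensor H H) :
    antiSwap S.toHom (G.γl x) = G.ρr (antiSwap S.toHom x) := by
  refine DFunLike.congr_fun (hom_ext (f := (antiSwap S.toHom).comp G.γl)
    (g := G.ρr.comp (antiSwap S.toHom)) fun f g => hN.ext_left fun y => ?_) x
  obtain ⟨σ, -, hσ⟩ := (isIso_antiSwap S).exists_inverse
  rw [← hσ y]
  have e : ∀ z, antiSwap S.toHom (rmul₁ g z) = lmul₂ (S.toHom g) (antiSwap S.toHom z) := fun z =>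
    DFunLike.congr_fun (hom_ext (f := (antiSwap S.toHom).comp (rmul₁ g))
      (g := (lmul₂ (S.toHom g)).comp (antiSwap S.toHom)) (by simp [h.map_mul])) z
  simp only [BHom.comp_apply, antiSwap_tmul, G.ρr_mul, ← antiSwap_mul h.map_mul, G.mul_γl,
    (h.coalgebra f _).1, e]

variable (hH : HasApproximationProperty H) (nH : IsNondegenerate H) (hΔ : IsComultiplication Δ)
include hH nH hΔ

theorem isIso : IsIso G.γl ∧ IsIso G.γr ∧ IsIso G.ρl ∧ IsIso G.ρr := by
  have hN := nH.tensor hH hH nH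
  obtain ⟨h1, h2⟩ := (h.isAntipode nH).γr_inverse hH nH hΔ
  have hS := isIso_antiSwap S
  have i1 : IsIso G.γr := IsIso.of_inverse _ h1 h2
  -- The inverse of `γr` is `ρr` composed on both sides with isomorphisms, which are peeled off.
  have i2 : IsIso G.ρr := ((IsIso.map S.isIso_inv IsIso.id).comp isIso_swap).of_comp_right
    ((IsIso.map IsIso.id S.isIso).of_comp_left (IsIso.of_inverse _ h2 h1))
  have e1 : (antiSwap S.toHom).comp G.γl = G.ρr.comp (antiSwap S.toHom) :=
    BHom.ext (h.antiSwap_γl hN)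
  have e2 : (antiSwap S.toHom).comp G.γr = G.ρl.comp (antiSwap S.toHom) :=
    BHom.ext (h.antiSwap_γr hN)
  refine ⟨hS.of_comp_left (e1 ▸ i2.comp hS), i1, hS.of_comp_right (e2 ▸ hS.comp i1), i2⟩

/-- Once the counits agree, surjectivity of `γr` turns the left antipode axiom into `S(x)c = (ε ⊗
id)γr⁻¹(x ⊗ c)`, and nondegeneracy recovers `S(x)`. -/
theorem unique {ε' : BHom H ℂ} {S' : BIso H H} (h' : IsCounitAntipode G ε' S') :
    ε = ε' ∧ S.toHom = S'.toHom := by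
  have hN := nH.tensor hH hH nH
  have e : ε = ε' :=
    (h.counit.isSliceCounit nH).unique nH hN G (h'.counit.isSliceCounit nH)
  subst e
  refine ⟨rfl, BHom.ext fun x => nH.ext_left fun c => ?_⟩
  obtain ⟨γ, -, hγ⟩ := (h.isIso hH nH hΔ).2.1.exists_inverse
  have e1 := h.antipode_left (γ (tmul x c))
  have e2 := h'.antipode_left (γ (tmul x c))
  rw [hγ, BTensor.map_tmul, mulMap_tmul] at e1 e2
  exact e1.trans e2.symm

end IsCounitAntipode

end Antipode

/-! ## From the Galois maps to the counit -/

section CounitConstruction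

open BTensor

variable {H : Type*} [NonUnitalRing H] [Module ℂ H] [BornAlgebra H] [EssentialAlgebra H]
variable {Δ : EssHom H (BTensor H H)} {G : GaloisMaps Δ}
  (hN : IsNondegenerate (BTensor H H))
include hN

/-- A counit would satisfy `ε ⊗ id = μγr⁻¹` and `id ⊗ ε = μρl⁻¹`. The commutation of `ρl` and `γr`
makes the two right-hand sides compatible, and this compatibility alone forces both to be given by
one functional. -/
theorem exists_slice_eq_mul (hN₃ : IsNondegenerate (BTensor H (BTensor H H)))
    (hΔ : IsComultiplication Δ) (hγr : IsIso G.γr) (hρl : IsIso G.ρl) {ω : BHom H ℂ} {k : H}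
    (hk : ω k = 1) : ∃ ε : BHom H ℂ, (∀ x, sliceLeft ε (G.γr x) = mulMap H x) ∧
      ∀ x, sliceRight ε (G.ρl x) = mulMap H x := by
  obtain ⟨γ, hγ1, hγ2⟩ := hγr.exists_inverse
  obtain ⟨ρ, hρ1, hρ2⟩ := hρl.exists_inverse
  have h1 : (BTensor.map (BHom.id H) ((mulMap H).comp γ)).comp (onRight G.γr) =
      BTensor.map (BHom.id H) (mulMap H) := hom_ext (by simp [hγ1])
  have h2 : ∀ a y, BTensor.map (BHom.id H) ((mulMap H).comp γ) (onLeft G.ρl (tmul a y)) =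
      lmul₁ a y := by
    intro a y
    have h3 := onLeft_ρl_onRight_γr hN hN₃ G hΔ (tmul a (γ y))
    rw [onRight_tmul, hγ2] at h3
    rw [h3, ← BHom.comp_apply, h1, map_mulMap_onLeft_ρl G hN, hγ2]
  have h3 : ∀ x c, BTensor.map (BHom.id H) ((mulMap H).comp γ)
      ((assoc H H H).toHom (tmul (G.ρl x) c)) = tmul (mulMap H x) c := fun x c =>
    DFunLike.congr_fun (hom_ext
      (f := (BTensor.map (BHom.id H) ((mulMap H).comp γ)).comp ((assoc H H H).toHom.comp
        ((BHom.flip (tmulHom _ _) c).comp G.ρl)))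
      (g := (BHom.flip (tmulHom _ _) c).comp (mulMap H)) fun a b => by
        have := h2 a (tmul b c)
        rw [onLeft_tmul] at this
        simp [this, mulMap_tmul]) x
  -- Separation of variables: `c` enters the right-hand side only as its second factor, and `p` the
  -- left-hand side only as its first. Slicing by `ω` with `ω(k) = 1`, at `p = k` and then at `c =
  -- k`, extracts the scalar `ε(q)`.
  have h4 : ∀ p q c, tmul p (mulMap H (γ (tmul q c))) = tmul (mulMap H (ρ (tmul p q))) c := by
    intro p q c
    rw [← h3, hρ2, assoc_tmul, BTensor.map_tmul, BHom.id_apply, BHom.comp_apply]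
  let ε : BHom H ℂ := ω.comp ((mulMap H).comp (ρ.comp (tmulHom H H k)))
  have h5 : ∀ q c, mulMap H (γ (tmul q c)) = ε q • c := by
    intro q c
    have := congrArg (sliceLeft ω) (h4 k q c)
    rwa [sliceLeft_tmul, sliceLeft_tmul, hk, one_smul] at this
  have h6 : ∀ p q, mulMap H (ρ (tmul p q)) = ε q • p := by
    intro p q
    have := congrArg (sliceRight ω) (h4 p q k)
    rw [h5, tmul_smul, map_smul, sliceRight_tmul, sliceRight_tmul, hk, one_smul, one_smul] at this
    exact this.symm
  refine ⟨ε, fun x => ?_, fun x => ?_⟩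
  · have : (mulMap H).comp γ = sliceLeft ε := hom_ext fun q c => by simp [h5]
    rw [← this, BHom.comp_apply, hγ1]
  · have : (mulMap H).comp ρ = sliceRight ε := hom_ext fun q c => by simp [h6]
    rw [← this, BHom.comp_apply, hρ1]

-- Identities for slices are verified on values of `γr` or `ρl`, which exhaust `H ⊗ H`. The axioms
-- `left_L` and `right_R` come from multiplicativity of `Δ`; the other two axioms need `ε` to be a
-- character, so that slicing is multiplicative.
omit [EssentialAlgebra H] in
theorem isSliceCounit_of_slice_eq_mul (nH : IsNondegenerate H) (hγr : IsIso G.γr)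
    (hρl : IsIso G.ρl) {ω : BHom H ℂ} {k : H} (hk : ω k = 1) {ε : BHom H ℂ}
    (hl : ∀ x, sliceLeft ε (G.γr x) = mulMap H x)
    (hr : ∀ x, sliceRight ε (G.ρl x) = mulMap H x) : IsSliceCounit Δ ε := by
  obtain ⟨γ, hγ1, hγ2⟩ := hγr.exists_inverse
  obtain ⟨ρ, hρ1, hρ2⟩ := hρl.exists_inverse
  have lL : ∀ f x, sliceLeft ε ((Δ.toHom f).L x) = f * sliceLeft ε x := by
    intro f x
    rw [← hγ2 x]
    refine DFunLike.congr_fun (hom_ext (f := ((sliceLeft ε).comp ((Δ.toHom f).L.comp G.γr)))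
      (g := (mulHom H f).comp ((sliceLeft ε).comp G.γr)) fun a b => ?_) (γ x)
    simp only [BHom.comp_apply, mulHom_apply, ← G.γr_mul_left hN, hl, mulMap_tmul, mul_assoc]
  have rR : ∀ f x, sliceRight ε ((Δ.toHom f).R x) = sliceRight ε x * f := by
    intro f x
    rw [← hρ2 x]
    refine DFunLike.congr_fun (hom_ext (f := ((sliceRight ε).comp ((Δ.toHom f).R.comp G.ρl)))
      (g := (mulOpHom H f).comp ((sliceRight ε).comp G.ρl)) fun a b => ?_) (ρ x)
    simp only [BHom.comp_apply, mulOpHom_apply, ← G.ρl_mul_right hN, hr, mulMap_tmul, mul_assoc]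
  have hmul : ∀ f g, ε (f * g) = ε f * ε g := by
    intro f g
    -- For `x = γr(a ⊗ b)` one has `x(g ⊗ 1) = Δ(a)(g ⊗ b)`, whose slice is `a ε(g)b` by `lL`.
    -- Taking `x = f ⊗ k` then gives multiplicativity of `ε`.
    have h1 : ∀ x : BTensor H H, sliceLeft ε (rmul₁ g x) = ε g • sliceLeft ε x := by
      intro x
      rw [← hγ2 x]
      refine DFunLike.congr_fun (hom_ext (f := (sliceLeft ε).comp ((rmul₁ g).comp G.γr))
        (g := ε g • (sliceLeft ε).comp G.γr) fun a b => ?_) (γ x)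
      simp only [BHom.comp_apply, BHom.smul_apply, G.rmul₁_γr hN, lL, hl, mulMap_tmul,
        sliceLeft_tmul, mul_smul_comm]
    have h2 := congrArg ω (h1 (tmul f k))
    rw [rmul₁_tmul, sliceLeft_tmul, sliceLeft_tmul, map_smul, map_smul, map_smul, hk] at h2
    simpa [mul_comm] using h2
  refine ⟨hmul, ?_, lL, fun f x => nH.ext_left fun g => ?_, fun f x => nH.ext_right fun g => ?_,
    rR⟩
  · by_contra hcon
    push Not at hcon
    have h0 : ε = 0 := by
      ext a
      by_contra ha
      exact hcon ((ε a)⁻¹ • a) (by simpa using inv_mul_cancel₀ ha)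
    -- If `ε = 0`, then `μ = (ε ⊗ id)γr` vanishes, contradicting nondegeneracy since `ω(k) = 1`.
    have hk0 : k = 0 := nH.left k fun b => by
      have e : sliceLeft (0 : BHom H ℂ) = (0 : BHom (BTensor H H) H) := hom_ext (by simp)
      rw [← mulMap_tmul, ← hl, h0, e, BHom.zero_apply]
    rw [hk0, map_zero] at hk
    exact zero_ne_one hk
  · rw [← sliceLeft_rmul₂, ← G.mul_γr, sliceLeft_mul hmul, hl, mulMap_tmul, mul_assoc]
  · rw [← sliceRight_lmul₁, ← G.ρl_mul, sliceRight_mul hmul, hr, mulMap_tmul, mul_assoc]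

omit [EssentialAlgebra H] hN in
/-- A character defines an essential action on `ℂ` if all elementary balanced tensors are determined
by the character. -/
theorem isEssentialAction_of_character {m : BHom H (BHom H H)} {l : BHom H (BHom ℂ ℂ)}
    {ε : BHom H ℂ} (hl : ∀ a z, l a z = ε a * z) (hm : ∀ a b, ε (m a b) = ε a * ε b) {k : H}
    (hk : ε k = 1) (hq : ∀ a, Balanced.tmul m l a 1 = ε a • Balanced.tmul m l k 1) :
    IsEssentialAction m l := by
  let fwd : BHom (Balanced m l) ℂ := QuotBy.lift (BTensor.lift l) (by
    rintro _ ⟨a, x, b, rfl⟩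
    simp [hl, hm, mul_assoc])
  have hf : ∀ a z, fwd (Balanced.tmul m l a z) = ε a * z := fun a z => by
    rw [← hl]; exact BTensor.lift_tmul l a z
  refine ⟨⟨fwd, BHom.flip (smulHom _) (Balanced.tmul m l k 1), fun x => ?_, fun z => ?_⟩,
    fun a z => (hf a z).trans (hl a z).symm⟩
  · refine DFunLike.congr_fun (Balanced.hom_ext
      (f := (BHom.flip (smulHom _) (Balanced.tmul m l k 1)).comp fwd) (g := BHom.id _)
      fun a z => ?_) x
    have h1 : Balanced.tmul m l a z = z • Balanced.tmul m l a 1 := by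
      rw [Balanced.tmul, Balanced.tmul, ← map_smul, ← BTensor.tmul_smul, smul_eq_mul, mul_one]
    rw [BHom.comp_apply, hf, BHom.flip_apply, smulHom_apply, BHom.id_apply, h1, hq a, smul_smul,
      mul_comm]
  · rw [BHom.flip_apply, smulHom_apply, map_smul, hf, hk, one_mul, smul_eq_mul, mul_one]

/-- A counit in terms of slice maps is essential, and hence a counit. -/
theorem IsSliceCounit.isCounit (nH : IsNondegenerate H) (hγr : IsIso G.γr) (hρl : IsIso G.ρl)
    {ε : BHom H ℂ} (hε : IsSliceCounit Δ ε) : IsCounit Δ ε := by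
  obtain ⟨γ, hγ1, hγ2⟩ := hγr.exists_inverse
  obtain ⟨ρ, hρ1, hρ2⟩ := hρl.exists_inverse
  obtain ⟨k, hk⟩ := hε.exists_eq_one
  let l := leftAction ((Multiplier.ι ℂ).comp ε)
  let r := rightAction ((Multiplier.ι ℂ).comp ε)
  have hl : ∀ a z, l a z = ε a * z := fun _ _ => rfl
  have hr : ∀ a z, r a z = ε a * z := fun _ _ => mul_comm _ _
  have essl : IsEssentialAction (mulHom H) l := by
    refine isEssentialAction_of_character hl hε.map_mul hk fun a => ?_
    -- The class `q(f)` of `f ⊗ 1` satisfies `q(fg) = ε(g)q(f)`, so `qμ = q(id ⊗ ε)`. Evaluating at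
    -- `y = γr⁻¹(a ⊗ k)` gives `q(a) = ε(a)q(k)`, because `μ(y) = (ε ⊗ id)(a ⊗ k)` and `(id ⊗ ε)(y)
    -- = (id ⊗ ε)(a ⊗ k)`. The right action is treated with `ρl` in the same way.
    let q : BHom H (Balanced (mulHom H) l) :=
      (QuotBy.mk _).comp (BHom.flip (BTensor.tmulHom H ℂ) 1)
    have hq : ∀ f g, q (f * g) = ε g • q f := fun f g => by
      have h1 := Balanced.tmul_rel (mulHom H) l f g 1
      rw [hl, mul_one, mulHom_apply] at h1
      refine h1.trans ?_
      change QuotBy.mk _ (tmul f (ε g)) = ε g • QuotBy.mk _ (tmul f (1 : ℂ))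
      rw [← map_smul, ← BTensor.tmul_smul, smul_eq_mul, mul_one]
    have e1 : q.comp (mulMap H) = q.comp (sliceRight ε) :=
      hom_ext fun f g => by simp [mulMap_tmul, hq]
    have e2 : mulMap H = (sliceLeft ε).comp G.γr :=
      hom_ext fun f g => by simp [mulMap_tmul, hε.sliceLeft_γr hN]
    have e3 : (sliceRight ε).comp G.γr = sliceRight ε :=
      hom_ext fun f g => by simp [hε.sliceRight_γr nH hN]
    have h1 := DFunLike.congr_fun e1 (γ (tmul a k))
    have h2 := DFunLike.congr_fun e2 (γ (tmul a k))
    have h3 := DFunLike.congr_fun e3 (γ (tmul a k))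
    simp only [BHom.comp_apply, hγ2, sliceLeft_tmul, sliceRight_tmul, hk, one_smul] at h1 h2 h3
    rw [h2, ← h3, map_smul] at h1
    exact h1.symm
  have essr : IsEssentialAction (mulOpHom H) r := by
    refine isEssentialAction_of_character hr (fun a b => ?_) hk fun a => ?_
    · rw [mulOpHom_apply, hε.map_mul, mul_comm]
    let q : BHom H (Balanced (mulOpHom H) r) :=
      (QuotBy.mk _).comp (BHom.flip (BTensor.tmulHom H ℂ) 1)
    have hq : ∀ f g, q (f * g) = ε f • q g := fun f g => by
      have h1 := Balanced.tmul_rel (mulOpHom H) r g f 1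
      rw [hr, mul_one, mulOpHom_apply] at h1
      refine h1.trans ?_
      change QuotBy.mk _ (tmul g (ε f)) = ε f • QuotBy.mk _ (tmul g (1 : ℂ))
      rw [← map_smul, ← BTensor.tmul_smul, smul_eq_mul, mul_one]
    have e1 : q.comp (mulMap H) = q.comp (sliceLeft ε) :=
      hom_ext fun f g => by simp [mulMap_tmul, hq]
    have e2 : mulMap H = (sliceRight ε).comp G.ρl :=
      hom_ext fun f g => by simp [mulMap_tmul, hε.sliceRight_ρl hN]
    have e3 : (sliceLeft ε).comp G.ρl = sliceLeft ε :=
      hom_ext fun f g => by simp [hε.sliceLeft_ρl nH hN]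
    have h1 := DFunLike.congr_fun e1 (ρ (tmul k a))
    have h2 := DFunLike.congr_fun e2 (ρ (tmul k a))
    have h3 := DFunLike.congr_fun e3 (ρ (tmul k a))
    simp only [BHom.comp_apply, hρ2, sliceLeft_tmul, sliceRight_tmul, hk, one_smul] at h1 h2 h3
    rw [h2, ← h3, map_smul] at h1
    exact h1.symm
  let e : EssHom H ℂ := ⟨(Multiplier.ι ℂ).comp ε, fun f g => by
    refine Multiplier.ext (fun z => ?_) fun z => ?_ <;> simp [hε.map_mul, mul_assoc], essl, essr⟩
  have he : e.toHom = (Multiplier.ι ℂ).comp ε := rfl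
  refine ⟨e, he, fun f => ⟨fun x => ⟨?_, ?_⟩, fun x => ⟨?_, ?_⟩⟩⟩
  -- By essentiality of `ε ⊗ id` it is enough to compare on vectors where the extension is explicit.
  · exact DFunLike.congr_fun ((e.tensor (EssHom.id H)).essential_left.hom_ext
      (f := (lid H).toHom.comp ((e.tensor (EssHom.id H)).extendL (Δ.toHom f)))
      (g := (mulHom H f).comp (lid H).toHom) fun a b => by
        simp only [BHom.comp_apply, leftAction_apply, EssHom.extendL_apply, lid_tensor_L e he,
          hε.left_L, mulHom_apply, mul_assoc]) x
  · exact DFunLike.congr_fun ((e.tensor (EssHom.id H)).essential_right.hom_ext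
      (f := (lid H).toHom.comp ((e.tensor (EssHom.id H)).extendR (Δ.toHom f)))
      (g := (mulOpHom H f).comp (lid H).toHom) fun a b => by
        simp only [BHom.comp_apply, rightAction_apply, EssHom.extendR_apply, lid_tensor_R e he,
          hε.left_R, mulOpHom_apply, mul_assoc]) x
  · exact DFunLike.congr_fun (((EssHom.id H).tensor e).essential_left.hom_ext
      (f := (rid H).toHom.comp (((EssHom.id H).tensor e).extendL (Δ.toHom f)))
      (g := (mulHom H f).comp (rid H).toHom) fun a b => by
        simp only [BHom.comp_apply, leftAction_apply, EssHom.extendL_apply, rid_tensor_L e he,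
          hε.right_L, mulHom_apply, mul_assoc]) x
  · exact DFunLike.congr_fun (((EssHom.id H).tensor e).essential_right.hom_ext
      (f := (rid H).toHom.comp (((EssHom.id H).tensor e).extendR (Δ.toHom f)))
      (g := (mulOpHom H f).comp (rid H).toHom) fun a b => by
        simp only [BHom.comp_apply, rightAction_apply, EssHom.extendR_apply, rid_tensor_R e he,
          hε.right_R, mulOpHom_apply, mul_assoc]) x

end CounitConstruction

/-! ## From the Galois maps to the antipode -/

section AntipodeConstruction

open BTensor

theorem IsIso.onLeft {V : Type*} [AddCommGroup V] [Module ℂ V] [BornSpace V]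
    {g : BHom (BTensor V V) (BTensor V V)} (hg : IsIso g) : IsIso (onLeft g) :=
  (assoc V V V).isIso.comp ((hg.map IsIso.id).comp (assoc V V V).isIso_inv)

theorem IsIso.doubleGalois {V : Type*} [AddCommGroup V] [Module ℂ V] [BornSpace V]
    {g : BHom (BTensor V V) (BTensor V V)} (hg : IsIso g) : IsIso (doubleGalois g) :=
  hg.onLeft.comp (((IsIso.id.map isIso_swap).comp (assoc V V V).isIso).comp
    ((hg.map IsIso.id).comp ((assoc V V V).isIso_inv.comp (IsIso.id.map isIso_swap))))

variable {H : Type*} [NonUnitalRing H] [Module ℂ H] [BornAlgebra H] [EssentialAlgebra H]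
variable {Δ : EssHom H (BTensor H H)} {G : GaloisMaps Δ} {ε : BHom H ℂ}
  (hH : HasApproximationProperty H) (nH : IsNondegenerate H) (hΔ : IsComultiplication Δ)
  (hε : IsSliceCounit Δ ε)
include hH nH hΔ hε

/-- Strong left invariance, where `σ (f ⊗ g) = S(f) g`. -/
theorem strong_left_invariance {φ : BHom H ℂ}
    (hφ : IsLeftInvariant G φ) {σ : BHom (BTensor H H) H} (hσ : ∀ x, σ (G.γr x) = sliceLeft ε x)
    (x : BTensor H H) (c : H) :
    σ (tmul (sliceRight φ (G.γr x)) c) = sliceRight φ (G.ρr x) * c := by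
  have hN := nH.tensor hH hH nH
  refine DFunLike.congr_fun (hom_ext
    (f := σ.comp ((BHom.flip (tmulHom H H) c).comp ((sliceRight φ).comp G.γr)))
    (g := (mulOpHom H c).comp ((sliceRight φ).comp G.ρr)) fun a b => ?_) x
  have := (G.isGaloisPair hΔ nH hN).strong_invariance hH (hε.sliceLeft_γr hN G)
    (fun f g => (hφ f g).1) hσ a b c
  simp only [BHom.comp_apply, BHom.flip_apply, tmulHom_apply, mulOpHom_apply, this]
  rw [← sliceRight_rmul₁, ← G.lmul₂_γl hN]
  rfl

/-- Strong left invariance, where `σ (f ⊗ g) = g S⁻¹(f)`. -/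
theorem strong_left_invariance_op {φ : BHom H ℂ}
    (hφ : IsLeftInvariant G φ) {σ : BHom (BTensor H H) H}
    (hσ : ∀ x, σ (G.ρr x) = sliceRight ε x) (x : BTensor H H) (c : H) :
    σ (tmul (sliceRight φ (G.ρr x)) c) = c * sliceRight φ (G.γr x) := by
  have hN := nH.tensor hH hH nH
  refine DFunLike.congr_fun (hom_ext
    (f := σ.comp ((BHom.flip (tmulHom H H) c).comp ((sliceRight φ).comp G.ρr)))
    (g := (mulHom H c).comp ((sliceRight φ).comp G.γr)) fun b a => ?_) x
  have e : (sliceRight ε).comp (swap H H) = sliceLeft ε := hom_ext (by simp)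
  have := (G.isGaloisPair_op hΔ nH hN).strong_invariance hH (σ := σ)
    (fun a b => by rw [BHom.comp_apply, swap_tmul]; exact hε.sliceLeft_ρr hN G a b)
    (fun f g => by rw [BHom.comp_apply, swap_tmul]; exact (hφ f g).2)
    (fun x => by rw [BHom.comp_apply, hσ, ← e, BHom.comp_apply]) a b c
  simp only [BHom.comp_apply, BHom.flip_apply, tmulHom_apply, mulHom_apply, swap_tmul] at this ⊢
  rw [this, ← sliceRight_lmul₁, G.lmul₁_γr hN]
  rfl

/-- Strong invariance says that the antipode carries `(id ⊗ φ)γr(x)` to `(id ⊗ φ)ρr(x)`, and the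
opposite version says the reverse. As `γr` and `ρr` are onto and `φ(k) = 1`, every element of `H` is
a slice of either kind, so this describes two mutually inverse maps. -/
theorem exists_antipode {φ : BHom H ℂ} (hφ : IsLeftInvariant G φ) {k : H} (hk : φ k = 1)
    (hγr : IsIso G.γr) (hρr : IsIso G.ρr) : ∃ S : BIso H H,
      ∀ x, mulMap H (BTensor.map S.toHom (BHom.id H) (G.γr x)) = sliceLeft ε x := by
  obtain ⟨γ, hγ1, hγ2⟩ := hγr.exists_inverse
  obtain ⟨ρ, hρ1, hρ2⟩ := hρr.exists_inverse
  have h1 := strong_left_invariance hH nH hΔ hε hφ (σ := (sliceLeft ε).comp γ)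
    fun x => by rw [BHom.comp_apply, hγ1]
  have h2 := strong_left_invariance_op hH nH hΔ hε hφ (σ := (sliceRight ε).comp ρ)
    fun x => by rw [BHom.comp_apply, hρ1]
  -- The element `v` is the slice of `v ⊗ k = γr(y)` with `y = γr⁻¹(v ⊗ k)`; its image is the slice
  -- of `ρr(y)`. Boundedness is immediate from this formula.
  let S : BHom H H :=
    (sliceRight φ).comp (G.ρr.comp (γ.comp (BHom.flip (tmulHom H H) k)))
  let T : BHom H H :=
    (sliceRight φ).comp (G.γr.comp (ρ.comp (BHom.flip (tmulHom H H) k)))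
  have hS : ∀ v c, S v * c = sliceLeft ε (γ (tmul v c)) := fun v c => by
    have := h1 (γ (tmul v k)) c
    rw [hγ2, sliceRight_tmul, hk, one_smul] at this
    exact this.symm
  have hT : ∀ v c, c * T v = sliceRight ε (ρ (tmul v c)) := fun v c => by
    have := h2 (ρ (tmul v k)) c
    rw [hρ2, sliceRight_tmul, hk, one_smul] at this
    exact this.symm
  -- Independence of the chosen preimage: `S(v)c` was identified by `hS` with an expression not
  -- involving `k`, and strong invariance evaluates it for any `x`.
  have hS' : ∀ x, S (sliceRight φ (G.γr x)) = sliceRight φ (G.ρr x) := fun x =>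
    nH.ext_left fun c => by rw [hS, ← h1]; rfl
  have hT' : ∀ x, T (sliceRight φ (G.ρr x)) = sliceRight φ (G.γr x) := fun x =>
    nH.ext_right fun c => by rw [hT, ← h2]; rfl
  refine ⟨⟨S, T, fun v => ?_, fun v => ?_⟩, fun x => ?_⟩
  · refine (hT' (γ (tmul v k))).trans ?_
    rw [hγ2, sliceRight_tmul, hk, one_smul]
  · refine (hS' (ρ (tmul v k))).trans ?_
    rw [hρ2, sliceRight_tmul, hk, one_smul]
  · have e : (mulMap H).comp (BTensor.map S (BHom.id H)) = (sliceLeft ε).comp γ :=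
      hom_ext fun v c => by simp [mulMap_tmul, hS]
    have := DFunLike.congr_fun e (G.γr x)
    simpa only [BHom.comp_apply, hγ1] using this

variable {S : BIso H H}
  (hS : ∀ x, mulMap H (BTensor.map S.toHom (BHom.id H) (G.γr x)) = sliceLeft ε x)
  (hγr : IsIso G.γr)
include hS hγr

/-- The left axiom reads `S(a)d = (ε ⊗ id)γr⁻¹(a ⊗ d)` and the right one `cS(a) = (id ⊗ ε)ρl⁻¹(c ⊗
a)`. Applying `γr⁻¹` on the last legs and `ρl⁻¹` on the first legs of `c ⊗ a ⊗ d`, in either order,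
and multiplying out gives `c(S(a)d)` on one hand and `(id ⊗ ε)ρl⁻¹(c ⊗ a) d` on the other. -/
theorem antipode_right_of_left (hρl : IsIso G.ρl) (x : BTensor H H) :
    mulMap H (BTensor.map (BHom.id H) S.toHom (G.ρl x)) = sliceRight ε x := by
  have hN := nH.tensor hH hH nH
  have hN₃ := nH.tensor₃ hH hH hH nH nH
  obtain ⟨γ, hγ1, hγ2⟩ := hγr.exists_inverse
  obtain ⟨ρ, hρ1, hρ2⟩ := hρl.exists_inverse
  have hμγ : (mulMap H).comp γ = sliceLeft ε := by
    have : (sliceLeft ε).comp G.γr = mulMap H :=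
      hom_ext fun a b => by simp [hε.sliceLeft_γr hN, mulMap_tmul]
    ext y
    rw [← this, BHom.comp_apply, BHom.comp_apply, hγ2]
  have hμρ : (mulMap H).comp ρ = sliceRight ε := by
    have : (sliceRight ε).comp G.ρl = mulMap H :=
      hom_ext fun a b => by simp [hε.sliceRight_ρl hN, mulMap_tmul]
    ext y
    rw [← this, BHom.comp_apply, BHom.comp_apply, hρ2]
  -- Commuting invertible operators have commuting inverses.
  have hcomm : ∀ z, onRight γ (onLeft ρ z) = onLeft ρ (onRight γ z) := by
    intro z
    have e1 : ∀ w, onRight γ (onRight G.γr w) = w := fun w => by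
      rw [onRight_onRight, show γ.comp G.γr = BHom.id _ from BHom.ext hγ1, onRight_id]
    have e2 : ∀ w, onRight G.γr (onRight γ w) = w := fun w => by
      rw [onRight_onRight, show G.γr.comp γ = BHom.id _ from BHom.ext hγ2, onRight_id]
    have e3 : ∀ w, onLeft ρ (onLeft G.ρl w) = w := fun w => by
      rw [onLeft_onLeft, show ρ.comp G.ρl = BHom.id _ from BHom.ext hρ1, onLeft_id]
    have e4 : ∀ w, onLeft G.ρl (onLeft ρ w) = w := fun w => by
      rw [onLeft_onLeft, show G.ρl.comp ρ = BHom.id _ from BHom.ext hρ2, onLeft_id]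
    have := onLeft_ρl_onRight_γr hN hN₃ G hΔ (onRight γ (onLeft ρ z))
    rw [e2, e4] at this
    conv_rhs => rw [this, e1, e3]
  have hl : ∀ p (y : BTensor H H), mulMap H (BTensor.map (BHom.id H) (mulMap H)
      (onLeft ρ (tmul p y))) = p * sliceLeft ε y := by
    refine fun p y => DFunLike.congr_fun (hom_ext
      (f := (mulMap H).comp ((BTensor.map (BHom.id H) (mulMap H)).comp
        ((onLeft ρ).comp (tmulHom _ _ p)))) (g := (mulHom H p).comp (sliceLeft ε))
        fun q r => ?_) y
    have e : (mulMap H).comp ((BTensor.map (BHom.id H) (mulMap H)).comp ((assoc H H H).toHom.comp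
        (BHom.flip (tmulHom _ _) r))) = (mulOpHom H r).comp (mulMap H) :=
      hom_ext (by simp [mulMap_tmul, mul_assoc])
    have e' := DFunLike.congr_fun e (ρ (tmul p q))
    have e'' := DFunLike.congr_fun hμρ (tmul p q)
    simp only [BHom.comp_apply, BHom.flip_apply, tmulHom_apply, mulOpHom_apply] at e' e''
    simp only [BHom.comp_apply, tmulHom_apply, onLeft_tmul, e', e'', sliceRight_tmul,
      sliceLeft_tmul, mulHom_apply, mul_smul_comm, smul_mul_assoc]
  have hr : ∀ (y : BTensor H H) d, mulMap H (BTensor.map (BHom.id H) (mulMap H)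
      (onRight γ ((assoc H H H).toHom (tmul y d)))) = sliceRight ε y * d := by
    refine fun y d => DFunLike.congr_fun (hom_ext
      (f := (mulMap H).comp ((BTensor.map (BHom.id H) (mulMap H)).comp ((onRight γ).comp
        ((assoc H H H).toHom.comp (BHom.flip (tmulHom _ _) d)))))
      (g := (mulOpHom H d).comp (sliceRight ε)) fun p q => ?_) y
    have e'' := DFunLike.congr_fun hμγ (tmul q d)
    simp only [BHom.comp_apply] at e''
    simp [mulMap_tmul, e'']
  have key : ∀ c a, c * S.toHom a = sliceRight ε (ρ (tmul c a)) := by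
    refine fun c a => nH.ext_left fun d => ?_
    have h1 := hcomm (tmul c (tmul a d))
    have h2 := hS (γ (tmul a d))
    rw [hγ2, BTensor.map_tmul, mulMap_tmul, BHom.id_apply] at h2
    rw [← hr, ← onLeft_tmul, h1, onRight_tmul, hl, ← h2, mul_assoc]
  have e : (mulMap H).comp (BTensor.map (BHom.id H) S.toHom) = (sliceRight ε).comp ρ :=
    hom_ext fun c a => by simp [mulMap_tmul, key]
  have := DFunLike.congr_fun e (G.ρl x)
  simpa only [BHom.comp_apply, hρ1] using this

-- With `σ(a ⊗ c) = S(a)c`, the left axiom gives `σ(Δ(p)y) = ε(p)σ(y)`. On `x = γr(p ⊗ q)` one gets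
-- `σ(x(b ⊗ 1)) = σ(Δ(p)(b ⊗ q)) = ε(p)S(b)q = S(b)σ(x)`; as `γr` is onto, `x = a ⊗ c` is allowed.
omit [EssentialAlgebra H] hΔ in
theorem antipode_mul (a b : H) : S.toHom (a * b) = S.toHom b * S.toHom a := by
  have hN := nH.tensor hH hH nH
  obtain ⟨γ, hγ1, hγ2⟩ := hγr.exists_inverse
  let σ := (mulMap H).comp (BTensor.map S.toHom (BHom.id H))
  have hσ : ∀ a c, σ (tmul a c) = S.toHom a * c := fun a c => by simp [σ, mulMap_tmul]
  have h1 : ∀ p y, σ ((Δ.toHom p).L y) = ε p • σ y := by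
    intro p y
    rw [← hγ2 y]
    refine DFunLike.congr_fun (hom_ext (f := σ.comp ((Δ.toHom p).L.comp G.γr))
      (g := ε p • σ.comp G.γr) fun r s => ?_) (γ y)
    simp only [BHom.comp_apply, BHom.smul_apply, ← G.γr_mul_left hN]
    refine (hS _).trans ?_
    rw [sliceLeft_tmul, hε.map_mul, mul_smul, ← sliceLeft_tmul ε r s, ← hS]
    rfl
  have h2 : ∀ x, σ (rmul₁ b x) = S.toHom b * σ x := by
    intro x
    rw [← hγ2 x]
    refine DFunLike.congr_fun (hom_ext (f := σ.comp ((rmul₁ b).comp G.γr))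
      (g := (mulHom H (S.toHom b)).comp (σ.comp G.γr)) fun p q => ?_) (γ x)
    simp only [BHom.comp_apply, G.rmul₁_γr hN, h1, hσ, mulHom_apply]
    have := hS (tmul p q)
    rw [sliceLeft_tmul] at this
    change _ = S.toHom b * mulMap H (BTensor.map S.toHom (BHom.id H) (G.γr (tmul p q)))
    rw [this, mul_smul_comm]
  refine nH.ext_left fun c => ?_
  rw [← hσ, ← rmul₁_tmul, h2, hσ, mul_assoc]

/-- Uniqueness of convolution inverses: `Δ ∘ S` and `(S ⊗ S)τΔ` are both left convolution inverses
of `Δ`. Composition with the invertible operator `doubleGalois G.γr`, that is `k ⊗ y ↦ Δ²(k)(1 ⊗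
y)`, replaces the convolution product. -/
theorem isCoalgebraAntihom_antipode (hρl : IsIso G.ρl) : IsCoalgebraAntihom Δ S := by
  have hN := nH.tensor hH hH nH
  have hmul := antipode_mul hH nH hε hS hγr
  obtain ⟨hA1, hA2⟩ := IsAntipode.γr_inverse
    ⟨hε, hmul, hS, antipode_right_of_left hH nH hΔ hε hS hγr hρl⟩ hH nH hΔ
  set A := (BTensor.map (BHom.id H) S.toHom).comp (G.ρr.comp
      ((BTensor.map S.inv (BHom.id H)).comp (swap H H))) with hA
  let σ := (mulMap H).comp (BTensor.map S.toHom (BHom.id H))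
  have hσ : ∀ a c, σ (tmul a c) = S.toHom a * c := fun a c => by simp [σ, mulMap_tmul]
  let P : BHom (BTensor H (BTensor H H)) (BTensor H H) :=
    BTensor.lift ((leftAction Δ.toHom).comp S.toHom)
  -- Informally `f ⊗ p ⊗ q ↦ S(f₂)p ⊗ S(f₁)q`: the map `A` produces `f₁ ⊗ S(f₂)p`, and `σ` applies
  -- `S` to the other leg.
  let Q : BHom (BTensor H (BTensor H H)) (BTensor H H) :=
    (BTensor.map (BHom.id H) σ).comp ((onLeft (swap H H)).comp (onLeft A))
  have hPt : ∀ f y, P (tmul f y) = (Δ.toHom (S.toHom f)).L y := fun f y => BTensor.lift_tmul _ _ _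
  -- On `y = Δ(g)z` this is `Δ(S(k₁))Δ(k₂g)z = Δ(S(k₁)k₂g)z = ε(k)Δ(g)z`; essentiality of `Δ`
  -- reduces to such `y`.
  have hP : P.comp (doubleGalois G.γr) = sliceLeft ε := by
    refine hom_ext fun k y => (DFunLike.congr_fun (Δ.essential_left.hom_ext
      (f := (P.comp (doubleGalois G.γr)).comp (tmulHom _ _ k)) (g := ε k • BHom.id _)
      fun g z => ?_) y).trans (sliceLeft_tmul ε k y).symm
    have h1 := (G.isGaloisPair hΔ nH hN).map_γr hH (T := BHom.flip (leftAction Δ.toHom) z)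
      (fun l b => by simp [Δ.map_mul]) k g
    have h2 : P.comp (BTensor.map (BHom.id H) (BHom.flip (leftAction Δ.toHom) z)) =
        (BHom.flip (leftAction Δ.toHom) z).comp σ :=
      hom_ext fun p q => by simp [hPt, hσ, Δ.map_mul]
    have h3 := DFunLike.congr_fun h2 (G.γr (tmul k g))
    have h4 : σ (G.γr (tmul k g)) = ε k • g := (hS _).trans (sliceLeft_tmul _ _ _)
    simp only [BHom.comp_apply, BHom.flip_apply, h4, map_smul, h1] at h3
    exact h3
  -- Since `A` inverts `γr`, the inner antipode cancels and leaves `p ⊗ S(a₁)a₂q = ε(a) p ⊗ q`.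
  have hQ : Q.comp (doubleGalois G.γr) = sliceLeft ε := by
    refine hom_ext_right fun a p q => ?_
    have h1 : (BTensor.map (BHom.id H) σ).comp ((onLeft (swap H H)).comp ((swapRight H).comp
        (BHom.flip (tmulHom _ _) p))) = (tmulHom H H p).comp σ := hom_ext (by simp)
    have h2 := DFunLike.congr_fun h1 (G.γr (tmul a q))
    have h3 : σ (G.γr (tmul a q)) = ε a • q := (hS _).trans (sliceLeft_tmul _ _ _)
    simp only [BHom.comp_apply, BHom.flip_apply, tmulHom_apply, h3] at h2
    simp only [Q, BHom.comp_apply, doubleGalois_tmul, onLeft_onLeft,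
      show A.comp G.γr = BHom.id _ from BHom.ext hA1, onLeft_id, h2, sliceLeft_tmul, tmul_smul]
  have hPQ : P = Q := by
    obtain ⟨D, -, hD⟩ := hγr.doubleGalois.exists_inverse
    ext w
    rw [← hD w]
    exact DFunLike.congr_fun (hP.trans hQ.symm) (D w)
  have hL : ∀ f x, (Δ.toHom (S.toHom f)).L (antiSwap S.toHom x) =
      antiSwap S.toHom ((Δ.toHom f).R x) := by
    refine fun f x => DFunLike.congr_fun (hom_ext
      (f := (Δ.toHom (S.toHom f)).L.comp (antiSwap S.toHom))
      (g := (antiSwap S.toHom).comp (Δ.toHom f).R) fun q p => ?_) x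
    -- On vectors `S(p) ⊗ S(q)` the map `Q` simplifies, because `A(f ⊗ S(p))` is `(id ⊗ S)((1 ⊗
    -- p)Δ(f))`.
    have h1 : (BTensor.map (BHom.id H) σ).comp ((onLeft (swap H H)).comp ((assoc H H H).toHom.comp
        ((BHom.flip (tmulHom _ _) (S.toHom q)).comp (BTensor.map (BHom.id H) S.toHom)))) =
        (antiSwap S.toHom).comp (lmul₁ q) := hom_ext (by simp [onLeft_tmul, hσ, hmul])
    have h2 := DFunLike.congr_fun h1 (G.ρr (tmul p f))
    simp only [BHom.comp_apply, BHom.flip_apply, tmulHom_apply, G.lmul₁_ρr hN] at h2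
    rw [BHom.comp_apply, BHom.comp_apply, antiSwap_tmul, ← hPt, hPQ, ← h2]
    simp [Q, A, S.inv_toHom]
  -- The identity for right multipliers follows from the one for left multipliers by testing against
  -- elements `(S ⊗ S)τ(y)`, which exhaust `H ⊗ H`.
  refine fun f x => ⟨hL f x, hN.ext_left fun y => ?_⟩
  obtain ⟨α, -, hα⟩ := (isIso_antiSwap S).exists_inverse
  rw [← hα y, ← Multiplier.mul_L, hL, ← antiSwap_mul hmul, ← antiSwap_mul hmul, Multiplier.mul_L]

end AntipodeConstruction

/-! ### Assembly of the theorem. -/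

theorem IsFaithful.exists_eq_one {H : Type*} [NonUnitalRing H] [Module ℂ H] [BornAlgebra H]
    [EssentialAlgebra H] {φ : BHom H ℂ} (hφ : IsFaithful φ) : ∃ k, φ k = 1 := by
  have := EssentialAlgebra.nontrivial (A := H)
  obtain ⟨f, hf⟩ := exists_ne (0 : H)
  by_contra h
  push Not at h
  refine hf (hφ.1 f fun g => ?_)
  by_contra hg
  exact h ((φ (f * g))⁻¹ • (f * g)) (by rw [map_smul, smul_eq_mul, inv_mul_cancel₀ hg])

/-- If the Galois maps are isomorphisms, then there exist a counit and an antipode. -/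
theorem exists_isCounitAntipode {H : Type*} [NonUnitalRing H] [Module ℂ H] [BornAlgebra H]
    [EssentialAlgebra H] (hH : HasApproximationProperty H) {Δ : EssHom H (BTensor H H)}
    (hΔ : IsComultiplication Δ) {G : GaloisMaps Δ} {φ : BHom H ℂ} (hφ : IsFaithful φ)
    (hinv : IsLeftInvariant G φ) (hγr : IsIso G.γr) (hρl : IsIso G.ρl) (hρr : IsIso G.ρr) :
    ∃ (ε : BHom H ℂ) (S : BIso H H), IsCounitAntipode G ε S := by
  have nH := hφ.isNondegenerate
  have hN := nH.tensor hH hH nH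
  obtain ⟨k, hk⟩ := hφ.exists_eq_one
  obtain ⟨ε, hl, hr⟩ :=
    exists_slice_eq_mul hN (nH.tensor₃ hH hH hH nH nH) hΔ hγr hρl hk
  have hε := isSliceCounit_of_slice_eq_mul hN nH hγr hρl hk hl hr
  obtain ⟨S, hS⟩ := exists_antipode hH nH hΔ hε hinv hk hγr hρr
  exact ⟨ε, S, hε.isCounit hN nH hγr hρl, antipode_mul hH nH hε hS hγr,
    isCoalgebraAntihom_antipode hH nH hΔ hε hS hγr hρl, hS,
    antipode_right_of_left hH nH hΔ hε hS hγr hρl⟩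

end Born

end

theorem mainTheorem3 {H : Type*} [NonUnitalRing H] [Module ℂ H] [Born.BornAlgebra H]
    [Born.EssentialAlgebra H] (hH : Born.HasApproximationProperty H)
    (Δ : Born.EssHom H (Born.BTensor H H)) (hΔ : Born.IsComultiplication Δ)
    (G : Born.GaloisMaps Δ) (φ : Born.BHom H ℂ) (hφ : Born.IsFaithful φ)
    (hinv : Born.IsLeftInvariant G φ) :
    (Born.IsBornologicalQuantumGroup Δ φ ↔
      ∃ (ε : Born.BHom H ℂ) (S : Born.BIso H H), Born.IsCounitAntipode G ε S) ∧
    ∀ (ε ε' : Born.BHom H ℂ) (S S' : Born.BIso H H), Born.IsCounitAntipode G ε S →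
      Born.IsCounitAntipode G ε' S' → ε = ε' ∧ S.toHom = S'.toHom := by
  have nH := hφ.isNondegenerate
  refine ⟨⟨fun h => ?_, fun ⟨ε, S, h⟩ => ?_⟩, fun ε ε' S S' h h' => h.unique hH nH hΔ h'⟩
  · obtain ⟨G', -, hγr, hρl, hρr, -⟩ := h.galois
    -- The quantum group comes with its own lifts `G'` of the Galois maps to `H ⊗ H`. They coincide
    -- with `G` because `H ⊗ H` embeds into its multipliers.
    obtain ⟨-, e2, e3, e4⟩ := G.eq (nH.tensor hH hH nH) G'
    exact Born.exists_isCounitAntipode hH hΔ hφ hinv (e2 ▸ hγr) (e3 ▸ hρl) (e4 ▸ hρr)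
  · obtain ⟨h1, h2, h3, h4⟩ := h.isIso hH nH hΔ
    exact ⟨hH, hΔ, ⟨G, h1, h2, h3, h4, hinv⟩, hφ⟩
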